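/- **Setting.** Work in one of three settings: schemes over a field of characteristic zero, real-analytic spaces, or complex-analytic spaces. "Coordinates" means étale, respectively analytic, local coordinates; "points" are closed points. Let $U$ be smooth of pure dimension $3$, $M$ smooth of dimension $N\ge 2$, $\sigma\colon U\to M$ a morphism, $E$ a reduced divisor on $U$ and $a\in U$. If $p\in U$ and $x=(x_1,x_2,x_3)$ are coordinates at $p$ *adapted* to $E$ (the components of $E$ through $p$ are precisely the $(x_j=0)$, $j\in S$), the logarithmic Jacobian matrix of $\sigma=(\sigma_1,\dots,\sigma_N)$ (in coordinates of $M$ at $\sigma(p)$) has entries $x_j\,\partial\sigma_i/\partial x_j$ for $j\in S$ and $\partial\sigma_i/\partial x_j$ for $j\notin S$. Let $\mathcal F_1(\sigma)_p$ be the ideal of $\mathcal O_p$ generated by its $2\times2$ minors, let $\mathcal R_p$ be the residual ideal obtained by factoring out of $\mathcal F_1(\sigma)_p$ the components of $E$ as much as possible, and let $\rho(p)\in\mathbb N\cup\{\infty\}$ be the order of $\mathcal R_p$ in the local ring $\mathcal O_p/(x_j : j\in S)$. **Prepared normal form.** $\sigma$ is in *prepared normal form* at $a$ if $0<\rho(a)<\infty$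 and there are coordinates of $U$ at $a$, vanishing at $a$ and adapted to $E$, either $(u,v)=(u_1,u_2,v)$ with $E=(u_1u_2=0)$ ($2$-point) or $(u,v,w)$ with $E=(u=0)$ ($1$-point), and coordinates of $M$ vanishing at $\sigma(a)$, such that the following hold. * $\sigma_1=u^{\alpha}$ and $\sigma_i=g_i(u)+u^{\delta}T_i$ for $i=2,\dots,N$; $u^\alpha$ divides every $\sigma_i$; $dg_i$ lies in the submodule generated by $d(u^\alpha)$; the $T_i$ are not simultaneously divisible by any component of $u$; and $\delta$ is $\mathbb Q$-linearly independent of $\alpha$ if some $T_i$ is a unit. * Let $d$ be the least order $|\gamma|$ of a partial derivative $\partial^\gamma$, in the coordinates other than those of $E$, for which $\partial^\gamma T_i$ is a unit for some $i$. Then $T_i=\widetilde T_i v^d+\sum_{j=0}^{d-1}a_{ij}v^j$, with $a_{ij}$ independent of $v$, $\widetilde T_2$ a unit and $a_{2,d-1}=0$; and the exponents of all monomials of order $\le d+|\delta|$ in the formal expansion of each $u^\delta T_i$ are linearly independent of the exponent of $u^\alpha$. * At a $2$-point: $a_{ij}=u^{r_{ij}}\tilde a_{ij}(u)$ for $1\le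 j\le d-1$, each $\tilde a_{ij}$ being zero or a unit; $a_{i_0,0}=u^\beta$ for some $i_0$; $\delta+\beta$ is linearly independent of $\alpha$; and $u^\beta$ divides all $a_{i0}$. * At a $1$-point: $a_{ij}=u^{r_{ij}}w^{s_{ij}}\tilde a_{ij}(u,w)$ for $1\le j\le d-1$, each $\tilde a_{ij}$ being zero or a unit; $a_{i_0,0}=u^\beta w$ for some $i_0$; and $u^\beta$ divides all $a_{i0}$. Let $J=\{(i,j): a_{ij}\ne0,\ 1\le j\le d-1\}$. A prepared $1$-point is *generic* if $s_{ij}=0$ for all $(i,j)\in J$. **Declared divisor and ideal.** At a $2$-point or a generic $1$-point let $D=E+(v=0)$ and $\mathcal I=(v^d,\ u^{r_{ij}}v^j\ ((i,j)\in J),\ u^\beta)$. At a non-generic $1$-point let $D=E+(v=0)+(w=0)$ and $\mathcal I=(v^d,\ u^{r_{ij}}w^{s_{ij}}v^j\ ((i,j)\in J),\ u^\beta w)$. Assume (after shrinking $U$) that $D$ is a simple normal crossings divisor on $U$. **Proposition.** Suppose that $\sigma$ is in prepared normal form at $a$, with $D$ and $\mathcal I$ as above. Let $\tau\colon\widetilde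 U\to U$ be a finite sequence of blowings-up that are combinatorial with respect to $D$, i.e. each centre is locally empty or an intersection of components of the current transform of $D$. Let $\widetilde E,\widetilde D$ be the final transforms of $E,D$, where the transform of a divisor under a blowing-up consists of the strict transforms of its components together with the exceptional divisor. Let $b\in\tau^{-1}(a)$. If $\tau^*\mathcal I$ is at $b$ a principal $\widetilde D$-monomial ideal (generated by a monomial in generators of the components of $\widetilde D$), then $\tau^*\mathcal I$ is at $b$ also a principal $\widetilde E$-monomial ideal, and $\rho(b)<\rho(a)$, where $\rho(b)$ is formed from $\sigma\circ\tau$ and $\widetilde E$. -/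

import Mathlib

open scoped Manifold ContDiff Topology
open AlgebraicGeometry CategoryTheory

noncomputable section

namespace LogFitting

universe u

/-- A common vocabulary for smooth spaces of the algebraic and of the analytic category.  It is never
quantified over: the only instances that are used are `algebraicGeometry k`, `analyticGeometry ℝ`
and `analyticGeometry ℂ` below. -/
structure Geometry where
  /-- smooth spaces of pure dimension `n` -/
  Obj : ℕ → Type (u + 1)
  Hom : ∀ {m n : ℕ}, Obj m → Obj n → Type u
  id : ∀ {n : ℕ} (X : Obj n), Hom X X
  comp : ∀ {l m n : ℕ} {X : Obj l} {Y : Obj m} {Z : Obj n}, Hom X Y → Hom Y Z → Hom X Z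
  Pt : ∀ {n : ℕ}, Obj n → Type u
  top : ∀ {n : ℕ} (X : Obj n), TopologicalSpace (Pt X)
  /-- the local ring `𝒪_{X,p}` -/
  Stalk : ∀ {n : ℕ} (X : Obj n), Pt X → Type u
  commRing : ∀ {n : ℕ} (X : Obj n) (p : Pt X), CommRing (Stalk X p)
  isLocal : ∀ {n : ℕ} (X : Obj n) (p : Pt X), IsLocalRing (Stalk X p)
  /-- the constants of the ground field inside `𝒪_{X,p}` -/
  scalars : ∀ {n : ℕ} (X : Obj n) (p : Pt X), Set (Stalk X p)
  /-- regular (analytic) functions on an open set, and their germs -/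
  Sec : ∀ {n : ℕ} (X : Obj n), TopologicalSpace.Opens (Pt X) → Type u
  germ : ∀ {n : ℕ} (X : Obj n) (V : TopologicalSpace.Opens (Pt X)), Sec X V →
    ∀ p : Pt X, p ∈ V → Stalk X p
  map : ∀ {m n : ℕ} {X : Obj m} {Y : Obj n}, Hom X Y → Pt X → Pt Y
  /-- pull-back of germs -/
  pull : ∀ {m n : ℕ} {X : Obj m} {Y : Obj n} (f : Hom X Y) (p : Pt X),
    Stalk Y (map f p) →+* Stalk X p
  IsProper : ∀ {m n : ℕ} {X : Obj m} {Y : Obj n}, Hom X Y → Prop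

attribute [instance] Geometry.top Geometry.commRing Geometry.isLocal

/-! ### The analytic category -/

section Analytic

variable (𝕜 : Type) [RCLike 𝕜]

/-- Hausdorff `𝕜`-analytic manifolds of dimension `n`. -/
structure AnalyticManifold (n : ℕ) : Type (u + 1) where
  carrier : Type u
  [top : TopologicalSpace carrier]
  [t2 : T2Space carrier]
  [charted : ChartedSpace (Fin n → 𝕜) carrier]
  [isManifold : IsManifold 𝓘(𝕜, Fin n → 𝕜) ω carrier]

attribute [instance] AnalyticManifold.top AnalyticManifold.t2 AnalyticManifold.charted
  AnalyticManifold.isManifold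

variable {𝕜}

/-- The ring of germs at `p` of `𝕜`-valued analytic functions. -/
def analyticStalk {n : ℕ} (X : AnalyticManifold.{u} 𝕜 n) (p : X.carrier) :
    Subring (Filter.Germ (𝓝 p) 𝕜) where
  carrier := {φ | ∃ f : X.carrier → 𝕜,
    ContMDiffAt 𝓘(𝕜, Fin n → 𝕜) 𝓘(𝕜) ω f p ∧ (f : Filter.Germ (𝓝 p) 𝕜) = φ}
  mul_mem' := by
    rintro _ _ ⟨f, hf, rfl⟩ ⟨g, hg, rfl⟩
    exact ⟨f * g, hf.mul hg, rfl⟩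
  one_mem' := ⟨1, contMDiffAt_const, rfl⟩
  add_mem' := by
    rintro _ _ ⟨f, hf, rfl⟩ ⟨g, hg, rfl⟩
    exact ⟨f + g, hf.add hg, rfl⟩
  zero_mem' := ⟨0, contMDiffAt_const, rfl⟩
  neg_mem' := by
    rintro _ ⟨f, hf, rfl⟩
    exact ⟨-f, hf.neg, rfl⟩

theorem analyticStalk_isUnit_iff {n : ℕ} (X : AnalyticManifold.{u} 𝕜 n) (p : X.carrier)
    (φ : analyticStalk X p) : IsUnit φ ↔ φ.1.value ≠ 0 := by
  constructor
  · intro hφ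
    obtain ⟨ψ, hψ⟩ := hφ.exists_right_inv
    obtain ⟨_, f, hf, rfl⟩ := φ
    obtain ⟨_, g, hg, rfl⟩ := ψ
    have h1 : f p * g p = 1 :=
      congrArg (fun φ : analyticStalk X p => φ.1.value) hψ
    exact left_ne_zero_of_mul_eq_one h1
  · obtain ⟨_, f, hf, rfl⟩ := φ
    intro h
    have h' : f p ≠ 0 := h
    refine IsUnit.of_mul_eq_one (⟨_, fun x => (f x)⁻¹, hf.inv₀ h', rfl⟩ : analyticStalk X p) ?_
    apply Subtype.ext
    change ((f * fun x => (f x)⁻¹ : X.carrier → 𝕜) : Filter.Germ (𝓝 p) 𝕜)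
      = ((1 : X.carrier → 𝕜) : Filter.Germ (𝓝 p) 𝕜)
    rw [Filter.Germ.coe_eq]
    filter_upwards [hf.continuousAt.eventually_ne h'] with x hx
    simp [hx]

theorem analyticStalk_isLocalRing {n : ℕ} (X : AnalyticManifold.{u} 𝕜 n) (p : X.carrier) :
    IsLocalRing (analyticStalk X p) := by
  have : Nontrivial (analyticStalk X p) := by
    refine ⟨⟨0, 1, fun h => ?_⟩⟩
    have h1 : (0 : Filter.Germ (𝓝 p) 𝕜).value = (1 : Filter.Germ (𝓝 p) 𝕜).value :=
      congrArg (fun φ : analyticStalk X p => φ.1.value) h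
    exact zero_ne_one (α := 𝕜) h1
  refine IsLocalRing.of_nonunits_add fun a b ha hb => ?_
  rw [mem_nonunits_iff, analyticStalk_isUnit_iff, not_not] at *
  obtain ⟨_, f, hf, rfl⟩ := a
  obtain ⟨_, g, hg, rfl⟩ := b
  have ha' : f p = 0 := ha
  have hb' : g p = 0 := hb
  change f p + g p = 0
  rw [ha', hb', add_zero]

/-- Composition of germs with an analytic map. -/
def analyticPull {m n : ℕ} {X : AnalyticManifold.{u} 𝕜 m} {Y : AnalyticManifold.{u} 𝕜 n}
    (f : X.carrier → Y.carrier)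
    (hf : ContMDiff 𝓘(𝕜, Fin m → 𝕜) 𝓘(𝕜, Fin n → 𝕜) ω f) (p : X.carrier) :
    analyticStalk Y (f p) →+* analyticStalk X p where
  toFun φ := ⟨φ.1.compTendsto f hf.continuous.continuousAt, by
    obtain ⟨_, g, hg, rfl⟩ := φ
    exact ⟨g ∘ f, hg.comp p (hf p), rfl⟩⟩
  map_one' := rfl
  map_zero' := rfl
  map_mul' := by
    rintro ⟨_, g, hg, rfl⟩ ⟨_, g', hg', rfl⟩
    rfl
  map_add' := by
    rintro ⟨_, g, hg, rfl⟩ ⟨_, g', hg', rfl⟩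
    rfl

variable (𝕜)

/-- Smooth analytic spaces over `𝕜 = ℝ` or `ℂ`. -/
def analyticGeometry : Geometry.{u} where
  Obj n := AnalyticManifold.{u} 𝕜 n
  Hom {m n} X Y := {f : X.carrier → Y.carrier //
    ContMDiff 𝓘(𝕜, Fin m → 𝕜) 𝓘(𝕜, Fin n → 𝕜) ω f}
  id _ := ⟨fun x => x, contMDiff_id⟩
  comp f g := ⟨g.1 ∘ f.1, g.2.comp f.2⟩
  Pt X := X.carrier
  top X := X.top
  Stalk X p := analyticStalk X p
  commRing _ _ := inferInstance
  isLocal X p := analyticStalk_isLocalRing X p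
  scalars _ _ := {φ | ∃ c : 𝕜, φ.1 = Filter.Germ.const c}
  Sec {n} X V := {f : X.carrier → 𝕜 // ContMDiffOn 𝓘(𝕜, Fin n → 𝕜) 𝓘(𝕜) ω f V}
  germ _ V f p hp := ⟨(f.1 : Filter.Germ (𝓝 p) 𝕜), f.1,
    (f.2 p hp).contMDiffAt (V.isOpen.mem_nhds hp), rfl⟩
  map f p := f.1 p
  pull f p := analyticPull f.1 f.2 p
  IsProper f := IsProperMap f.1

end Analytic

/-! ### The algebraic category -/

/-- Smooth schemes over a field `k`, with `k`-morphisms. -/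
def algebraicGeometry (k : Type u) [Field k] : Geometry.{u} where
  Obj n := {X : Over (Spec (CommRingCat.of k)) // SmoothOfRelativeDimension n X.hom}
  Hom X Y := X.1 ⟶ Y.1
  id X := 𝟙 X.1
  comp f g := f ≫ g
  Pt X := X.1.left
  top _ := inferInstance
  Stalk X p := X.1.left.presheaf.stalk p
  commRing _ _ := inferInstance
  isLocal _ _ := inferInstance
  scalars X p := Set.range fun c : k =>
    (X.1.left.presheaf.germ ⊤ p trivial).hom
      (X.1.hom.appTop.hom ((Scheme.ΓSpecIso (CommRingCat.of k)).inv.hom c))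
  Sec X V := Γ(X.1.left, V)
  germ X V s p hp := (X.1.left.presheaf.germ V p hp).hom s
  map f p := f.left p
  pull f p := (f.left.stalkMap p).hom
  IsProper f := AlgebraicGeometry.IsProper f.left

/-- The three settings: algebraic over a field of characteristic zero, real-analytic,
complex-analytic. -/
inductive Setting : Type (u + 1)
  | algebraic (k : Type u) [Field k] [CharZero k]
  | realAnalytic
  | complexAnalytic

/-- The smooth spaces of a setting. -/
def Setting.geometry : Setting.{u} → Geometry.{u}
  | @Setting.algebraic k _ _ => algebraicGeometry k
  | .realAnalytic => analyticGeometry ℝ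
  | .complexAnalytic => analyticGeometry ℂ

/-! ### Coordinates, divisors, blowings-up -/

variable {G : Geometry.{u}}

/-- Pull-back of germs, with the image point named. -/
def pullAt {m n : ℕ} {X : G.Obj m} {Y : G.Obj n} (f : G.Hom X Y) {p : G.Pt X} {q : G.Pt Y}
    (h : G.map f p = q) : G.Stalk Y q →+* G.Stalk X p :=
  h ▸ G.pull f p

/-- A system of (étale or analytic) local coordinates `x 0, …, x (n-1)` at `p`, together with its
partial derivatives `∂ j`.  The coordinates are not required to vanish at `p`. -/
structure Coord {n : ℕ} (X : G.Obj n) (p : G.Pt X) where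
  x : Fin n → G.Stalk X p
  pd : Fin n → Derivation ℤ (G.Stalk X p) (G.Stalk X p)
  pd_scalar : ∀ j, ∀ c ∈ G.scalars X p, pd j c = 0
  pd_x : ∀ i j, pd i (x j) = if i = j then 1 else 0
  /-- the partial derivatives form a basis of the derivations of `𝒪_{X,p}` over the ground field -/
  pd_unique : ∀ D : Derivation ℤ (G.Stalk X p) (G.Stalk X p),
    (∀ c ∈ G.scalars X p, D c = 0) → (∀ j, D (x j) = 0) → D = 0

namespace Coord

variable {n : ℕ} {X : G.Obj n} {p : G.Pt X}

/-- The coordinates vanish at `p` (`p = 0`): they generate the maximal ideal of `𝒪_{X,p}`. -/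
def Centred (c : Coord X p) : Prop :=
  Ideal.span (Set.range c.x) = IsLocalRing.maximalIdeal (G.Stalk X p)

/-- The monomial `x^γ`. -/
def mono (c : Coord X p) (γ : Fin n → ℕ) : G.Stalk X p := ∏ j, c.x j ^ γ j

/-- The iterated partial derivative `∂^γ f`, in dimension three. -/
def iter {X : G.Obj 3} {p : G.Pt X} (c : Coord X p) (γ : Fin 3 → ℕ) (f : G.Stalk X p) :
    G.Stalk X p :=
  (c.pd 0)^[γ 0] ((c.pd 1)^[γ 1] ((c.pd 2)^[γ 2] f))

end Coord

/-- An ideal sheaf (equivalently, a closed subspace), given by its stalks. -/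
abbrev IdealFamily {n : ℕ} (X : G.Obj n) : Type u := ∀ p : G.Pt X, Ideal (G.Stalk X p)

/-- A reduced divisor is given by the set of the ideal sheaves of its components.  The coordinates
`c` at `p` are adapted to the divisor `E`, with index set `S`, if the components of `E` through `p`
are precisely the hypersurfaces `(x i = 0)`, `i ∈ S`. -/
def Adapted {n : ℕ} {X : G.Obj n} (E : Set (IdealFamily X)) (p : G.Pt X) (c : Coord X p)
    (S : Finset (Fin n)) : Prop :=
  ∃ e : {i // i ∈ S} ≃ {H : IdealFamily X // H ∈ E ∧ H p ≠ ⊤},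
    ∀ i, (e i).1 p = Ideal.span {c.x i.1}

/-- `D` is a simple normal crossings divisor. -/
structure IsSNC {n : ℕ} {X : G.Obj n} (D : Set (IdealFamily X)) : Prop where
  /-- every component is a hypersurface, given locally by one equation -/
  locally_principal : ∀ H ∈ D, ∀ p : G.Pt X, ∃ (V : TopologicalSpace.Opens (G.Pt X)) (_ : p ∈ V)
    (f : G.Sec X V), ∀ (q : G.Pt X) (hq : q ∈ V), H q = Ideal.span {G.germ X V f q hq}
  locally_finite : ∀ p : G.Pt X, ∃ V ∈ 𝓝 p, {H ∈ D | ∃ q ∈ V, H q ≠ ⊤}.Finite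
  /-- the components are smooth and meet transversely -/
  adapted : ∀ p : G.Pt X, ∃ (c : Coord X p) (S : Finset (Fin n)), Adapted D p c S

/-- The ideal `J` of `𝒪_{X,p}` is generated by a monomial in generators of the components of `E`. -/
def IsPrincipalMonomial {n : ℕ} {X : G.Obj n} (E : Set (IdealFamily X)) (p : G.Pt X)
    (J : Ideal (G.Stalk X p)) : Prop :=
  ∃ (c : Coord X p) (S : Finset (Fin n)), Adapted E p c S ∧
    ∃ γ : Fin n → ℕ, (∀ j ∉ S, γ j = 0) ∧ J = Ideal.span {c.mono γ}

/-- `C` is (locally, on `X`) empty or an intersection of components of `D`. -/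
def IsCombinatorialCentre {n : ℕ} {X : G.Obj n} (D : Set (IdealFamily X)) (C : IdealFamily X) :
    Prop :=
  ∀ p : G.Pt X, ∃ V ∈ 𝓝 p, (∀ q ∈ V, C q = ⊤) ∨
    ∃ T ⊆ D, T.Nonempty ∧ ∀ q ∈ V, C q = ⨆ H ∈ T, H q

/-- `β` is the blowing-up of the smooth centre `C`: it is proper, an isomorphism over the complement
of `C` (a proper map that is bijective there, with isomorphisms of local rings), and, if `C = (x i = 0, i ∈ K)` in local coordinates at the image of `b`, then `b` belongs to
an "`x i`-chart", `i ∈ K`, with coordinates `x' i = x i`, `x' j = x j / x i` for the remaining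
`j ∈ K`, and `x' j = x j` for `j ∉ K`. -/
structure IsBlowup {n : ℕ} {X' X : G.Obj n} (β : G.Hom X' X) (C : IdealFamily X) : Prop where
  proper : G.IsProper β
  bijective_off : ∀ p : G.Pt X, C p = ⊤ → ∃! b : G.Pt X', G.map β b = p
  iso_off : ∀ b : G.Pt X', C (G.map β b) = ⊤ → Function.Bijective (G.pull β b)
  chart : ∀ (b : G.Pt X') (c : Coord X (G.map β b)) (K : Finset (Fin n)),
    C (G.map β b) ≠ ⊤ → C (G.map β b) = Ideal.span (c.x '' K) →
    ∃ i ∈ K, ∃ c' : Coord X' b,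
      c'.x i = G.pull β b (c.x i) ∧
      (∀ j ∈ K, j ≠ i → G.pull β b (c.x j) = G.pull β b (c.x i) * c'.x j) ∧
      (∀ j ∉ K, c'.x j = G.pull β b (c.x j))

/-- The exceptional divisor of the blowing-up `β` with centre `C`. -/
def exceptional {n : ℕ} {X' X : G.Obj n} (β : G.Hom X' X) (C : IdealFamily X) : IdealFamily X' :=
  fun b => (C (G.map β b)).map (G.pull β b)

/-- The strict transform of `H`: the total transform, saturated by the exceptional divisor. -/
def strictTransform {n : ℕ} {X' X : G.Obj n} (β : G.Hom X' X) (C H : IdealFamily X) :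
    IdealFamily X' :=
  fun b => ⨆ m : ℕ, ((H (G.map β b)).map (G.pull β b)).colon
    ((exceptional β C b ^ m : Ideal (G.Stalk X' b)) : Set (G.Stalk X' b))

/-- The transform of a divisor: the strict transforms of its components, and the exceptional
divisor. -/
def transform {n : ℕ} {X' X : G.Obj n} (β : G.Hom X' X) (C : IdealFamily X)
    (E : Set (IdealFamily X)) : Set (IdealFamily X') :=
  insert (exceptional β C) (strictTransform β C '' E)

/-- `τ : Y → X` is a finite sequence of blowings-up that are combinatorial with respect to `D`, and
`E'`, `D'` are the transforms of the divisors `E`, `D`. -/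
inductive BlowupSequence {n : ℕ} {X : G.Obj n} (E D : Set (IdealFamily X)) :
    {Y : G.Obj n} → G.Hom Y X → Set (IdealFamily Y) → Set (IdealFamily Y) → Prop
  | nil : BlowupSequence E D (G.id X) E D
  | cons {Y Z : G.Obj n} (τ : G.Hom Y X) (E' D' : Set (IdealFamily Y)) (β : G.Hom Z Y)
      (C : IdealFamily Y) : BlowupSequence E D τ E' D' → IsCombinatorialCentre D' C →
      IsBlowup β C → BlowupSequence E D (G.comp β τ) (transform β C E') (transform β C D')

/-! ### Logarithmic Fitting ideals and the invariant `ρ` -/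

section Fitting

variable {n N : ℕ} {X : G.Obj n} {p : G.Pt X}

/-- The logarithmic Jacobian matrix of `σ = (σ 0, …, σ (N-1))`. -/
def logJac (c : Coord X p) (S : Finset (Fin n)) (σ : Fin N → G.Stalk X p) :
    Matrix (Fin N) (Fin n) (G.Stalk X p) :=
  Matrix.of fun i j => if j ∈ S then c.x j * c.pd j (σ i) else c.pd j (σ i)

/-- The logarithmic Fitting ideal `ℱ_k(σ)_p`, generated by the minors of order `n - k`. -/
def logFitting (k : ℕ) (c : Coord X p) (S : Finset (Fin n)) (σ : Fin N → G.Stalk X p) :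
    Ideal (G.Stalk X p) :=
  Ideal.span {f | ∃ (R : Fin (n - k) → Fin N) (Q : Fin (n - k) → Fin n),
    f = ((logJac c S σ).submatrix R Q).det}

/-- The largest power of `(x j = 0)` that divides the ideal `F`. -/
def multiplicity (c : Coord X p) (F : Ideal (G.Stalk X p)) (j : Fin n) : ℕ :=
  sSup {m : ℕ | F ≤ Ideal.span {c.x j ^ m}}

/-- The residual ideal of `F`, after factoring out the components of the divisor
`(∏_{j ∈ S} x j = 0)` as much as possible.  (It is `0` if `F = 0`.) -/
def residual (c : Coord X p) (S : Finset (Fin n)) (F : Ideal (G.Stalk X p)) :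
    Ideal (G.Stalk X p) :=
  F.colon {∏ j ∈ S, c.x j ^ multiplicity c F j}

/-- The invariant `ρ_k(p)`: the order of the residual ideal of `ℱ_k(σ)_p` in the local ring of the
stratum `(x j = 0, j ∈ S)`. -/
def rhoAt (k : ℕ) (c : Coord X p) (S : Finset (Fin n)) (σ : Fin N → G.Stalk X p) : ℕ∞ :=
  let q := Ideal.Quotient.mk (Ideal.span (c.x '' S))
  ⨆ (m : ℕ) (_ : (residual c S (logFitting k c S σ)).map q ≤
    (IsLocalRing.maximalIdeal (G.Stalk X p)).map q ^ m), (m : ℕ∞)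

end Fitting

/-- `ρ(p) = ρ_1(p)` for a morphism `σ` from a three-dimensional space to a smooth space `M`, in the
coordinates `c` at `p` (the divisor being `(x j = 0, j ∈ S)`) and `z` at the image of `p`.  It does
not depend on the choice of adapted coordinates `c` and of `z`. -/
def rho {N : ℕ} {X : G.Obj 3} {M : G.Obj N} (σ : G.Hom X M) (p : G.Pt X) (c : Coord X p)
    (S : Finset (Fin 3)) (z : Coord M (G.map σ p)) : ℕ∞ :=
  rhoAt 1 c S fun i => G.pull σ p (z.x i)

/-! ### Prepared normal form -/

/-- Exponents that are linearly independent over `ℚ`. -/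
def Indep {n : ℕ} (α γ : Fin n → ℕ) : Prop :=
  LinearIndependent ℚ ![fun j => (α j : ℚ), fun j => (γ j : ℚ)]

/-- 2-points and 1-points. -/
inductive PointKind
  | two
  | one

/-- The adapted coordinates are written `x 0, x 1, x 2 = u₁, u₂, v` at a 2-point, and
`x 0, x 1, x 2 = u, w, v` at a 1-point; the divisor is `(u₁ u₂ = 0)`, respectively `(u = 0)`. -/
def PointKind.S : PointKind → Finset (Fin 3)
  | .two => {0, 1}
  | .one => {0}

/-- A presentation of `σ : (X, E) → M`, `dim X = 3`, `dim M = r + 2`, in prepared normal form at `a`.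
The components of `σ` are numbered from `0`: the index `0` stands for `σ₁`, and `i : Fin (r + 1)`
stands for the index `i + 2` of the components `σ₂, …, σ_N`. -/
structure PreparedForm {r : ℕ} {X : G.Obj 3} {M : G.Obj (r + 2)} (E : Set (IdealFamily X))
    (σ : G.Hom X M) (a : G.Pt X) where
  kind : PointKind
  /-- adapted coordinates of `X` at `a` -/
  c : Coord X a
  c_centred : c.Centred
  c_adapted : Adapted E a c kind.S
  /-- coordinates of `M` at `σ(a)` -/
  z : Coord M (G.map σ a)
  z_centred : z.Centred
  rho_pos : 0 < rho σ a c kind.S z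
  rho_lt_top : rho σ a c kind.S z < ⊤
  /-- `σ₁ = u^α` and `σ_i = g_i(u) + u^δ T_i` -/
  α : Fin 3 → ℕ
  δ : Fin 3 → ℕ
  g : Fin (r + 1) → G.Stalk X a
  T : Fin (r + 1) → G.Stalk X a
  α_support : ∀ j ∉ kind.S, α j = 0
  δ_support : ∀ j ∉ kind.S, δ j = 0
  g_of_u : ∀ i, ∀ j ∉ kind.S, c.pd j (g i) = 0
  first : G.pull σ a (z.x 0) = c.mono α
  other : ∀ i : Fin (r + 1), G.pull σ a (z.x i.succ) = g i + c.mono δ * T i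
  dvd : ∀ i, c.mono α ∣ G.pull σ a (z.x i)
  /-- `dg_i` belongs to the submodule generated by `d(u^α)` -/
  dg_mem : ∀ i, ∃ h, ∀ j, c.pd j (g i) = h * c.pd j (c.mono α)
  T_not_dvd : ∀ j ∈ kind.S, ∃ i, ¬ c.x j ∣ T i
  δ_indep : (∃ i, IsUnit (T i)) → Indep α δ
  /-- `d = d(a)` -/
  d : ℕ
  d_least : IsLeast {m | ∃ (i : Fin (r + 1)) (γ : Fin 3 → ℕ), (∀ j ∈ kind.S, γ j = 0) ∧
    ∑ j, γ j = m ∧ IsUnit (c.iter γ (T i))} d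
  /-- Weierstrass form `T_i = T̃_i v^d + ∑_{j < d} a_{ij} v^j`, with `a_{ij}` independent of `v` -/
  Ttilde : Fin (r + 1) → G.Stalk X a
  coeff : Fin (r + 1) → ℕ → G.Stalk X a
  coeff_indep_v : ∀ i, ∀ j < d, c.pd 2 (coeff i j) = 0
  weierstrass : ∀ i, T i = Ttilde i * c.x 2 ^ d + ∑ j ∈ Finset.range d, coeff i j * c.x 2 ^ j
  isUnit_Ttilde : IsUnit (Ttilde 0)
  coeff_pred : ∀ j, j + 1 = d → coeff 0 j = 0
  /-- the monomials of order `≤ d + |δ|` of the formal expansion of `u^δ T_i` are linearly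
  independent of `u^α` -/
  expansion_indep : ∀ (i : Fin (r + 1)) (γ : Fin 3 → ℕ), ∑ j, γ j ≤ d + ∑ j, δ j →
    IsUnit (c.iter γ (c.mono δ * T i)) → Indep α γ
  /-- `a_{ij} = u^{r_{ij}} ã_{ij}`, respectively `a_{ij} = u^{r_{ij}} w^{s_{ij}} ã_{ij}`, for
  `1 ≤ j ≤ d - 1`; here `expo i j` is `r_{ij}`, respectively `(r_{ij}, s_{ij})` -/
  expo : Fin (r + 1) → ℕ → Fin 3 → ℕ
  atilde : Fin (r + 1) → ℕ → G.Stalk X a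
  expo_v : ∀ i j, expo i j 2 = 0
  atilde_indep_v : ∀ i j, c.pd 2 (atilde i j) = 0
  atilde_zero_or_unit : ∀ i j, atilde i j = 0 ∨ IsUnit (atilde i j)
  coeff_eq : ∀ i j, 1 ≤ j → j < d → coeff i j = c.mono (expo i j) * atilde i j
  /-- `a_{i₀,0} = u^β`, respectively `a_{i₀,0} = u^β w` -/
  β : Fin 3 → ℕ
  β_support : ∀ j ∉ kind.S, β j = 0
  i₀ : Fin (r + 1)
  coeff_zero : coeff i₀ 0 = c.mono β * (match kind with
    | .two => 1
    | .one => c.x 1)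
  β_indep : kind = .two → Indep α (δ + β)
  β_dvd : ∀ i, c.mono β ∣ coeff i 0

namespace PreparedForm

variable {r : ℕ} {X : G.Obj 3} {M : G.Obj (r + 2)} {E : Set (IdealFamily X)} {σ : G.Hom X M}
  {a : G.Pt X}

/-- The value `ρ(a)`. -/
def rhoValue (P : PreparedForm E σ a) : ℕ∞ := rho σ a P.c P.kind.S P.z

/-- The index set `J = {(i,j) : a_{ij} ≠ 0, j = 1, …, d - 1}`. -/
def J (P : PreparedForm E σ a) : Set (Fin (r + 1) × ℕ) :=
  {ij | 1 ≤ ij.2 ∧ ij.2 < P.d ∧ P.coeff ij.1 ij.2 ≠ 0}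

/-- `a` is a non-generic prepared 1-point: not all `s_{ij}` are zero. -/
def NonGeneric (P : PreparedForm E σ a) : Prop :=
  P.kind = .one ∧ ∃ ij ∈ P.J, P.expo ij.1 ij.2 1 ≠ 0

/-- The monomial ideal `ℐ = ℐ(σ, a)`. -/
def declaredIdeal (P : PreparedForm E σ a) : Ideal (G.Stalk X a) :=
  Ideal.span ({P.c.x 2 ^ P.d} ∪
    {f | ∃ ij ∈ P.J, f = P.c.mono (P.expo ij.1 ij.2) * P.c.x 2 ^ ij.2} ∪
    {f | (P.NonGeneric ∧ f = P.c.mono P.β * P.c.x 1) ∨ (¬ P.NonGeneric ∧ f = P.c.mono P.β)})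

/-- `D` is the declared exceptional divisor: `D = E + (v = 0)`, or `D = E + (v = 0) + (w = 0)` at a
non-generic 1-point. -/
def IsDeclaredDivisor (P : PreparedForm E σ a) (D : Set (IdealFamily X)) : Prop :=
  (P.NonGeneric ∧ ∃ V W : IdealFamily X, V a = Ideal.span {P.c.x 2} ∧
    W a = Ideal.span {P.c.x 1} ∧ D = insert V (insert W E)) ∨
  (¬ P.NonGeneric ∧ ∃ V : IdealFamily X, V a = Ideal.span {P.c.x 2} ∧ D = insert V E)

end PreparedForm

end LogFitting

end

open LogFitting

noncomputable section

namespace LogFitting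

universe u

section

/-! ### Derivations of local rings -/

section Rings

variable {O : Type*} [CommRing O]

/-! Write `𝔪` for the maximal ideal of the local ring in question. Over `a`, the point `b` has
coordinates in which those at `a` are monomials, with an exponent matrix `A` that is invertible over
the integers (`BlowupSequence.nonempty_monomialChart`). Hence each field `x_j ∂/∂x_j` lifts to a
field `theta j` at `b` tangent to every component of the transformed divisors, and it multiplies the
pull-back of `x^η` by `η_j`. Let `x^γ` generate the pull-back of the declared ideal. A component of
`D'` outside `E'` can only come from `v = 0` or `w = 0`. Some generator does not involve `v` and
another does not involve `w`, so `x^γ` is a monomial in `E'` alone.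

The Fitting ideal is generated by minors `D₁f D₂g - D₂f D₁g` with `D₁, D₂` tangent to the divisor
(`logFitting_eq_minorIdeal`), so coordinates can be chosen freely. Since `dg_i` is a multiple of
`d(u^α)` and `u^α` divides `u^δ`, these minors reduce to the values `X(u^δ T_i)` for tangent fields
`X` with `X(u^α) = 0`. At `b` all such values are divisible by `u^δ x^γ` (`exists_deriv_mul_T`), so
the Fitting ideal is contained in `(w)` with `w = u^α u^δ x^γ`. If some `X(u^δ T_i) = u^δ x^γ f`,
then `w f` belongs to the Fitting ideal. The residual ideal then contains `f`, provided that `f`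
does not vanish identically on the stratum. So `ρ(b)` is at most the order of `f` there.

It remains to find `f` of order less than some `m ≤ ρ(a)` (`exists_low_order`), where `ρ(a) ≥ 1` by
assumption and `ρ(a) ≥ d - 1` by `le_rhoValue`. Up to a unit, `x^γ` is the pull-back of one
generator. If that generator is `v^d` or `u^r w^s v^j`, take `X = theta 2`, the lift of `v ∂/∂v`: it
replaces the terms of `T_i / x^γ` by their multiples by the degree `j` in `v`. These are
eigenvectors with distinct eigenvalues modulo the ideal of the stratum of `D'`, and one of them is a
unit. A sum of `m` such terms lies outside `𝔪^m` on the stratum (`sum_eigen_notMem`). The term `j =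
0` is lost to differentiation. A further term is lost either because `a_{2,d-1} = 0` or because `v^d
/ x^γ` vanishes on the stratum, which leaves `d - 1` terms (one if `d = 1`). If the generator is the
last one, `u^β` or `u^β w`, a different field that kills `u^α` makes `f` a unit.

All of this uses only the properties in `Geometry.IsRegular`. In the analytic case they follow from
Hadamard's lemma and the inverse function theorem, in the algebraic case from formal smoothness of
the local rings and Krull's intersection theorem. -/

theorem derivation_mem_of_mem_pow_succ (D : Derivation ℤ O O) (I : Ideal O) (n : ℕ) {f : O}
    (hf : f ∈ I ^ (n + 1)) : D f ∈ I ^ n := by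
  induction n generalizing f with
  | zero => simp
  | succ n ih =>
    rw [pow_succ] at hf
    refine Submodule.mul_induction_on hf (fun a ha b hb => ?_) (fun a b ha hb => ?_)
    · rw [D.leibniz, smul_eq_mul, smul_eq_mul]
      refine add_mem (Ideal.mul_mem_right _ _ ha) ?_
      rw [mul_comm, pow_succ]
      exact Ideal.mul_mem_mul (ih ha) hb
    · rw [map_add]
      exact add_mem ha hb

theorem derivation_mem_span {D : Derivation ℤ O O} {s : Set O}
    (h : ∀ a ∈ s, D a ∈ Ideal.span s) {f : O} (hf : f ∈ Ideal.span s) : D f ∈ Ideal.span s := by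
  induction hf using Submodule.span_induction with
  | mem x hx => exact h x hx
  | zero => simp
  | add x y _ _ hx hy => rw [map_add]; exact add_mem hx hy
  | smul a x hx' hx =>
    rw [smul_eq_mul, D.leibniz, smul_eq_mul, smul_eq_mul]
    exact add_mem (Ideal.mul_mem_left _ _ hx) (Ideal.mul_mem_right _ _ hx')

theorem pow_sup_le (I J : Ideal O) {m n : ℕ} (h : m ≤ n) : I ^ n ⊔ J ≤ I ^ m ⊔ J :=
  sup_le_sup (Ideal.pow_le_pow_right h) le_rfl

theorem derivation_mem_pow_sup {D : Derivation ℤ O O} {I J : Ideal O}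
    (hJ : ∀ a ∈ J, D a ∈ J) (n : ℕ) {f : O} (hf : f ∈ I ^ (n + 1) ⊔ J) : D f ∈ I ^ n ⊔ J := by
  obtain ⟨a, ha, b, hb, rfl⟩ := Submodule.mem_sup.1 hf
  rw [map_add]
  exact add_mem (Ideal.mem_sup_left (derivation_mem_of_mem_pow_succ D I n ha))
    (Ideal.mem_sup_right (hJ b hb))

theorem not_isUnit_mem_of_sum_eigen [IsLocalRing O] (hZ : ∀ n : ℤ, n ≠ 0 → IsUnit (n : O))
    (D : Derivation ℤ O O) {J : Ideal O} (hJ : ∀ a ∈ J, D a ∈ J)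
    (hJm : J ≤ IsLocalRing.maximalIdeal O) {ι : Type*} [DecidableEq ι] (ε : ι → ℤ) (j : ι)
    (F : Finset ι) (hjF : j ∉ F) (hε : Set.InjOn ε (insert j F : Finset ι)) (y : ι → O)
    (hy : ∀ i ∈ insert j F, D (y i) - ε i * y i ∈ J)
    (h : ∑ i ∈ insert j F, y i ∈ IsLocalRing.maximalIdeal O ^ (F.card + 1) ⊔ J) :
    y j ∈ IsLocalRing.maximalIdeal O := by
  induction F using Finset.induction_on generalizing y with
  | empty =>
    simp only [insert_empty_eq, Finset.sum_singleton, Finset.card_empty, zero_add, pow_one] at h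
    rwa [sup_eq_left.2 hJm] at h
  | insert a F haF ih =>
    have haj : a ≠ j := by rintro rfl; simp at hjF
    have hjF' : j ∉ F := fun h => hjF (Finset.mem_insert_of_mem h)
    have hsub : insert j F ⊆ insert j (insert a F) :=
      Finset.insert_subset_insert _ (Finset.subset_insert _ _)
    -- The operator `D - ε a` removes the term `a` modulo `J` and multiplies every other term by `ε
    -- i - ε a`, at the cost of one power of the maximal ideal.
    have key := ih hjF' (hε.mono (by exact_mod_cast hsub)) (fun i => ((ε i - ε a : ℤ) : O) * y i)
      (fun i hi => ?_) ?_
    · have h1 : ε j - ε a ≠ 0 := by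
        intro h0
        exact haj (hε (by simp) (by simp) (by omega))
      exact ((IsLocalRing.maximalIdeal.isMaximal O).isPrime.mem_or_mem key).resolve_left
        fun hmem => (IsLocalRing.mem_maximalIdeal _).1 hmem (hZ _ h1)
    · have : D (((ε i - ε a : ℤ) : O) * y i) - ε i * (((ε i - ε a : ℤ) : O) * y i)
          = ((ε i - ε a : ℤ) : O) * (D (y i) - ε i * y i) := by
        rw [D.leibniz, D.map_intCast]; simp; ring
      rw [this]
      exact Ideal.mul_mem_left _ _ (hy i (hsub hi))
    · rw [Finset.card_insert_of_notMem haF] at h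
      have h1 : D (∑ i ∈ insert j (insert a F), y i) - ε a * (∑ i ∈ insert j (insert a F), y i)
          ∈ IsLocalRing.maximalIdeal O ^ (F.card + 1) ⊔ J :=
        sub_mem (derivation_mem_pow_sup hJ _ h) (Ideal.mul_mem_left _ _
          (pow_sup_le _ _ (Nat.le_succ _) h))
      have h2 : D (∑ i ∈ insert j (insert a F), y i) - ε a * (∑ i ∈ insert j (insert a F), y i)
          = ∑ i ∈ insert j (insert a F), (D (y i) - ε i * y i)
            + ∑ i ∈ insert j (insert a F), ((ε i - ε a : ℤ) : O) * y i := by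
        rw [map_sum, Finset.mul_sum, ← Finset.sum_sub_distrib, ← Finset.sum_add_distrib]
        refine Finset.sum_congr rfl fun i _ => ?_
        push_cast; ring
      have h3 : ∑ i ∈ insert j (insert a F), ((ε i - ε a : ℤ) : O) * y i
          = ∑ i ∈ insert j F, ((ε i - ε a : ℤ) : O) * y i := by
        rw [Finset.insert_comm, Finset.sum_insert (by simp [haj, haF])]
        simp
      rw [h2, h3] at h1
      refine (Submodule.add_mem_iff_right _ (Ideal.mem_sup_right ?_)).1 h1
      exact sum_mem fun i hi => hy i hi

/-- A sum of elements of distinct eigenvalues, one of which is a unit, has order smaller than the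
number of summands. -/
theorem sum_eigen_notMem [IsLocalRing O] (hZ : ∀ n : ℤ, n ≠ 0 → IsUnit (n : O))
    (D : Derivation ℤ O O) {J : Ideal O} (hJ : ∀ a ∈ J, D a ∈ J)
    (hJm : J ≤ IsLocalRing.maximalIdeal O) {ι : Type*} [DecidableEq ι] (ε : ι → ℤ)
    (F : Finset ι) (hε : Set.InjOn ε F) (y : ι → O) (hy : ∀ i ∈ F, D (y i) - ε i * y i ∈ J)
    {j : ι} (hj : j ∈ F) (hu : IsUnit (y j)) {m : ℕ} (hm : F.card ≤ m) :
    ∑ i ∈ F, y i ∉ IsLocalRing.maximalIdeal O ^ m ⊔ J := by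
  intro h
  have hF : insert j (F.erase j) = F := Finset.insert_erase hj
  have hc : (F.erase j).card + 1 = F.card := Finset.card_erase_add_one hj
  refine (IsLocalRing.mem_maximalIdeal _).1 (not_isUnit_mem_of_sum_eigen hZ D hJ hJm ε j
    (F.erase j) (by simp) (by rwa [hF]) y (by rwa [hF]) ?_) hu
  rw [hF, hc]
  exact pow_sup_le _ _ hm h

theorem derivation_sum_apply {R ι : Type*} [CommRing R] [Algebra R O] (s : Finset ι)
    (D : ι → Derivation R O O) (f : O) :
    (∑ i ∈ s, D i) f = ∑ i ∈ s, D i f := by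
  classical
  induction s using Finset.induction_on with
  | empty => simp
  | insert a s ha ih => rw [Finset.sum_insert ha, Finset.sum_insert ha, Derivation.add_apply, ih]

theorem derivation_prod_pow {ι : Type*} [Fintype ι] {D : Derivation ℤ O O} {x l : ι → O}
    (γ : ι → ℕ) (h : ∀ j, γ j ≠ 0 → D (x j) = l j * x j) :
    D (∏ j, x j ^ γ j) = (∑ j, γ j * l j) * ∏ j, x j ^ γ j := by
  classical
  have key : ∀ s : Finset ι, D (∏ j ∈ s, x j ^ γ j)
      = (∑ j ∈ s, γ j * l j) * ∏ j ∈ s, x j ^ γ j := by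
    intro s
    induction s using Finset.induction_on with
    | empty => simp
    | insert a s ha ih =>
      rw [Finset.prod_insert ha, Finset.sum_insert ha, D.leibniz, ih, D.leibniz_pow]
      rcases Nat.eq_zero_or_pos (γ a) with h0 | h0
      · simp [h0]
      · rw [h a h0.ne']
        obtain ⟨m, hm⟩ : ∃ m, γ a = m + 1 := ⟨γ a - 1, by omega⟩
        simp only [hm, smul_eq_mul, nsmul_eq_mul, Nat.add_sub_cancel]
        ring
  exact key _

/-- Nakayama: if no member of `s` divides `g`, each of them is `g` times a nonunit, so `g` lies in
`g` times the maximal ideal, and `g` can be cancelled. -/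
theorem exists_mem_dvd_of_span_eq [IsLocalRing O] {s : Set O} {g : O} (hg : g ∈ nonZeroDivisors O)
    (h : Ideal.span s = Ideal.span {g}) : ∃ a ∈ s, a ∣ g := by
  by_contra! hno
  have hle : Ideal.span s ≤ Ideal.span {g} * IsLocalRing.maximalIdeal O := by
    rw [Ideal.span_le]
    intro a ha
    obtain ⟨t, ht⟩ := Ideal.mem_span_singleton.1 (h ▸ Ideal.subset_span ha)
    refine Ideal.mem_span_singleton_mul.2 ⟨t, ?_, ht.symm⟩
    rw [IsLocalRing.mem_maximalIdeal]
    intro hu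
    obtain ⟨t', ht'⟩ := hu.exists_right_inv
    exact hno a ha ⟨t', by rw [ht, mul_assoc, ht', mul_one]⟩
  obtain ⟨t, ht, ht'⟩ := Ideal.mem_span_singleton_mul.1
    (hle (h ▸ Ideal.mem_span_singleton_self g))
  have h1 : t = 1 := (mul_cancel_left_mem_nonZeroDivisors hg).1 (by rw [ht', mul_one])
  exact (IsLocalRing.mem_maximalIdeal _).1 ht (h1 ▸ isUnit_one)

/-- The minor of the differentials of `f, g` along `D₁, D₂`. -/
def minor (D₁ D₂ : Derivation ℤ O O) (f g : O) : O := D₁ f * D₂ g - D₂ f * D₁ g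

/-- The minors of functions `s₀ = A` and `s_i`, where `ds_i = h_i dA + d(B T_i)`. -/
theorem minor_mem {Λ : Submodule O (Derivation ℤ O O)} {A B : O} (p : Derivation ℤ O O → O)
    (hp : ∀ D ∈ Λ, D A = p D * A) {X₀ : Derivation ℤ O O} (hX₀ : X₀ ∈ Λ) (hu : IsUnit (p X₀))
    (hAB : A ∣ B) {L : Ideal O} {ι : Type*} {s h T : ι → O}
    (hs : ∀ D ∈ Λ, ∀ i, D (s i) = h i * D A + D (B * T i))
    (hB : ∀ D ∈ Λ, B ∣ D B)
    (hL : ∀ X ∈ Λ, X A = 0 → ∀ i, ∃ l ∈ L, X (B * T i) = B * l)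
    {D₁ D₂ : Derivation ℤ O O} (h₁ : D₁ ∈ Λ) (h₂ : D₂ ∈ Λ) :
    (∀ i, minor D₁ D₂ A (s i) ∈ Ideal.span {A * B} * L) ∧
    (∀ i j, minor D₁ D₂ (s i) (s j) ∈ Ideal.span {A * B} * L) := by
  have key : ∀ D₁ ∈ Λ, ∀ D₂ ∈ Λ, ∀ i, minor D₁ D₂ A (B * T i) ∈ Ideal.span {A * B} * L := by
    intro D₁ h₁ D₂ h₂ i
    -- This combination kills `A`, and the minor is `A` times its value on `B * T i`.
    have hX : p D₁ • D₂ - p D₂ • D₁ ∈ Λ := Λ.sub_mem (Λ.smul_mem _ h₂) (Λ.smul_mem _ h₁)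
    obtain ⟨l, hl, hl'⟩ := hL _ hX (by simp [hp D₁ h₁, hp D₂ h₂]; ring) i
    have : minor D₁ D₂ A (B * T i) = A * B * l := by
      rw [mul_assoc, ← hl', minor, hp D₁ h₁, hp D₂ h₂]
      simp only [Derivation.sub_apply, Derivation.smul_apply, smul_eq_mul]
      ring
    rw [this]
    exact Ideal.mul_mem_mul (Ideal.mem_span_singleton_self _) hl
  have hDB : ∀ D ∈ Λ, ∀ i, B ∣ D (B * T i) := by
    intro D hD i
    rw [D.leibniz, smul_eq_mul, smul_eq_mul]
    exact dvd_add (dvd_mul_right _ _) ((hB D hD).mul_left _)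
  have key2 : ∀ X ∈ Λ, X A = 0 → ∀ D ∈ Λ, ∀ i j,
      minor X D (B * T i) (B * T j) ∈ Ideal.span {A * B} * L := by
    intro X hX hXA D hD i j
    obtain ⟨l, hl, hl'⟩ := hL X hX hXA i
    obtain ⟨l₂, hl₂, hl₂'⟩ := hL X hX hXA j
    obtain ⟨e, he⟩ := hDB D hD i
    obtain ⟨e₂, he₂⟩ := hDB D hD j
    -- Every entry is divisible by `B`, so the minor carries `B ^ 2`; one of the two factors is
    -- rewritten as `A * t`.
    obtain ⟨t, ht⟩ := hAB
    have : minor X D (B * T i) (B * T j) = A * B * (t * e₂ * l - t * e * l₂) := by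
      rw [minor, hl', hl₂', he, he₂]
      linear_combination (B * l * e₂ - B * e * l₂) * ht
    rw [this]
    exact Ideal.mul_mem_mul (Ideal.mem_span_singleton_self _)
      (sub_mem (Ideal.mul_mem_left _ _ hl) (Ideal.mul_mem_left _ _ hl₂))
  have key3 : ∀ D₁ ∈ Λ, ∀ D₂ ∈ Λ, ∀ i j,
      minor D₁ D₂ (B * T i) (B * T j) ∈ Ideal.span {A * B} * L := by
    intro D₁ h₁ D₂ h₂ i j
    have hX : ∀ D ∈ Λ, p X₀ • D - p D • X₀ ∈ Λ := fun D hD =>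
      Λ.sub_mem (Λ.smul_mem _ hD) (Λ.smul_mem _ hX₀)
    have hXA : ∀ D ∈ Λ, (p X₀ • D - p D • X₀) A = 0 := fun D hD => by
      simp [hp D hD, hp X₀ hX₀]; ring
    have h12 := key2 _ (hX D₁ h₁) (hXA D₁ h₁) D₂ h₂ i j
    have h02 := key2 _ (hX D₂ h₂) (hXA D₂ h₂) X₀ hX₀ i j
    -- Times the unit `p X₀`, a field is the sum of one that kills `A` and a multiple of `X₀`. Doing
    -- this for both fields reduces the minor to those of `key2`.
    have e : p X₀ * (p X₀ * minor D₁ D₂ (B * T i) (B * T j))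
        = p X₀ * minor (p X₀ • D₁ - p D₁ • X₀) D₂ (B * T i) (B * T j)
          - p D₁ * minor (p X₀ • D₂ - p D₂ • X₀) X₀ (B * T i) (B * T j) := by
      simp only [minor, Derivation.sub_apply, Derivation.smul_apply, smul_eq_mul]
      ring
    have hmem : p X₀ * (p X₀ * minor D₁ D₂ (B * T i) (B * T j)) ∈ Ideal.span {A * B} * L := by
      rw [e]
      exact sub_mem (Ideal.mul_mem_left _ _ h12) (Ideal.mul_mem_left _ _ h02)
    rwa [Ideal.unit_mul_mem_iff_mem _ hu, Ideal.unit_mul_mem_iff_mem _ hu] at hmem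
  refine ⟨fun i => ?_, fun i j => ?_⟩
  · have : minor D₁ D₂ A (s i) = minor D₁ D₂ A (B * T i) := by
      simp only [minor, hs D₁ h₁, hs D₂ h₂]; ring
    rw [this]
    exact key D₁ h₁ D₂ h₂ i
  · have : minor D₁ D₂ (s i) (s j) = h i * minor D₁ D₂ A (B * T j)
        - h j * minor D₁ D₂ A (B * T i) + minor D₁ D₂ (B * T i) (B * T j) := by
      simp only [minor, hs D₁ h₁, hs D₂ h₂]; ring
    rw [this]
    exact add_mem (sub_mem (Ideal.mul_mem_left _ _ (key D₁ h₁ D₂ h₂ j))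
      (Ideal.mul_mem_left _ _ (key D₁ h₁ D₂ h₂ i))) (key3 D₁ h₁ D₂ h₂ i j)

end Rings

end

section

/-! ### The properties of a geometry that are used -/

variable {G : Geometry.{u}}

/-- Properties common to the geometries of the three settings. -/
structure Geometry.IsRegular (G : Geometry.{u}) : Prop where
  isUnit_natCast : ∀ {n : ℕ} (X : G.Obj n) (p : G.Pt X) (m : ℕ), m ≠ 0 →
    IsUnit (m : G.Stalk X p)
  isLocalHom_pull : ∀ {m n : ℕ} {X : G.Obj m} {Y : G.Obj n} (f : G.Hom X Y) (p : G.Pt X),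
    IsLocalHom (G.pull f p)
  image_scalars : ∀ {m n : ℕ} {X : G.Obj m} {Y : G.Obj n} (f : G.Hom X Y) (p : G.Pt X),
    G.pull f p '' G.scalars Y (G.map f p) = G.scalars X p
  /-- a derivation along `f` is determined by its values on a system of coordinates -/
  deriv_ext : ∀ {m n : ℕ} {X : G.Obj m} {Y : G.Obj n} (f : G.Hom X Y) (p : G.Pt X)
    (c : Coord Y (G.map f p)) (D : G.Stalk Y (G.map f p) →+ G.Stalk X p),
    (∀ a b, D (a * b) = G.pull f p a * D b + G.pull f p b * D a) →
    (∀ s ∈ G.scalars Y (G.map f p), D s = 0) → (∀ j, D (c.x j) = 0) → ∀ a, D a = 0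
  mem_of_mul_mem : ∀ {n : ℕ} {X : G.Obj n} {p : G.Pt X} (c : Coord X p) {i j : Fin n}, i ≠ j →
    ∀ {f : G.Stalk X p}, c.x i * f ∈ Ideal.span {c.x j} → f ∈ Ideal.span {c.x j}
  eq_zero_of_mul : ∀ {n : ℕ} {X : G.Obj n} {p : G.Pt X} (c : Coord X p) {i : Fin n}
    {f : G.Stalk X p}, c.x i * f = 0 → f = 0
  map_id : ∀ {n : ℕ} (X : G.Obj n) (p : G.Pt X), G.map (G.id X) p = p
  map_comp : ∀ {l m n : ℕ} {X : G.Obj l} {Y : G.Obj m} {Z : G.Obj n} (f : G.Hom X Y)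
    (g : G.Hom Y Z) (p : G.Pt X), G.map (G.comp f g) p = G.map g (G.map f p)
  pullAt_id : ∀ {n : ℕ} (X : G.Obj n) {p q : G.Pt X} (h : G.map (G.id X) p = q) (h' : p = q)
    (φ : G.Stalk X q), pullAt (G.id X) h φ = h' ▸ φ
  pullAt_comp : ∀ {l m n : ℕ} {X : G.Obj l} {Y : G.Obj m} {Z : G.Obj n} (f : G.Hom X Y)
    (g : G.Hom Y Z) {p : G.Pt X} {q : G.Pt Y} {r : G.Pt Z} (h : G.map (G.comp f g) p = r)
    (h₁ : G.map f p = q) (h₂ : G.map g q = r) (φ : G.Stalk Z r),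
    pullAt (G.comp f g) h φ = pullAt f h₁ (pullAt g h₂ φ)

section Coordinates

variable {n : ℕ} {X : G.Obj n} {p : G.Pt X}

theorem Coord.deriv_eq_sum (c : Coord X p) (D : Derivation ℤ (G.Stalk X p) (G.Stalk X p))
    (hD : ∀ s ∈ G.scalars X p, D s = 0) : D = ∑ j, D (c.x j) • c.pd j := by
  refine sub_eq_zero.1 (c.pd_unique _ (fun s hs => ?_) fun i => ?_)
  · simp [hD s hs, derivation_sum_apply, c.pd_scalar _ s hs]
  · simp [derivation_sum_apply, c.pd_x]

namespace Coord

variable (c : Coord X p)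

theorem mono_zero : c.mono 0 = 1 := by simp [mono]

theorem mono_add (γ η : Fin n → ℕ) : c.mono (γ + η) = c.mono γ * c.mono η := by
  simp [mono, pow_add, Finset.prod_mul_distrib]

theorem mono_single (j : Fin n) (m : ℕ) : c.mono (Pi.single j m) = c.x j ^ m := by
  rw [mono, Finset.prod_eq_single j]
  · simp
  · intro i _ hi; simp [Pi.single_eq_of_ne hi]
  · simp

theorem mono_dvd_mono {γ η : Fin n → ℕ} (h : γ ≤ η) : c.mono η = c.mono γ * c.mono (η - γ) := by
  rw [← mono_add, add_tsub_cancel_of_le h]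

theorem isUnit_mono {γ : Fin n → ℕ} (h : ∀ j, IsUnit (c.x j) ∨ γ j = 0) : IsUnit (c.mono γ) := by
  rw [mono]
  refine (Finset.univ.prod_induction _ IsUnit (fun _ _ => IsUnit.mul) isUnit_one) fun j _ => ?_
  rcases h j with h | h
  · exact h.pow _
  · simp [h]

theorem deriv_mono {D : Derivation ℤ (G.Stalk X p) (G.Stalk X p)} {l : Fin n → G.Stalk X p}
    (γ : Fin n → ℕ) (h : ∀ j, γ j ≠ 0 → D (c.x j) = l j * c.x j) :
    D (c.mono γ) = (∑ j, γ j * l j) * c.mono γ :=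
  derivation_prod_pow γ h

variable {c}

theorem mono_mem_nonZeroDivisors (hG : G.IsRegular) (c : Coord X p) (γ : Fin n → ℕ) :
    c.mono γ ∈ nonZeroDivisors (G.Stalk X p) :=
  prod_mem fun j _ => pow_mem (mem_nonZeroDivisors_iff_right.2 fun f hf =>
    hG.eq_zero_of_mul c (i := j) (by rwa [mul_comm])) _

theorem mono_mul_cancel (hG : G.IsRegular) (c : Coord X p) (γ : Fin n → ℕ) {f g : G.Stalk X p}
    (h : c.mono γ * f = c.mono γ * g) : f = g :=
  (mul_cancel_left_mem_nonZeroDivisors (mono_mem_nonZeroDivisors hG c γ)).1 h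

theorem mem_of_mono_mul_mem (hG : G.IsRegular) (c : Coord X p) {γ : Fin n → ℕ} {j : Fin n}
    (hγ : γ j = 0) {f : G.Stalk X p} (h : c.mono γ * f ∈ Ideal.span {c.x j}) :
    f ∈ Ideal.span {c.x j} := by
  have key : ∀ s : Finset (Fin n), ∀ f : G.Stalk X p,
      (∏ i ∈ s, c.x i ^ γ i) * f ∈ Ideal.span {c.x j} → f ∈ Ideal.span {c.x j} := by
    intro s
    induction s using Finset.induction_on with
    | empty => simp
    | insert a s ha ih =>
      intro f hf
      rw [Finset.prod_insert ha, mul_comm (c.x a ^ γ a), mul_assoc] at hf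
      have h1 := ih _ hf
      rcases eq_or_ne a j with rfl | haj
      · simpa [hγ] using h1
      · have h2 : ∀ m : ℕ, c.x a ^ m * f ∈ Ideal.span {c.x j} → f ∈ Ideal.span {c.x j} := by
          intro m
          induction m with
          | zero => simp
          | succ m ih2 =>
            intro h
            rw [pow_succ', mul_assoc] at h
            exact ih2 (hG.mem_of_mul_mem c haj h)
        exact h2 _ h1
  exact key _ f h

/-- Exponents of a monomial that divides another monomial. -/
theorem le_of_mono_dvd (hG : G.IsRegular) (c : Coord X p) {γ η : Fin n → ℕ} {j : Fin n}
    (hj : ¬ IsUnit (c.x j)) (h : c.mono γ ∣ c.mono η) : γ j ≤ η j := by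
  by_contra! hlt
  obtain ⟨g, hg⟩ := h
  have e1 : c.mono η = c.x j ^ η j * c.mono (Function.update η j 0) := by
    rw [← mono_single, ← mono_add]
    congr 1; ext i
    rcases eq_or_ne i j with rfl | h <;> simp [*]
  -- Exactly `η j + 1` factors `x j` are split off: cancelling `x j ^ η j` leaves one, which would
  -- divide a monomial free of `x j`.
  have e2 : c.mono γ = c.x j ^ η j * (c.x j * c.mono (Function.update γ j (γ j - η j - 1))) := by
    rw [← mono_single, ← pow_one (c.x j), ← mono_single, ← mono_add, ← mono_add]
    congr 1; ext i
    rcases eq_or_ne i j with rfl | h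
    · simp; omega
    · simp [h]
  rw [e1, e2, mul_assoc, ← mono_single] at hg
  have h1 := mono_mul_cancel hG c _ hg
  have h2 : (1 : G.Stalk X p) ∈ Ideal.span {c.x j} := by
    refine mem_of_mono_mul_mem hG c (γ := Function.update η j 0) (by simp) ?_
    rw [mul_one, h1, mul_assoc]
    exact Ideal.mul_mem_right _ _ (Ideal.mem_span_singleton_self _)
  exact hj (isUnit_of_dvd_one (Ideal.mem_span_singleton.1 h2))

/-- Apply `∂ i` to `x i = x j * g`: the result `1 = x j * ∂ i g` makes `x j` a unit. -/
theorem not_mem_span_of_ne (c : Coord X p) {i j : Fin n} (hij : i ≠ j) (hj : ¬ IsUnit (c.x j)) :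
    c.x i ∉ Ideal.span {c.x j} := by
  intro h
  obtain ⟨g, hg⟩ := Ideal.mem_span_singleton.1 h
  have := congrArg (c.pd i) hg
  rw [Derivation.leibniz, c.pd_x, c.pd_x, if_pos rfl, if_neg hij] at this
  simp only [smul_eq_mul, mul_zero, add_zero] at this
  exact hj (IsUnit.of_mul_eq_one _ this.symm)

theorem span_mono (c : Coord X p) {S : Finset (Fin n)} {γ : Fin n → ℕ} (h : ∀ j ∉ S, γ j = 0) :
    Ideal.span {c.mono γ} = ∏ i : {i // i ∈ S}, Ideal.span {c.x i.1} ^ γ i.1 := by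
  have : c.mono γ = ∏ i : {i // i ∈ S}, c.x i.1 ^ γ i.1 := by
    rw [mono, Finset.prod_coe_sort S (fun i => c.x i ^ γ i)]
    refine (Finset.prod_subset (Finset.subset_univ S) fun i _ hi => ?_).symm
    simp [h i hi]
  rw [this, ← Ideal.prod_span_singleton]
  simp [Ideal.span_singleton_pow]

end Coord

theorem Geometry.IsRegular.isUnit_intCast (hG : G.IsRegular) (X : G.Obj n) (p : G.Pt X) (m : ℤ)
    (hm : m ≠ 0) : IsUnit (m : G.Stalk X p) := by
  obtain ⟨k, rfl | rfl⟩ := m.eq_nat_or_neg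
  · simpa using hG.isUnit_natCast X p k (by simpa using hm)
  · simpa using hG.isUnit_natCast X p k (by simpa using hm)

/-! ### Adapted coordinates -/

/-- The bijection of the definition is split into existence and uniqueness statements, which can be
checked one component at a time after a blowing-up. Its injectivity rests on
`Coord.not_mem_span_of_ne`. -/
theorem adapted_iff {E : Set (IdealFamily X)} (c : Coord X p) (S : Finset (Fin n)) :
    Adapted E p c S ↔ (∀ i ∈ S, ¬ IsUnit (c.x i)) ∧
      (∀ H ∈ E, H p ≠ ⊤ → ∃ i ∈ S, H p = Ideal.span {c.x i}) ∧
      (∀ i ∈ S, ∃ H ∈ E, H p = Ideal.span {c.x i} ∧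
        ∀ H' ∈ E, H' p = Ideal.span {c.x i} → H' = H) := by
  constructor
  · rintro ⟨e, he⟩
    have hu : ∀ i ∈ S, ¬ IsUnit (c.x i) := fun i hi hu =>
      (e ⟨i, hi⟩).2.2 (by rw [he ⟨i, hi⟩]; exact Ideal.span_singleton_eq_top.2 hu)
    refine ⟨hu, fun H hH hp => ?_, fun i hi => ?_⟩
    · obtain ⟨i, hi⟩ := e.surjective ⟨H, hH, hp⟩
      exact ⟨i.1, i.2, by rw [← he i, hi]⟩
    · refine ⟨(e ⟨i, hi⟩).1, (e ⟨i, hi⟩).2.1, he ⟨i, hi⟩, fun H' hH' hp => ?_⟩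
      have hp' : H' p ≠ ⊤ := by rw [hp, Ne, Ideal.span_singleton_eq_top]; exact hu i hi
      obtain ⟨j, hj⟩ := e.surjective ⟨H', hH', hp'⟩
      have h1 : Ideal.span {c.x j.1} = Ideal.span {c.x i} := by rw [← he j, hj]; exact hp
      have h2 : j.1 = i := by
        by_contra hne
        exact c.not_mem_span_of_ne hne (hu i hi) (h1 ▸ Ideal.mem_span_singleton_self _)
      rw [show (⟨i, hi⟩ : {i // i ∈ S}) = j from Subtype.ext h2.symm, hj]
  · rintro ⟨hu, h1, h2⟩
    choose! H hH hHp hHu using h2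
    refine ⟨Equiv.ofBijective (fun i => ⟨H i.1, hH _ i.2, ?_⟩) ⟨fun i j hij => ?_, ?_⟩, fun i => ?_⟩
    · rw [hHp _ i.2, Ne, Ideal.span_singleton_eq_top]; exact hu _ i.2
    · have h3 : H i.1 = H j.1 := congrArg Subtype.val hij
      by_contra hne
      refine c.not_mem_span_of_ne (fun h => hne (Subtype.ext h)) (hu _ j.2) ?_
      rw [← hHp _ j.2, ← h3, hHp _ i.2]
      exact Ideal.mem_span_singleton_self _
    · rintro ⟨H', hH', hp⟩
      obtain ⟨i, hi, hi'⟩ := h1 H' hH' hp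
      exact ⟨⟨i, hi⟩, Subtype.ext (hHu i hi H' hH' hi').symm⟩
    · exact hHp _ i.2

section TwoCoordinates

variable {E : Set (IdealFamily X)} {c c₀ : Coord X p} {S S₀ : Finset (Fin n)}

theorem Adapted.span_image_le (h : Adapted E p c S) (h₀ : Adapted E p c₀ S₀) :
    Ideal.span (c.x '' S) ≤ Ideal.span (c₀.x '' S₀) := by
  rw [adapted_iff] at h h₀
  rw [Ideal.span_le]
  rintro _ ⟨i, hi, rfl⟩
  obtain ⟨H, hH, hHp, -⟩ := h.2.2 i hi
  obtain ⟨j, hj, hj'⟩ := h₀.2.1 H hH (by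
    rw [hHp, Ne, Ideal.span_singleton_eq_top]; exact h.1 i hi)
  have : c.x i ∈ Ideal.span {c₀.x j} := by
    rw [← hj', hHp]; exact Ideal.mem_span_singleton_self _
  exact Ideal.span_mono (Set.singleton_subset_iff.2
    (Set.mem_image_of_mem c₀.x (Finset.mem_coe.2 hj))) this

theorem Adapted.span_image_eq (h : Adapted E p c S) (h₀ : Adapted E p c₀ S₀) :
    Ideal.span (c.x '' S) = Ideal.span (c₀.x '' S₀) :=
  le_antisymm (h.span_image_le h₀) (h₀.span_image_le h)

/-- A monomial ideal in one system of adapted coordinates is monomial in any other. -/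
theorem Adapted.exists_mono (h : Adapted E p c S) (h₀ : Adapted E p c₀ S₀) (γ : Fin n → ℕ)
    (hγ : ∀ j ∉ S, γ j = 0) : ∃ γ₀ : Fin n → ℕ, (∀ j ∉ S₀, γ₀ j = 0) ∧
      Ideal.span {c.mono γ} = Ideal.span {c₀.mono γ₀} := by
  obtain ⟨e, he⟩ := h
  obtain ⟨e₀, he₀⟩ := h₀
  refine ⟨fun j => if hj : j ∈ S₀ then γ (e.symm (e₀ ⟨j, hj⟩)) else 0, fun j hj => by simp [hj], ?_⟩
  rw [c.span_mono hγ, c₀.span_mono (S := S₀) (fun j hj => by simp [hj])]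
  refine Fintype.prod_equiv (e.trans e₀.symm) _ _ fun i => ?_
  simp [← he, ← he₀]

end TwoCoordinates

end Coordinates

end

section

variable {G : Geometry.{u}}

/-! ### Logarithmic derivations -/

section LogDer

variable {n : ℕ} {X : G.Obj n} {p : G.Pt X}

/-- The chain rule: the difference of the two sides is a derivation along `f` that kills the
constants and the coordinates, so `deriv_ext` applies. -/
theorem Geometry.IsRegular.deriv_pullAt (hG : G.IsRegular) {m : ℕ} {Y : G.Obj m} (f : G.Hom X Y)
    {q : G.Pt Y} (h : G.map f p = q) (c : Coord Y q)
    (D : Derivation ℤ (G.Stalk X p) (G.Stalk X p)) (hD : ∀ s ∈ G.scalars X p, D s = 0)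
    (a : G.Stalk Y q) :
    D (pullAt f h a) = ∑ j, pullAt f h (c.pd j a) * D (pullAt f h (c.x j)) := by
  subst h
  let δ : G.Stalk Y (G.map f p) →+ G.Stalk X p := AddMonoidHom.mk'
    (fun a => D (G.pull f p a) - ∑ j, G.pull f p (c.pd j a) * D (G.pull f p (c.x j)))
    fun a b => by simp [add_mul, Finset.sum_add_distrib]; ring
  refine sub_eq_zero.1 (hG.deriv_ext f p c δ (fun a b => ?_) (fun s hs => ?_) (fun j => ?_) a)
  · change D _ - _ = _ * (D _ - _) + _ * (D _ - _)
    simp only [map_mul, Derivation.leibniz, smul_eq_mul, map_add, mul_sub, Finset.mul_sum, add_mul,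
      Finset.sum_add_distrib]
    simp only [mul_assoc]
    ring
  · change D _ - ∑ j, _ = 0
    rw [hD _ (hG.image_scalars f p ▸ Set.mem_image_of_mem _ hs)]
    simp [c.pd_scalar _ s hs]
  · change D _ - ∑ j, _ = 0
    simp [c.pd_x]

/-- The derivations over the ground field that are tangent to `E`. -/
def logDer (E : Set (IdealFamily X)) (p : G.Pt X) :
    Submodule (G.Stalk X p) (Derivation ℤ (G.Stalk X p) (G.Stalk X p)) where
  carrier := {D | (∀ s ∈ G.scalars X p, D s = 0) ∧ ∀ H ∈ E, ∀ f ∈ H p, D f ∈ H p}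
  add_mem' {D D'} h h' := ⟨fun s hs => by simp [h.1 s hs, h'.1 s hs],
    fun H hH f hf => add_mem (h.2 H hH f hf) (h'.2 H hH f hf)⟩
  zero_mem' := ⟨fun s _ => rfl, fun H _ f _ => zero_mem _⟩
  smul_mem' a D h := ⟨fun s hs => by simp [h.1 s hs],
    fun H hH f hf => Ideal.mul_mem_left _ _ (h.2 H hH f hf)⟩

/-- The logarithmic partial derivative. -/
def Coord.logPd (c : Coord X p) (S : Finset (Fin n)) (j : Fin n) :
    Derivation ℤ (G.Stalk X p) (G.Stalk X p) :=
  if j ∈ S then c.x j • c.pd j else c.pd j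

theorem logJac_apply {N : ℕ} (c : Coord X p) (S : Finset (Fin n)) (σ : Fin N → G.Stalk X p)
    (i : Fin N) (j : Fin n) : logJac c S σ i j = c.logPd S j (σ i) := by
  simp only [logJac, Coord.logPd, Matrix.of_apply]
  split_ifs <;> simp

variable {E : Set (IdealFamily X)} {c : Coord X p} {S : Finset (Fin n)}

theorem Adapted.mem_logDer (h : Adapted E p c S) {D : Derivation ℤ (G.Stalk X p) (G.Stalk X p)}
    (hD : ∀ s ∈ G.scalars X p, D s = 0) (hS : ∀ j ∈ S, c.x j ∣ D (c.x j)) : D ∈ logDer E p := by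
  refine ⟨hD, fun H hH f hf => ?_⟩
  by_cases hp : H p = ⊤
  · rw [hp]; trivial
  · obtain ⟨i, hi, hi'⟩ := ((adapted_iff c S).1 h).2.1 H hH hp
    rw [hi'] at hf ⊢
    refine derivation_mem_span (fun a ha => ?_) hf
    rw [Set.mem_singleton_iff.1 ha]
    exact Ideal.mem_span_singleton.2 (hS i hi)

theorem Adapted.dvd_of_mem_logDer (h : Adapted E p c S)
    {D : Derivation ℤ (G.Stalk X p) (G.Stalk X p)} (hD : D ∈ logDer E p) {j : Fin n} (hj : j ∈ S) :
    c.x j ∣ D (c.x j) := by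
  obtain ⟨H, hH, hp, -⟩ := ((adapted_iff c S).1 h).2.2 j hj
  have := hD.2 H hH (c.x j) (by rw [hp]; exact Ideal.mem_span_singleton_self _)
  rwa [hp, Ideal.mem_span_singleton] at this

theorem Adapted.smul_pd_mem_logDer (h : Adapted E p c S) (k : Fin n) :
    c.x k • c.pd k ∈ logDer E p := by
  refine h.mem_logDer (fun s hs => by simp [c.pd_scalar _ s hs]) fun j _ => ?_
  rw [Derivation.smul_apply, c.pd_x, smul_eq_mul]
  split_ifs with hkj
  · rw [hkj, mul_one]
  · simp

theorem Adapted.pd_mem_logDer (h : Adapted E p c S) {k : Fin n} (hk : k ∉ S) :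
    c.pd k ∈ logDer E p := by
  refine h.mem_logDer (fun s hs => c.pd_scalar _ s hs) fun j hj => ?_
  rw [c.pd_x, if_neg (by rintro rfl; exact hk hj)]
  exact dvd_zero _

theorem Adapted.logPd_mem_logDer (h : Adapted E p c S) (k : Fin n) :
    c.logPd S k ∈ logDer E p := by
  unfold Coord.logPd
  split_ifs with hk
  · exact h.smul_pd_mem_logDer k
  · exact h.pd_mem_logDer hk

/-- Tangency makes `D (x j)` divisible by `x j` for `j ∈ S`, so the coefficients of `D` in the
partial derivatives can be rewritten in the logarithmic ones. Thus minors along tangent fields are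
combinations of minors of the logarithmic Jacobian matrix. -/
theorem Adapted.exists_eq_sum_logPd (h : Adapted E p c S)
    {D : Derivation ℤ (G.Stalk X p) (G.Stalk X p)} (hD : D ∈ logDer E p) :
    ∃ a : Fin n → G.Stalk X p, D = ∑ j, a j • c.logPd S j := by
  have h1 : ∀ j, ∃ a : G.Stalk X p, D (c.x j) • c.pd j = a • c.logPd S j := by
    intro j
    unfold Coord.logPd
    split_ifs with hj
    · obtain ⟨a, ha⟩ := h.dvd_of_mem_logDer hD hj
      exact ⟨a, by rw [ha, smul_smul, mul_comm]⟩
    · exact ⟨_, rfl⟩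
  choose a ha using h1
  exact ⟨a, (c.deriv_eq_sum D hD.1).trans (Finset.sum_congr rfl fun j _ => ha j)⟩

/-- The ideal generated by the `2 × 2` minors of the logarithmic differentials of the functions
in `R`. -/
def minorIdeal (E : Set (IdealFamily X)) (p : G.Pt X) (R : Set (G.Stalk X p)) :
    Ideal (G.Stalk X p) :=
  Ideal.span {φ | ∃ D₁ ∈ logDer E p, ∃ D₂ ∈ logDer E p, ∃ f ∈ R, ∃ g ∈ R, φ = minor D₁ D₂ f g}

theorem minor_mem_minorIdeal {R : Set (G.Stalk X p)}
    {D₁ D₂ : Derivation ℤ (G.Stalk X p) (G.Stalk X p)} (h₁ : D₁ ∈ logDer E p)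
    (h₂ : D₂ ∈ logDer E p) {f g : G.Stalk X p} (hf : f ∈ R) (hg : g ∈ R) :
    minor D₁ D₂ f g ∈ minorIdeal E p R :=
  Ideal.subset_span ⟨D₁, h₁, D₂, h₂, f, hf, g, hg, rfl⟩

/-- It suffices to consider the minors of coordinate functions. -/
theorem minorIdeal_le (hG : G.IsRegular) {N : ℕ} {M : G.Obj N} (σ : G.Hom X M) {q : G.Pt M}
    (h : G.map σ p = q) (z : Coord M q) {I : Ideal (G.Stalk X p)}
    (hI : ∀ D₁ ∈ logDer E p, ∀ D₂ ∈ logDer E p, ∀ i j,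
      minor D₁ D₂ (pullAt σ h (z.x i)) (pullAt σ h (z.x j)) ∈ I) :
    minorIdeal E p (Set.range (pullAt σ h)) ≤ I := by
  refine Ideal.span_le.2 ?_
  rintro _ ⟨D₁, h₁, D₂, h₂, _, ⟨f, rfl⟩, _, ⟨g, rfl⟩, rfl⟩
  have : minor D₁ D₂ (pullAt σ h f) (pullAt σ h g) = ∑ i, ∑ j, pullAt σ h (z.pd i f) *
      pullAt σ h (z.pd j g) * minor D₁ D₂ (pullAt σ h (z.x i)) (pullAt σ h (z.x j)) := by
    simp only [minor]
    rw [hG.deriv_pullAt σ h z D₁ h₁.1 f, hG.deriv_pullAt σ h z D₂ h₂.1 f,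
      hG.deriv_pullAt σ h z D₁ h₁.1 g, hG.deriv_pullAt σ h z D₂ h₂.1 g, Finset.sum_mul_sum,
      Finset.sum_mul_sum, ← Finset.sum_sub_distrib]
    refine Finset.sum_congr rfl fun i _ => ?_
    rw [← Finset.sum_sub_distrib]
    refine Finset.sum_congr rfl fun j _ => ?_
    ring
  rw [this]
  exact sum_mem fun i _ => sum_mem fun j _ => Ideal.mul_mem_left _ _ (hI D₁ h₁ D₂ h₂ i j)

end LogDer

section Fitting

variable {X : G.Obj 3} {p : G.Pt X} {E : Set (IdealFamily X)} {c : Coord X p} {S : Finset (Fin 3)}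

/-- The logarithmic Fitting ideal, independently of coordinates. -/
theorem logFitting_eq_minorIdeal (hG : G.IsRegular) {N : ℕ} {M : G.Obj N} (σ : G.Hom X M)
    (z : Coord M (G.map σ p)) (h : Adapted E p c S) :
    logFitting 1 c S (fun i => G.pull σ p (z.x i)) = minorIdeal E p (Set.range (G.pull σ p)) := by
  have hdet : ∀ (R : Fin (3 - 1) → Fin N) (Q : Fin (3 - 1) → Fin 3),
      ((logJac c S fun i => G.pull σ p (z.x i)).submatrix R Q).det
        = minor (c.logPd S (Q 0)) (c.logPd S (Q 1)) (G.pull σ p (z.x (R 0)))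
          (G.pull σ p (z.x (R 1))) := by
    intro R Q
    refine (Matrix.det_fin_two _).trans ?_
    simp only [Matrix.submatrix_apply, logJac_apply, minor]
  apply le_antisymm
  · refine Ideal.span_le.2 ?_
    rintro _ ⟨R, Q, rfl⟩
    rw [hdet]
    exact minor_mem_minorIdeal (h.logPd_mem_logDer _) (h.logPd_mem_logDer _) ⟨_, rfl⟩ ⟨_, rfl⟩
  · refine minorIdeal_le hG σ rfl z fun D₁ h₁ D₂ h₂ i j => ?_
    obtain ⟨a, rfl⟩ := h.exists_eq_sum_logPd h₁
    obtain ⟨b, rfl⟩ := h.exists_eq_sum_logPd h₂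
    have : ∀ f g, minor (∑ k, a k • c.logPd S k) (∑ k, b k • c.logPd S k) f g
        = ∑ k, ∑ l, a k * b l * minor (c.logPd S k) (c.logPd S l) f g := by
      intro f g
      simp only [minor, derivation_sum_apply, Derivation.smul_apply, smul_eq_mul]
      rw [Finset.sum_mul_sum, Finset.sum_mul_sum, Finset.sum_comm (γ := Fin 3)
        (f := fun i j => b i * (c.logPd S i) f * (a j * (c.logPd S j) g)),
        ← Finset.sum_sub_distrib]
      refine Finset.sum_congr rfl fun k _ => ?_
      rw [← Finset.sum_sub_distrib]
      refine Finset.sum_congr rfl fun l _ => ?_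
      ring
    rw [this]
    refine sum_mem fun k _ => sum_mem fun l _ => Ideal.mul_mem_left _ _ (Ideal.subset_span ?_)
    exact ⟨![i, j], ![k, l], ((hdet ![i, j] ![k, l]).trans rfl).symm⟩

end Fitting

/-! ### The order of the residual ideal -/

section Order

variable {n : ℕ} {X : G.Obj n} {p : G.Pt X} {c : Coord X p} {S : Finset (Fin n)}

/-- The element `f` witnesses that no higher power of `x j` divides the ideal. Exhibiting the
maximum also rules out the default value of the supremum of an unbounded set. -/
theorem multiplicity_eq (hG : G.IsRegular) {F : Ideal (G.Stalk X p)} {μ : Fin n → ℕ}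
    (hF : F ≤ Ideal.span {c.mono μ}) {f : G.Stalk X p} (hf : c.mono μ * f ∈ F) {j : Fin n}
    (hj : f ∉ Ideal.span {c.x j}) : multiplicity c F j = μ j := by
  have e : c.mono μ = c.x j ^ μ j * c.mono (Function.update μ j 0) := by
    rw [← Coord.mono_single, ← Coord.mono_add]
    congr 1; ext i
    rcases eq_or_ne i j with rfl | h <;> simp [*]
  refine IsGreatest.csSup_eq ⟨hF.trans ?_, fun m hm => ?_⟩
  · rw [Ideal.span_singleton_le_span_singleton, e]
    exact dvd_mul_right _ _
  · by_contra! hlt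
    obtain ⟨g, hg⟩ := Ideal.mem_span_singleton.1 (hm hf)
    obtain ⟨t, rfl⟩ := Nat.exists_eq_add_of_lt hlt
    rw [e, mul_assoc, pow_add, pow_add, mul_assoc, mul_assoc, ← Coord.mono_single] at hg
    have h1 := Coord.mono_mul_cancel hG c _ hg
    refine hj (Coord.mem_of_mono_mul_mem hG c (γ := Function.update μ j 0) (by simp) ?_)
    rw [h1, pow_one]
    exact Ideal.mul_mem_left _ _ (Ideal.mul_mem_right _ _ (Ideal.mem_span_singleton_self _))

/-- An `f` that does not vanish identically on the stratum is divisible by none of the `x j`, `j ∈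
S`, so one element fixes all the multiplicities at once. -/
theorem residual_eq (hG : G.IsRegular) {F : Ideal (G.Stalk X p)} {μ : Fin n → ℕ}
    (hμ : ∀ j ∉ S, μ j = 0) (hF : F ≤ Ideal.span {c.mono μ}) {f : G.Stalk X p}
    (hf : c.mono μ * f ∈ F) (hfS : f ∉ Ideal.span (c.x '' S)) :
    residual c S F = F.colon {c.mono μ} := by
  have h1 : ∏ j ∈ S, c.x j ^ multiplicity c F j = c.mono μ := by
    rw [Coord.mono, ← Finset.prod_subset (Finset.subset_univ S) fun i _ hi => by simp [hμ i hi]]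
    refine Finset.prod_congr rfl fun j hj => ?_
    rw [multiplicity_eq hG hF hf fun h => hfS ?_]
    exact Ideal.span_mono (Set.singleton_subset_iff.2
      (Set.mem_image_of_mem c.x (Finset.mem_coe.2 hj))) h
  rw [residual, h1]

theorem map_mk_le_iff (I J K : Ideal (G.Stalk X p)) (m : ℕ) :
    I.map (Ideal.Quotient.mk J) ≤ K.map (Ideal.Quotient.mk J) ^ m ↔ I ≤ K ^ m ⊔ J := by
  rw [← Ideal.map_pow, Ideal.map_le_iff_le_comap,
    Ideal.comap_map_of_surjective _ Ideal.Quotient.mk_surjective]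
  congr! 2
  ext x
  simp [Ideal.mem_comap, Ideal.Quotient.eq_zero_iff_mem]

variable {E : Set (IdealFamily X)} {c₀ : Coord X p} {S₀ : Finset (Fin n)}

/-- The residual ideal is the Fitting ideal divided by `w`, and it contains `f`. The invariant is
formed in arbitrary adapted coordinates `c`, while `w` is known to be monomial only in `c₀`; both
the monomial ideal and the ideal of the stratum are independent of this choice. -/
theorem rhoAt_lt (hG : G.IsRegular) (h : Adapted E p c S) (h₀ : Adapted E p c₀ S₀) {k N : ℕ}
    {σ : Fin N → G.Stalk X p} {w : G.Stalk X p} {μ : Fin n → ℕ} (hμ : ∀ j ∉ S₀, μ j = 0)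
    (hw : Ideal.span {w} = Ideal.span {c₀.mono μ})
    (hF : logFitting k c S σ ≤ Ideal.span {w}) {f : G.Stalk X p}
    (hf : w * f ∈ logFitting k c S σ) {m : ℕ}
    (hm : f ∉ IsLocalRing.maximalIdeal (G.Stalk X p) ^ m ⊔ Ideal.span (c₀.x '' S₀)) :
    rhoAt k c S σ < m := by
  obtain ⟨γ, hγ, hγ'⟩ := h₀.exists_mono h μ hμ
  have hwγ : Ideal.span {w} = Ideal.span {c.mono γ} := hw.trans hγ'
  have hmem : c.mono γ * f ∈ logFitting k c S σ := by
    obtain ⟨t, ht⟩ := Ideal.mem_span_singleton.1 (hwγ ▸ Ideal.mem_span_singleton_self (c.mono γ))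
    rw [ht, mul_right_comm]
    exact Ideal.mul_mem_right _ _ hf
  rw [h₀.span_image_eq h] at hm
  have hm0 : m ≠ 0 := by rintro rfl; simp at hm
  have hres := residual_eq hG hγ (hwγ ▸ hF) hmem fun hS => hm (Ideal.mem_sup_right hS)
  refine lt_of_le_of_lt (b := ((m - 1 : ℕ) : ℕ∞)) ?_ (by exact_mod_cast (by omega : m - 1 < m))
  refine iSup₂_le fun m' hm' => ?_
  rw [map_mk_le_iff, hres] at hm'
  have h1 : f ∈ (logFitting k c S σ).colon {c.mono γ} := by
    rw [Submodule.mem_colon_singleton, smul_eq_mul, mul_comm]; exact hmem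
  by_contra hlt
  have hlt' : m - 1 < m' := by exact_mod_cast not_le.1 hlt
  exact hm (pow_sup_le _ _ (by omega) (hm' h1))

/-- The counterpart of `rhoAt_lt`, for lower bounds: after division by the monomial the Fitting
ideal is contained in `L`. The element `f` is needed to know that nothing more is factored out. -/
theorem le_rhoAt (hG : G.IsRegular) {k N : ℕ} {σ : Fin N → G.Stalk X p} {μ : Fin n → ℕ}
    (hμ : ∀ j ∉ S, μ j = 0) {L : Ideal (G.Stalk X p)}
    (hF : logFitting k c S σ ≤ Ideal.span {c.mono μ} * L) {f : G.Stalk X p}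
    (hf : c.mono μ * f ∈ logFitting k c S σ) (hfS : f ∉ Ideal.span (c.x '' S)) {m : ℕ}
    (hL : L ≤ IsLocalRing.maximalIdeal (G.Stalk X p) ^ m ⊔ Ideal.span (c.x '' S)) :
    m ≤ rhoAt k c S σ := by
  refine le_iSup₂_of_le m ?_ le_rfl
  rw [map_mk_le_iff, residual_eq hG hμ (hF.trans Ideal.mul_le_left) hf hfS]
  intro g hg
  rw [Submodule.mem_colon_singleton, smul_eq_mul] at hg
  obtain ⟨l, hl, hl'⟩ := Ideal.mem_span_singleton_mul.1 (hF hg)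
  rw [mul_comm g] at hl'
  rw [← Coord.mono_mul_cancel hG c _ hl']
  exact hL hl

end Order

end

section

variable {G : Geometry.{u}}

/-! ### Coordinates at a point of a combinatorial blowing-up -/

theorem Coord.map_mono {m n : ℕ} {X : G.Obj m} {Y : G.Obj n} {p : G.Pt X} {q : G.Pt Y}
    (φ : G.Stalk Y q →+* G.Stalk X p) (c : Coord Y q) (c' : Coord X p)
    {M : Matrix (Fin n) (Fin m) ℕ} (h : ∀ l, φ (c.x l) = c'.mono (M l)) (γ : Fin n → ℕ) :
    φ (c.mono γ) = c'.mono (Matrix.vecMul γ M) := by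
  simp only [mono, map_prod, map_pow, h, ← Finset.prod_pow, ← pow_mul]
  rw [Finset.prod_comm]
  refine Finset.prod_congr rfl fun k _ => ?_
  rw [Finset.prod_pow_eq_pow_sum]
  congr 1
  simp only [Matrix.vecMul, dotProduct]
  exact Finset.sum_congr rfl fun l _ => mul_comm _ _

section Blowup

variable {n : ℕ} {Z Y : G.Obj n}

/-- Coordinates at a point where a morphism is an isomorphism of local rings. -/
def Coord.transport (hG : G.IsRegular) (β : G.Hom Z Y) (b : G.Pt Z) (c : Coord Y (G.map β b))
    (hβ : Function.Bijective (G.pull β b)) : Coord Z b :=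
  let e : G.Stalk Y (G.map β b) ≃+* G.Stalk Z b := RingEquiv.ofBijective (G.pull β b) hβ
  { x := fun j => e (c.x j)
    pd := fun j => Derivation.mk' (AddMonoidHom.mk' (fun f => e (c.pd j (e.symm f)))
        (by simp)).toIntLinearMap (by intro f g; simp)
    pd_scalar := by
      intro j s hs
      rw [← hG.image_scalars β b] at hs
      obtain ⟨t, ht, rfl⟩ := hs
      change e (c.pd j (e.symm (e t))) = 0
      rw [e.symm_apply_apply, c.pd_scalar j t ht, map_zero]
    pd_x := by
      intro i j
      change e (c.pd i (e.symm (e (c.x j)))) = _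
      rw [e.symm_apply_apply, c.pd_x]
      split_ifs <;> simp
    pd_unique := by
      intro D hD hx
      let D' : Derivation ℤ (G.Stalk Y (G.map β b)) (G.Stalk Y (G.map β b)) :=
        Derivation.mk' (AddMonoidHom.mk' (fun f => e.symm (D (e f)))
          (by simp)).toIntLinearMap (by intro f g; simp)
      have h0 : D' = 0 := c.pd_unique D' (fun s hs => by
          change e.symm (D (e s)) = 0
          rw [hD (e s) (hG.image_scalars β b ▸ Set.mem_image_of_mem _ hs), map_zero])
        fun j => by
          change e.symm (D (e (c.x j))) = 0
          rw [hx j, map_zero]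
      ext f
      have h1 : e.symm (D (e (e.symm f))) = 0 := congrArg (fun D => D (e.symm f)) h0
      simpa using h1 }

theorem Coord.transport_x (hG : G.IsRegular) (β : G.Hom Z Y) (b : G.Pt Z)
    (c : Coord Y (G.map β b)) (hβ : Function.Bijective (G.pull β b)) (j : Fin n) :
    (c.transport hG β b hβ).x j = G.pull β b (c.x j) := rfl

variable {β : G.Hom Z Y} {C : IdealFamily Y} {b : G.Pt Z} {c : Coord Y (G.map β b)}
  {F : Set (IdealFamily Y)} {s : Finset (Fin n)} {S S' : Finset (Fin n)}

theorem strictTransform_eq_top {H : IdealFamily Y} (hH : H (G.map β b) = ⊤) :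
    strictTransform β C H b = ⊤ := by
  rw [eq_top_iff]
  refine le_trans ?_ (le_iSup _ 0)
  simp [hH, Ideal.map_top]

/-- Off the centre the exceptional ideal is the unit ideal, so the strict transform is the pull-back
and everything is carried over by the isomorphism. -/
theorem adapted_transform_of_iso (hG : G.IsRegular) (hC : C (G.map β b) = ⊤)
    (hβ : Function.Bijective (G.pull β b)) (hF : Adapted F (G.map β b) c S) :
    Adapted (transform β C F) b (c.transport hG β b hβ) S := by
  have hloc := hG.isLocalHom_pull β b
  have hexc : exceptional β C b = ⊤ := by rw [exceptional, hC, Ideal.map_top]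
  have hstr : ∀ H : IdealFamily Y,
      strictTransform β C H b = (H (G.map β b)).map (G.pull β b) := by
    intro H
    simp only [strictTransform, hexc, Ideal.top_pow]
    rw [ciSup_const]
    ext f
    rw [Submodule.mem_colon_iff_le]
    constructor
    · intro h
      have := h (Submodule.smul_mem_pointwise_smul 1 f ⊤ trivial)
      simpa using this
    · rintro h _ ⟨g, -, rfl⟩
      exact Ideal.mul_mem_right _ _ h
  rw [adapted_iff] at hF ⊢
  have hu : ∀ i ∈ S, ¬ IsUnit (G.pull β b (c.x i)) := fun i hi h =>
    hF.1 i hi (isUnit_of_map_unit (G.pull β b) _ h)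
  refine ⟨hu, ?_, fun i hi => ?_⟩
  · rintro _ (rfl | ⟨H, hH, rfl⟩) hp
    · exact absurd hexc hp
    · rw [hstr] at hp
      obtain ⟨i, hi, hi'⟩ := hF.2.1 H hH fun h => hp (by rw [h, Ideal.map_top])
      exact ⟨i, hi, by rw [hstr, hi', Ideal.map_span, Set.image_singleton]; rfl⟩
  · obtain ⟨H, hH, hi', huniq⟩ := hF.2.2 i hi
    refine ⟨strictTransform β C H, Or.inr ⟨H, hH, rfl⟩, ?_, ?_⟩
    · rw [hstr, hi', Ideal.map_span, Set.image_singleton]; rfl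
    · rintro _ (rfl | ⟨H', hH', rfl⟩) hp
      · rw [hexc] at hp
        exact absurd (Ideal.span_singleton_eq_top.1 hp.symm) (hu i hi)
      · rw [huniq H' hH' ?_]
        rw [hstr, Coord.transport_x] at hp
        have h2 := congrArg (Ideal.comap (G.pull β b)) hp
        rw [Ideal.comap_map_of_bijective _ hβ] at h2
        rw [h2, ← Set.image_singleton, ← Ideal.map_span, Ideal.comap_map_of_bijective _ hβ]

variable {c' : Coord Z b} {K : Finset (Fin n)} {i : Fin n}

/-- Saturation removes the factor `x i ^ ε` and nothing else, since `x i` is a nonzerodivisor modulo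
`x k`. -/
theorem strictTransform_eq_span (hG : G.IsRegular) (hexc : exceptional β C b = Ideal.span {c'.x i})
    {H : IdealFamily Y} {k : Fin n} (hki : k ≠ i) (hH : H (G.map β b) = Ideal.span {c.x k})
    {ε : ℕ} (hε : G.pull β b (c.x k) = c'.x i ^ ε * c'.x k) :
    strictTransform β C H b = Ideal.span {c'.x k} := by
  have hcolon : ∀ m (f : G.Stalk Z b), f ∈ ((H (G.map β b)).map (G.pull β b)).colon
      ((exceptional β C b ^ m : Ideal (G.Stalk Z b)) : Set (G.Stalk Z b)) ↔
      f * c'.x i ^ m ∈ Ideal.span {c'.x i ^ ε * c'.x k} := by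
    intro m f
    rw [hexc, Ideal.span_singleton_pow, Ideal.colon_span, hH, Ideal.map_span, Set.image_singleton,
      hε, Submodule.mem_colon_singleton, smul_eq_mul]
  apply le_antisymm
  · refine iSup_le fun m f hf => ?_
    rw [hcolon] at hf
    have h1 : c'.mono (Pi.single i m) * f ∈ Ideal.span {c'.x k} := by
      rw [Coord.mono_single, mul_comm]
      exact Ideal.span_singleton_le_span_singleton.2 (dvd_mul_left _ _) hf
    exact Coord.mem_of_mono_mul_mem hG c' (by simp [hki]) h1
  · refine le_trans (fun f hf => ?_) (le_iSup _ ε)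
    rw [hcolon]
    obtain ⟨g, rfl⟩ := Ideal.mem_span_singleton.1 hf
    exact Ideal.mem_span_singleton.2 ⟨g, by ring⟩

/-- In the `x i`-chart the strict transform of `(x i = 0)` is empty and its label `i` passes to the
exceptional divisor, while every other component keeps its label. The sets `s` and `insert i s`
collect labels, whether or not the component passes through the point; `S` and `S'` keep those whose
coordinate is a nonunit. -/
theorem adapted_transform (hG : G.IsRegular) (hi : i ∈ K)
    (hCK : C (G.map β b) = Ideal.span (c.x '' K)) (hC : C (G.map β b) ≠ ⊤)
    (hci : c'.x i = G.pull β b (c.x i))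
    (hcK : ∀ j ∈ K, j ≠ i → G.pull β b (c.x j) = G.pull β b (c.x i) * c'.x j)
    (hcoff : ∀ j ∉ K, c'.x j = G.pull β b (c.x j))
    (hS : ∀ k, k ∈ S ↔ k ∈ s ∧ ¬ IsUnit (c.x k))
    (hS' : ∀ k, k ∈ S' ↔ k ∈ insert i s ∧ ¬ IsUnit (c'.x k))
    (hF : Adapted F (G.map β b) c S) : Adapted (transform β C F) b c' S' := by
  have hloc := hG.isLocalHom_pull β b
  have hexc : exceptional β C b = Ideal.span {c'.x i} := by
    rw [exceptional, hCK, Ideal.map_span]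
    apply le_antisymm
    · rw [Ideal.span_le]
      rintro _ ⟨_, ⟨j, hj, rfl⟩, rfl⟩
      rcases eq_or_ne j i with rfl | hji
      · rw [← hci]; exact Ideal.mem_span_singleton_self _
      · rw [hcK j hj hji, ← hci]
        exact Ideal.mul_mem_right _ _ (Ideal.mem_span_singleton_self _)
    · rw [Ideal.span_singleton_le_iff_mem, hci]
      exact Ideal.subset_span ⟨_, ⟨i, hi, rfl⟩, rfl⟩
  have hciu : ¬ IsUnit (c'.x i) := by
    rw [hci]
    intro h
    refine hC (Ideal.eq_top_of_isUnit_mem _ ?_ (isUnit_of_map_unit (G.pull β b) _ h))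
    rw [hCK]
    exact Ideal.subset_span ⟨i, hi, rfl⟩
  have hε : ∀ k, k ≠ i → ∃ ε, G.pull β b (c.x k) = c'.x i ^ ε * c'.x k := by
    intro k hk
    by_cases hkK : k ∈ K
    · exact ⟨1, by rw [hcK k hkK hk, hci, pow_one]⟩
    · exact ⟨0, by rw [hcoff k hkK, pow_zero, one_mul]⟩
  have hstr : ∀ (H : IdealFamily Y) (k : Fin n), k ≠ i → H (G.map β b) = Ideal.span {c.x k} →
      strictTransform β C H b = Ideal.span {c'.x k} := by
    intro H k hk hH
    obtain ⟨ε, hε⟩ := hε k hk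
    exact strictTransform_eq_span hG hexc hk hH hε
  -- The pull-back of `x i` generates the exceptional ideal itself, so a single colon already gives
  -- the unit ideal.
  have hstri : ∀ H : IdealFamily Y, H (G.map β b) = Ideal.span {c.x i} →
      strictTransform β C H b = ⊤ := by
    intro H hH
    rw [eq_top_iff]
    refine le_trans (fun f _ => ?_) (le_iSup _ 1)
    rw [pow_one, hexc, Ideal.colon_span, Submodule.mem_colon_singleton, hH, Ideal.map_span,
      Set.image_singleton, hci]
    exact Ideal.mul_mem_left _ _ (Ideal.mem_span_singleton_self _)
  have hsub : ∀ k ∈ S', k ≠ i → k ∈ S := by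
    intro k hk hki
    rw [hS'] at hk
    refine (hS k).2 ⟨Finset.mem_of_mem_insert_of_ne hk.1 hki, fun h => hk.2 ?_⟩
    obtain ⟨ε, hε⟩ := hε k hki
    exact isUnit_of_mul_isUnit_right (hε ▸ h.map (G.pull β b))
  have hne : ∀ k l, l ∈ S' → Ideal.span {c'.x k} = Ideal.span {c'.x l} → k = l := by
    intro k l hl h
    by_contra hkl
    exact c'.not_mem_span_of_ne hkl ((hS' l).1 hl).2 (h ▸ Ideal.mem_span_singleton_self _)
  have hcase : ∀ H ∈ F, strictTransform β C H b ≠ ⊤ →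
      ∃ k ∈ S, k ≠ i ∧ H (G.map β b) = Ideal.span {c.x k} := by
    intro H hH hp
    obtain ⟨k, hk, hk'⟩ := ((adapted_iff _ _).1 hF).2.1 H hH
      fun h => hp (strictTransform_eq_top h)
    exact ⟨k, hk, by rintro rfl; exact hp (hstri H hk'), hk'⟩
  rw [adapted_iff] at hF ⊢
  have htop : ∀ k ∈ S', Ideal.span {c'.x k} ≠ ⊤ := fun k hk h =>
    ((hS' k).1 hk).2 (Ideal.span_singleton_eq_top.1 h)
  have hiS' : i ∈ S' := (hS' i).2 ⟨Finset.mem_insert_self _ _, hciu⟩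
  refine ⟨fun k hk => ((hS' k).1 hk).2, ?_, fun k hk => ?_⟩
  · rintro _ (rfl | ⟨H, hH, rfl⟩) hp
    · exact ⟨i, hiS', hexc⟩
    · obtain ⟨k, hk, hki, hk'⟩ := hcase H hH hp
      have h1 := hstr H k hki hk'
      refine ⟨k, (hS' k).2 ⟨Finset.mem_insert_of_mem ((hS k).1 hk).1, fun h => hp ?_⟩, h1⟩
      rw [h1, Ideal.span_singleton_eq_top.2 h]
  · rcases eq_or_ne k i with rfl | hki
    · refine ⟨exceptional β C, Or.inl rfl, hexc, ?_⟩
      rintro _ (rfl | ⟨H, hH, rfl⟩) hp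
      · rfl
      · obtain ⟨l, hl, hli, hl'⟩ := hcase H hH (by rw [hp]; exact htop k hk)
        rw [hstr H l hli hl'] at hp
        exact absurd (hne l k hk hp) hli
    · obtain ⟨H, hH, hHk, huniq⟩ := hF.2.2 k (hsub k hk hki)
      refine ⟨strictTransform β C H, Or.inr ⟨H, hH, rfl⟩, hstr H k hki hHk, ?_⟩
      rintro _ (rfl | ⟨H', hH', rfl⟩) hp
      · rw [hexc] at hp
        exact absurd (hne i k hk hp).symm hki
      · obtain ⟨l, hl, hli, hl'⟩ := hcase H' hH' (by rw [hp]; exact htop k hk)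
        rw [hstr H' l hli hl'] at hp
        obtain rfl := hne l k hk hp
        rw [huniq H' hH' hl']

theorem IsCombinatorialCentre.exists_eq_span {D : Set (IdealFamily Y)}
    (h : IsCombinatorialCentre D C) {p : G.Pt Y} {c : Coord Y p} (hD : Adapted D p c S)
    (hC : C p ≠ ⊤) : ∃ K ⊆ S, C p = Ideal.span (c.x '' K) := by
  classical
  obtain ⟨V, hV, h | ⟨T, hT, -, h⟩⟩ := h p
  · exact absurd (h p (mem_of_mem_nhds hV)) hC
  have hCp := h p (mem_of_mem_nhds hV)
  have hT' : ∀ H ∈ T, ∃ k ∈ S, H p = Ideal.span {c.x k} := by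
    intro H hH
    refine ((adapted_iff _ _).1 hD).2.1 H (hT hH) fun htop => hC ?_
    rw [hCp, eq_top_iff, ← htop]
    exact le_iSup₂_of_le H hH le_rfl
  refine ⟨S.filter fun k => ∃ H ∈ T, H p = Ideal.span {c.x k}, Finset.filter_subset _ _, ?_⟩
  rw [hCp]
  apply le_antisymm
  · refine iSup₂_le fun H hH => ?_
    obtain ⟨k, hk, hk'⟩ := hT' H hH
    rw [hk']
    exact Ideal.span_mono (Set.singleton_subset_iff.2 ⟨k, by simpa using ⟨hk, H, hH, hk'⟩, rfl⟩)
  · rw [Ideal.span_le]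
    rintro _ ⟨k, hk, rfl⟩
    obtain ⟨-, H, hH, hk'⟩ := Finset.mem_filter.1 (Finset.mem_coe.1 hk)
    refine (le_iSup₂_of_le (f := fun H (_ : H ∈ T) => H p) H hH le_rfl) ?_
    rw [hk']
    exact Ideal.mem_span_singleton_self _

end Blowup

/-- Coordinates `c` at a point `b` over `a`, in which the coordinates `ca` at `a` are monomials with
exponents `A` (the entries of `c` may be units).  The components of `D'` through `b` are given by
the nonunits `c k`, `k ∈ s`, and those of `E'` by the nonunits `c k`, `k ∈ N`. -/
structure MonomialChart {n : ℕ} {X Y : G.Obj n} {a : G.Pt X} {b : G.Pt Y} (τ : G.Hom Y X)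
    (h : G.map τ b = a) (ca : Coord X a) (s sE : Finset (Fin n)) (E' D' : Set (IdealFamily Y)) where
  c : Coord Y b
  A : Matrix (Fin n) (Fin n) ℕ
  B : Matrix (Fin n) (Fin n) ℤ
  mul_eq_one : A.map (Nat.cast : ℕ → ℤ) * B = 1
  pull_x : ∀ j, pullAt τ h (ca.x j) = c.mono (A j)
  N : Finset (Fin n)
  sE_subset : sE ⊆ N
  subset_s : N ⊆ s
  col : ∀ k ∉ N, ∀ j, A j k = (1 : Matrix (Fin n) (Fin n) ℕ) j k
  row : ∀ k ∉ s, ∀ j, A k j = (1 : Matrix (Fin n) (Fin n) ℕ) k j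
  S : Finset (Fin n)
  mem_S : ∀ k, k ∈ S ↔ k ∈ s ∧ ¬ IsUnit (c.x k)
  S_E : Finset (Fin n)
  mem_S_E : ∀ k, k ∈ S_E ↔ k ∈ N ∧ ¬ IsUnit (c.x k)
  adapted_D : Adapted D' b c S
  adapted_E : Adapted E' b c S_E

/-- Each blowing-up multiplies the exponent matrix by an elementary unipotent matrix, so
invertibility over the integers persists. Over points off the centre nothing changes. -/
theorem BlowupSequence.nonempty_monomialChart (hG : G.IsRegular) {n : ℕ} {X Y : G.Obj n}
    {E D : Set (IdealFamily X)} {τ : G.Hom Y X} {E' D' : Set (IdealFamily Y)}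
    (hτ : BlowupSequence E D τ E' D') {a : G.Pt X} {ca : Coord X a} {s sE : Finset (Fin n)}
    (hs : sE ⊆ s) (hD : Adapted D a ca s) (hE : Adapted E a ca sE) (b : G.Pt Y)
    (h : G.map τ b = a) : Nonempty (MonomialChart τ h ca s sE E' D') := by
  classical
  induction hτ with
  | nil =>
    obtain rfl : b = a := (hG.map_id X b).symm.trans h
    exact ⟨{
      c := ca, A := 1, B := 1
      mul_eq_one := by simp
      pull_x := fun j => by
        rw [hG.pullAt_id X h rfl]
        have : (1 : Matrix (Fin n) (Fin n) ℕ) j = Pi.single j 1 := by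
          ext k; simp [Matrix.one_apply, Pi.single_apply, eq_comm]
        rw [this, Coord.mono_single, pow_one]
      N := sE, sE_subset := subset_rfl, subset_s := hs
      col := fun _ _ _ => rfl, row := fun _ _ _ => rfl
      S := s
      mem_S := fun k => ⟨fun hk => ⟨hk, ((adapted_iff _ _).1 hD).1 k hk⟩, fun hk => hk.1⟩
      S_E := sE
      mem_S_E := fun k => ⟨fun hk => ⟨hk, ((adapted_iff _ _).1 hE).1 k hk⟩, fun hk => hk.1⟩
      adapted_D := hD, adapted_E := hE }⟩
  | @cons Y Z τ E' D' β C hτ hC hβ ih =>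
    have h₁ : G.map τ (G.map β b) = a := (hG.map_comp β τ b).symm.trans h
    have hpull : ∀ f, pullAt (G.comp β τ) h f = G.pull β b (pullAt τ h₁ f) :=
      fun f => hG.pullAt_comp β τ h rfl h₁ f
    have hloc := hG.isLocalHom_pull β b
    obtain ⟨P⟩ := ih (G.map β b) h₁
    by_cases htop : C (G.map β b) = ⊤
    · have hbij := hβ.iso_off b htop
      have hunit : ∀ k, IsUnit ((P.c.transport hG β b hbij).x k) ↔ IsUnit (P.c.x k) := fun k => by
        rw [Coord.transport_x, isUnit_map_iff]
      exact ⟨{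
        c := P.c.transport hG β b hbij, A := P.A, B := P.B, mul_eq_one := P.mul_eq_one
        pull_x := fun j => by
          rw [hpull, P.pull_x, Coord.mono, map_prod]
          exact Finset.prod_congr rfl fun k _ => map_pow _ _ _
        N := P.N, sE_subset := P.sE_subset, subset_s := P.subset_s, col := P.col, row := P.row
        S := P.S, mem_S := fun k => by rw [hunit]; exact P.mem_S k
        S_E := P.S_E, mem_S_E := fun k => by rw [hunit]; exact P.mem_S_E k
        adapted_D := adapted_transform_of_iso hG htop hbij P.adapted_D
        adapted_E := adapted_transform_of_iso hG htop hbij P.adapted_E }⟩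
    · obtain ⟨K, hKS, hK⟩ := hC.exists_eq_span P.adapted_D htop
      obtain ⟨i, hi, c', hci, hcK, hcoff⟩ := hβ.chart b P.c K htop hK
      have his : i ∈ s := ((P.mem_S i).1 (hKS hi)).1
      -- In the `x i`-chart every other coordinate of the centre acquires one factor `x i`, so the
      -- exponent matrix of the blowing-up is `1 + R`.
      let R : Matrix (Fin n) (Fin n) ℕ := Matrix.of fun l k =>
        if l ∈ K ∧ l ≠ i ∧ k = i then 1 else 0
      have hM : ∀ l, G.pull β b (P.c.x l) = c'.mono ((1 + R : Matrix _ _ ℕ) l) := by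
        intro l
        have e1 : (1 : Matrix (Fin n) (Fin n) ℕ) l = Pi.single l 1 := by
          ext k; simp [Matrix.one_apply, Pi.single_apply, eq_comm]
        change _ = c'.mono ((1 : Matrix (Fin n) (Fin n) ℕ) l + R l)
        rw [Coord.mono_add, e1, Coord.mono_single, pow_one]
        by_cases hl : l ∈ K ∧ l ≠ i
        · have e2 : R l = Pi.single i 1 := by
            ext k; simp [R, hl.1, hl.2, Pi.single_apply]
          rw [e2, Coord.mono_single, pow_one, hcK l hl.1 hl.2, hci, mul_comm]
        · have e2 : R l = 0 := by
            ext k; simp only [R, Matrix.of_apply, Pi.zero_apply]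
            rw [if_neg fun h => hl ⟨h.1, h.2.1⟩]
          rw [e2, Coord.mono_zero, mul_one]
          by_cases hlK : l ∈ K
          · obtain rfl : l = i := by_contra fun h => hl ⟨hlK, h⟩
            exact hci.symm
          · exact (hcoff l hlK).symm
      -- `R` is supported in the column `i` and in rows other than `i`. Hence `1 - R` is the inverse
      -- of `1 + R`.
      have hRR : R * R = 0 := by
        ext l k
        simp only [Matrix.mul_apply, R, Matrix.of_apply, Matrix.zero_apply]
        refine Finset.sum_eq_zero fun m _ => ?_
        split_ifs with h1 h2 <;> simp_all
      let RZ : Matrix (Fin n) (Fin n) ℤ := R.map (Nat.cast : ℕ → ℤ)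
      have hRZ : RZ * RZ = 0 := by
        have := congrArg (fun M : Matrix (Fin n) (Fin n) ℕ => M.map (Nat.castRingHom ℤ)) hRR
        simp only [Matrix.map_mul] at this
        ext l k
        simpa using congrFun (congrFun this l) k
      have hcast : (P.A * (1 + R)).map (Nat.cast : ℕ → ℤ)
          = P.A.map (Nat.cast : ℕ → ℤ) * (1 + RZ) := by
        have h1 : (1 + RZ) = (1 + R).map (Nat.castRingHom ℤ) := by
          ext l k; simp [RZ, Matrix.one_apply]
        rw [h1]
        exact Matrix.map_mul (f := Nat.castRingHom ℤ)
      have hcol : ∀ k, k ≠ i → ∀ j, (P.A * (1 + R)) j k = P.A j k := by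
        intro k hk j
        rw [mul_add, mul_one, Matrix.add_apply, Matrix.mul_apply]
        rw [Finset.sum_eq_zero fun l _ => by simp [R, hk], add_zero]
      have hunion : insert i s = s := Finset.insert_eq_of_mem his
      let S' : Finset (Fin n) := s.filter fun k => ¬ IsUnit (c'.x k)
      let S_E' : Finset (Fin n) := (insert i P.N).filter fun k => ¬ IsUnit (c'.x k)
      exact ⟨{
        c := c', A := P.A * (1 + R), B := (1 - RZ) * P.B
        mul_eq_one := by
          rw [hcast, mul_assoc, ← mul_assoc (1 + RZ)]
          have : (1 + RZ) * (1 - RZ) = 1 := by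
            rw [mul_sub, mul_one, add_mul, one_mul, hRZ, add_zero, add_sub_cancel_right]
          rw [this, one_mul, P.mul_eq_one]
        pull_x := fun j => by
          rw [hpull, P.pull_x, Coord.map_mono (G.pull β b) P.c c' hM]
          rfl
        -- The exceptional divisor is a component of both transforms, so `i` becomes a label of `E'`
        -- even if it previously named a component of `D'` only.
        N := insert i P.N
        sE_subset := P.sE_subset.trans (Finset.subset_insert _ _)
        subset_s := Finset.insert_subset his P.subset_s
        col := fun k hk j => by
          rw [Finset.mem_insert, not_or] at hk
          rw [hcol k hk.1, P.col k hk.2]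
        row := fun k hk j => by
          have hkK : k ∉ K := fun h => hk ((P.mem_S k).1 (hKS h)).1
          have : P.A k = (1 : Matrix (Fin n) (Fin n) ℕ) k := funext (P.row k hk)
          rw [Matrix.mul_apply, this, ← Matrix.mul_apply, one_mul]
          simp [R, hkK]
        S := S'
        mem_S := fun k => Finset.mem_filter
        S_E := S_E'
        mem_S_E := fun k => Finset.mem_filter
        adapted_D := adapted_transform hG (s := s) hi hK htop hci hcK hcoff P.mem_S
          (fun k => by rw [hunion]; exact Finset.mem_filter) P.adapted_D
        adapted_E := adapted_transform hG (s := P.N) hi hK htop hci hcK hcoff P.mem_S_E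
          (fun k => Finset.mem_filter) P.adapted_E }⟩

end

section

variable {G : Geometry.{u}}

/-! ### Logarithmic derivations in the coordinates of a monomial chart -/

section Exponents

variable {n : ℕ} {X : G.Obj n} {p : G.Pt X}

/-- Chart coordinates may be units at `b`; dropping them turns a formal monomial into one in
components through `b`. -/
theorem Coord.span_mono_restrict (c : Coord X p) {κ : Fin n → ℕ} {S : Finset (Fin n)}
    (h : ∀ k ∉ S, κ k = 0 ∨ IsUnit (c.x k)) :
    Ideal.span {c.mono κ} = Ideal.span {c.mono fun k => if k ∈ S then κ k else 0} := by
  have e : κ = (fun k => if k ∈ S then κ k else 0) + fun k => if k ∈ S then 0 else κ k := by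
    ext k; simp only [Pi.add_apply]; split_ifs <;> simp
  have hu : IsUnit (c.mono fun k => if k ∈ S then 0 else κ k) := by
    refine c.isUnit_mono fun k => ?_
    by_cases hk : k ∈ S
    · simp [hk]
    · simpa [hk] using (h k hk).symm
  conv_lhs => rw [e, Coord.mono_add, Ideal.span_singleton_mul_right_unit hu]

theorem Coord.mono_mem_span (c : Coord X p) {κ : Fin n → ℕ} {S : Finset (Fin n)} {k : Fin n}
    (hk : k ∈ S) (h : κ k ≠ 0) : c.mono κ ∈ Ideal.span (c.x '' S) := by
  have h1 : Pi.single k 1 ≤ κ := by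
    intro i
    rcases eq_or_ne i k with rfl | hi
    · simpa using Nat.one_le_iff_ne_zero.2 h
    · simp [hi]
  rw [c.mono_dvd_mono h1, Coord.mono_single, pow_one]
  exact Ideal.mul_mem_right _ _ (Ideal.subset_span ⟨k, hk, rfl⟩)

theorem Coord.isUnit_mono_of_notMem (c : Coord X p) {κ : Fin n → ℕ} {S s : Finset (Fin n)}
    (hS : ∀ k ∈ s, k ∉ S → IsUnit (c.x k)) (h : ∀ k ∈ S, κ k = 0) (h' : ∀ k ∉ s, κ k = 0) :
    IsUnit (c.mono κ) := by
  refine c.isUnit_mono fun k => ?_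
  by_cases hk : k ∈ S
  · exact Or.inr (h k hk)
  · by_cases hs : k ∈ s
    · exact Or.inl (hS k hs hk)
    · exact Or.inr (h' k hs)

end Exponents

namespace MonomialChart

variable {n : ℕ} {X Y : G.Obj n} {a : G.Pt X} {b : G.Pt Y} {τ : G.Hom Y X}
  {h : G.map τ b = a} {ca : Coord X a} {s sE : Finset (Fin n)} {E' D' : Set (IdealFamily Y)}
  (Q : MonomialChart τ h ca s sE E' D')

/-- The logarithmic derivation that lifts `x j ∂/∂x j`. -/
def theta (j : Fin n) : Derivation ℤ (G.Stalk Y b) (G.Stalk Y b) :=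
  ∑ k, (Q.B k j : G.Stalk Y b) • (Q.c.x k • Q.c.pd k)

theorem theta_mem_logDer (j : Fin n) : Q.theta j ∈ logDer E' b :=
  sum_mem fun k _ => Submodule.smul_mem _ _ (Q.adapted_E.smul_pd_mem_logDer k)

theorem theta_x (j k : Fin n) : Q.theta j (Q.c.x k) = Q.B k j * Q.c.x k := by
  rw [theta, derivation_sum_apply, Finset.sum_eq_single k]
  · simp [Q.c.pd_x]
  · intro i _ hi; simp [Q.c.pd_x, hi]
  · simp

theorem theta_mono (j : Fin n) (κ : Fin n → ℕ) :
    Q.theta j (Q.c.mono κ) = ((∑ k, κ k * Q.B k j : ℤ) : G.Stalk Y b) * Q.c.mono κ := by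
  rw [Q.c.deriv_mono κ (l := fun k => (Q.B k j : G.Stalk Y b)) fun k _ => Q.theta_x j k]
  push_cast
  rfl

theorem pull_mono (η : Fin n → ℕ) :
    pullAt τ h (ca.mono η) = Q.c.mono (Matrix.vecMul η Q.A) :=
  Coord.map_mono _ _ _ Q.pull_x η

/-- This is `(η A) B = η`, and the reason why `theta j` acts on the pull-back of `x^η` with
eigenvalue `η j`. -/
theorem sum_vecMul_mul (η : Fin n → ℕ) (j : Fin n) :
    ∑ k, ((Matrix.vecMul η Q.A k : ℕ) : ℤ) * Q.B k j = η j := by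
  have h1 : (fun k => ((Matrix.vecMul η Q.A k : ℕ) : ℤ))
      = Matrix.vecMul (fun i => (η i : ℤ)) (Q.A.map (Nat.cast : ℕ → ℤ)) := by
    ext k; simp [Matrix.vecMul, dotProduct]
  have h2 : Matrix.vecMul (fun k => ((Matrix.vecMul η Q.A k : ℕ) : ℤ)) Q.B
      = fun i => (η i : ℤ) := by
    rw [h1, Matrix.vecMul_vecMul, Q.mul_eq_one, Matrix.vecMul_one]
  exact congrFun h2 j

theorem theta_pull_mono (j : Fin n) (η : Fin n → ℕ) :
    Q.theta j (pullAt τ h (ca.mono η)) = (η j : G.Stalk Y b) * pullAt τ h (ca.mono η) := by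
  rw [Q.pull_mono, Q.theta_mono, Q.sum_vecMul_mul, Int.cast_natCast]

theorem theta_pull_x (j i : Fin n) :
    Q.theta j (pullAt τ h (ca.x i)) = if i = j then pullAt τ h (ca.x i) else 0 := by
  have := Q.theta_pull_mono j (Pi.single i 1)
  rw [Coord.mono_single, pow_one] at this
  rw [this]
  split_ifs with hij
  · simp [hij]
  · simp [Pi.single_eq_of_ne (Ne.symm hij)]

theorem theta_pull (hG : G.IsRegular) (j : Fin n) (f : G.Stalk X a) :
    Q.theta j (pullAt τ h f) = pullAt τ h (ca.x j * ca.pd j f) := by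
  rw [hG.deriv_pullAt τ h ca _ (Q.theta_mem_logDer j).1, Finset.sum_eq_single j]
  · rw [theta_pull_x, if_pos rfl, map_mul, mul_comm]
  · intro i _ hi; rw [theta_pull_x, if_neg hi, mul_zero]
  · simp

theorem theta_mem_span (j : Fin n) {f : G.Stalk Y b} (hf : f ∈ Ideal.span (Q.c.x '' Q.S)) :
    Q.theta j f ∈ Ideal.span (Q.c.x '' Q.S) := by
  refine derivation_mem_span ?_ hf
  rintro _ ⟨k, hk, rfl⟩
  rw [theta_x]
  exact Ideal.mul_mem_left _ _ (Ideal.subset_span ⟨k, hk, rfl⟩)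

theorem isUnit_of_mem_of_notMem {k : Fin n} (hk : k ∈ s) (hS : k ∉ Q.S) : IsUnit (Q.c.x k) := by
  by_contra hu
  exact hS ((Q.mem_S k).2 ⟨hk, hu⟩)

theorem S_E_subset : Q.S_E ⊆ Q.S := fun k hk =>
  (Q.mem_S k).2 ⟨Q.subset_s ((Q.mem_S_E k).1 hk).1, ((Q.mem_S_E k).1 hk).2⟩

theorem mem_S_E_of_mem {k : Fin n} (hk : k ∈ Q.S) (hN : k ∈ Q.N) : k ∈ Q.S_E :=
  (Q.mem_S_E k).2 ⟨hN, ((Q.mem_S k).1 hk).2⟩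

theorem span_le_maximalIdeal :
    Ideal.span (Q.c.x '' Q.S) ≤ IsLocalRing.maximalIdeal (G.Stalk Y b) := by
  rw [Ideal.span_le]
  rintro _ ⟨k, hk, rfl⟩
  exact (IsLocalRing.mem_maximalIdeal _).2 ((Q.mem_S k).1 hk).2

/-- A label outside `N` has never been taken by an exceptional divisor, so the exponent along that
component is the original one. -/
theorem vecMul_eq_of_notMem (η : Fin n → ℕ) {k : Fin n} (hk : k ∉ Q.N) :
    Matrix.vecMul η Q.A k = η k := by
  simp [Matrix.vecMul, dotProduct, Q.col k hk, Matrix.one_apply]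

/-- Pull-back is local, so the monomial is a nonunit and must involve a coordinate that vanishes at
`b`. Since `j ∈ s`, only labels in `s` occur in it. -/
theorem pull_x_mem_span (hG : G.IsRegular) {j : Fin n} (hj : j ∈ s) (hu : ¬ IsUnit (ca.x j)) :
    pullAt τ h (ca.x j) ∈ Ideal.span (Q.c.x '' Q.S) := by
  have hloc : IsLocalHom (pullAt τ h) := by subst h; exact hG.isLocalHom_pull τ b
  rw [Q.pull_x]
  by_contra hmem
  refine hu (isUnit_of_map_unit (pullAt τ h) _ ?_)
  rw [Q.pull_x]
  refine Q.c.isUnit_mono_of_notMem (fun k hk hkS => Q.isUnit_of_mem_of_notMem hk hkS)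
    (fun k hk => by_contra fun h0 => hmem (Q.c.mono_mem_span hk h0)) fun k hk => ?_
  rw [Q.col k (fun hN => hk (Q.subset_s hN)), Matrix.one_apply, if_neg]
  rintro rfl
  exact hk hj

/-- Monomials in components of the exceptional divisor divide their logarithmic derivatives. -/
theorem mono_dvd_deriv {D : Derivation ℤ (G.Stalk Y b) (G.Stalk Y b)} (hD : D ∈ logDer E' b)
    {κ : Fin n → ℕ} (hκ : ∀ k ∉ Q.N, κ k = 0) : Q.c.mono κ ∣ D (Q.c.mono κ) := by
  have h1 : ∀ k, ∃ l, κ k ≠ 0 → D (Q.c.x k) = l * Q.c.x k := by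
    intro k
    by_cases hk : k ∈ Q.S_E
    · obtain ⟨l, hl⟩ := Q.adapted_E.dvd_of_mem_logDer hD hk
      exact ⟨l, fun _ => by rw [hl, mul_comm]⟩
    · by_cases hN : k ∈ Q.N
      · have hu : IsUnit (Q.c.x k) := by
          by_contra hu
          exact hk ((Q.mem_S_E k).2 ⟨hN, hu⟩)
        obtain ⟨l, hl⟩ := hu.dvd (a := D (Q.c.x k))
        exact ⟨l, fun _ => by rw [hl, mul_comm]⟩
      · exact ⟨0, fun h0 => absurd (hκ k hN) h0⟩
  choose l hl using h1
  rw [Q.c.deriv_mono κ (l := l) hl]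
  exact dvd_mul_left _ _

theorem pull_mono_dvd_deriv (Q : MonomialChart τ h ca s sE E' D')
    {D : Derivation ℤ (G.Stalk Y b) (G.Stalk Y b)}
    (hD : D ∈ logDer E' b) {η : Fin n → ℕ} (hη : ∀ k ∉ sE, η k = 0) :
    pullAt τ h (ca.mono η) ∣ D (pullAt τ h (ca.mono η)) := by
  rw [Q.pull_mono]
  refine Q.mono_dvd_deriv hD fun k hk => ?_
  rw [Q.vecMul_eq_of_notMem η hk]
  exact hη k fun hE => hk (Q.sE_subset hE)

end MonomialChart

end

section

variable {G : Geometry.{u}}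

/-! ### Taylor expansion -/

section Taylor

theorem Coord.pd_comm {n : ℕ} {X : G.Obj n} {p : G.Pt X} (c : Coord X p) (i j : Fin n)
    (f : G.Stalk X p) : c.pd i (c.pd j f) = c.pd j (c.pd i f) := by
  have h : ⁅c.pd i, c.pd j⁆ = 0 := by
    refine c.pd_unique _ (fun s hs => ?_) fun k => ?_
    · rw [Derivation.commutator_apply, c.pd_scalar _ s hs, c.pd_scalar _ s hs, map_zero, map_zero,
        sub_zero]
    · rw [Derivation.commutator_apply, c.pd_x, c.pd_x]
      split_ifs <;> simp
  have := congrArg (fun D => D f) h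
  rw [Derivation.commutator_apply] at this
  exact sub_eq_zero.1 this

variable {n : ℕ} {X : G.Obj n} {p : G.Pt X} {c : Coord X p}

theorem Coord.pd_mem_span {S : Finset (Fin n)} {j : Fin n} (hj : j ∉ S) {f : G.Stalk X p}
    (hf : f ∈ Ideal.span (c.x '' S)) : c.pd j f ∈ Ideal.span (c.x '' S) := by
  refine derivation_mem_span ?_ hf
  rintro _ ⟨k, hk, rfl⟩
  rw [c.pd_x, if_neg (by rintro rfl; exact hj hk)]
  exact zero_mem _

/-- The Euler derivation acts on `m ^ k / m ^ (k + 1)` by multiplication by `k`. -/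
theorem Coord.euler_sub_mem (hc : c.Centred) (k : ℕ) {f : G.Stalk X p}
    (hf : f ∈ IsLocalRing.maximalIdeal (G.Stalk X p) ^ k) :
    ∑ j, c.x j * c.pd j f - k * f ∈ IsLocalRing.maximalIdeal (G.Stalk X p) ^ (k + 1) := by
  have hx : ∀ j, c.x j ∈ IsLocalRing.maximalIdeal (G.Stalk X p) := fun j => by
    rw [← show _ = _ from hc]; exact Ideal.subset_span ⟨j, rfl⟩
  induction k generalizing f with
  | zero =>
    simp only [Nat.cast_zero, zero_mul, sub_zero, zero_add, pow_one]
    exact sum_mem fun j _ => Ideal.mul_mem_right _ _ (hx j)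
  | succ k ih =>
    rw [pow_succ] at hf
    refine Submodule.mul_induction_on hf (fun a ha b hb => ?_) (fun a b ha hb => ?_)
    · have hb' : ∑ j, c.x j * c.pd j b - b ∈ IsLocalRing.maximalIdeal (G.Stalk X p) ^ 2 := by
        rw [← show _ = _ from hc] at hb
        induction hb using Submodule.span_induction with
        | mem x hx =>
          obtain ⟨i, rfl⟩ := hx
          simp [c.pd_x]
        | zero => simp
        | add x y _ _ hx hy =>
          simp only [map_add, mul_add, Finset.sum_add_distrib]
          rw [add_sub_add_comm]
          exact add_mem hx hy
        | smul g x hx' hx2 =>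
          have e : ∑ j, c.x j * c.pd j (g • x) - g • x
              = g * (∑ j, c.x j * c.pd j x - x) + x * ∑ j, c.x j * c.pd j g := by
            simp only [smul_eq_mul, Derivation.leibniz, mul_add, Finset.sum_add_distrib,
              Finset.mul_sum, mul_sub]
            simp only [mul_left_comm]
            ring
          rw [e]
          refine add_mem (Ideal.mul_mem_left _ _ hx2) ?_
          rw [pow_two]
          refine Ideal.mul_mem_mul (by rw [← show _ = _ from hc]; exact hx')
            (sum_mem fun j _ => Ideal.mul_mem_right _ _ (hx j))
      have e : ∑ j, c.x j * c.pd j (a * b) - ((k + 1 : ℕ) : G.Stalk X p) * (a * b)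
          = a * (∑ j, c.x j * c.pd j b - b) + (∑ j, c.x j * c.pd j a - k * a) * b := by
        simp only [smul_eq_mul, Derivation.leibniz, mul_add, Finset.sum_add_distrib,
          Finset.mul_sum, mul_sub, sub_mul, Finset.sum_mul]
        push_cast
        have e1 : ∑ x, c.x x * (a * (c.pd x) b) = ∑ x, a * (c.x x * (c.pd x) b) :=
          Finset.sum_congr rfl fun _ _ => by ring
        have e2 : ∑ x, c.x x * (b * (c.pd x) a) = ∑ x, c.x x * (c.pd x) a * b :=
          Finset.sum_congr rfl fun _ _ => by ring
        rw [e1, e2]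
        ring
      rw [e]
      refine add_mem ?_ ?_
      · rw [show k + 1 + 1 = k + 2 from rfl, pow_add]
        exact Ideal.mul_mem_mul ha hb'
      · rw [pow_succ]
        exact Ideal.mul_mem_mul (ih ha) hb
    · simp only [map_add, mul_add, Finset.sum_add_distrib]
      rw [add_sub_add_comm]
      exact add_mem ha hb

/-- By Euler's relation, a function of order at least `k + 1` on the stratum equals `(k + 1)⁻¹ ∑ x j
∂ j f` up to order `k + 2`. The terms with `j ∈ S` vanish on the stratum, so bounds on the remaining
derivatives raise the order step by step. -/
theorem Coord.mem_pow_succ_sup (hG : G.IsRegular) (hc : c.Centred) {S : Finset (Fin n)} (m : ℕ)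
    {f : G.Stalk X p} (hf : f ∈ IsLocalRing.maximalIdeal (G.Stalk X p))
    (hpd : ∀ j ∉ S, c.pd j f ∈
      IsLocalRing.maximalIdeal (G.Stalk X p) ^ m ⊔ Ideal.span (c.x '' S)) :
    f ∈ IsLocalRing.maximalIdeal (G.Stalk X p) ^ (m + 1) ⊔ Ideal.span (c.x '' S) := by
  have hx : ∀ j, c.x j ∈ IsLocalRing.maximalIdeal (G.Stalk X p) := fun j => by
    rw [← show _ = _ from hc]; exact Ideal.subset_span ⟨j, rfl⟩
  have key : ∀ k ≤ m,
      f ∈ IsLocalRing.maximalIdeal (G.Stalk X p) ^ (k + 1) ⊔ Ideal.span (c.x '' S) := by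
    intro k
    induction k with
    | zero => intro _; rw [zero_add, pow_one]; exact Ideal.mem_sup_left hf
    | succ k ih =>
      intro hk
      obtain ⟨f₁, hf₁, f₂, hf₂, rfl⟩ := Submodule.mem_sup.1 (ih (by omega))
      have h1 := Coord.euler_sub_mem hc (k + 1) hf₁
      have h2 : ∑ j, c.x j * c.pd j f₂ ∈ Ideal.span (c.x '' S) := by
        refine sum_mem fun j _ => ?_
        by_cases hj : j ∈ S
        · exact Ideal.mul_mem_right _ _ (Ideal.subset_span ⟨j, hj, rfl⟩)
        · exact Ideal.mul_mem_left _ _ (Coord.pd_mem_span hj hf₂)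
      have h3 : ∑ j, c.x j * c.pd j (f₁ + f₂) ∈
          IsLocalRing.maximalIdeal (G.Stalk X p) ^ (k + 1 + 1) ⊔ Ideal.span (c.x '' S) := by
        refine sum_mem fun j _ => ?_
        by_cases hj : j ∈ S
        · exact Ideal.mem_sup_right (Ideal.mul_mem_right _ _ (Ideal.subset_span ⟨j, hj, rfl⟩))
        · obtain ⟨g₁, hg₁, g₂, hg₂, e⟩ := Submodule.mem_sup.1 (hpd j hj)
          rw [← e, mul_add]
          refine add_mem (Ideal.mem_sup_left ?_) (Ideal.mem_sup_right (Ideal.mul_mem_left _ _ hg₂))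
          rw [pow_succ']
          exact Ideal.mul_mem_mul (hx j) (Ideal.pow_le_pow_right hk hg₁)
      have e : ((k + 1 : ℕ) : G.Stalk X p) * (f₁ + f₂) = ∑ j, c.x j * c.pd j (f₁ + f₂)
          - (∑ j, c.x j * c.pd j f₁ - ((k + 1 : ℕ) : G.Stalk X p) * f₁)
          - (∑ j, c.x j * c.pd j f₂ - ((k + 1 : ℕ) : G.Stalk X p) * f₂) := by
        simp only [map_add, mul_add, Finset.sum_add_distrib]
        ring
      rw [← Ideal.unit_mul_mem_iff_mem _ (hG.isUnit_natCast X p (k + 1) (by omega)), e]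
      exact sub_mem (sub_mem h3 (Ideal.mem_sup_left h1))
        (Ideal.mem_sup_right (sub_mem h2 (Ideal.mul_mem_left _ _ hf₂)))
  exact key m le_rfl

theorem Coord.iter_pd {X : G.Obj 3} {p : G.Pt X} (c : Coord X p) (γ : Fin 3 → ℕ) (j : Fin 3)
    (f : G.Stalk X p) : c.iter γ (c.pd j f) = c.iter (γ + Pi.single j 1) f := by
  have hcomm : ∀ i j : Fin 3, Function.Commute (c.pd i) (c.pd j) := fun i j f => c.pd_comm i j f
  unfold Coord.iter
  fin_cases j
  · simp only [Fin.zero_eta, Pi.add_apply, Pi.single_eq_same, Function.iterate_succ_apply]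
    rw [← ((hcomm 0 2).iterate_right (γ 2)).eq, ← ((hcomm 0 1).iterate_right (γ 1)).eq]
    simp
  · simp only [Fin.mk_one, Pi.add_apply, Pi.single_eq_same, Function.iterate_succ_apply]
    rw [← ((hcomm 1 2).iterate_right (γ 2)).eq]
    simp
  · simp

/-- Taylor expansion in the coordinates `x j`, `j ∉ S`. -/
theorem Coord.mem_pow_sup_of_iter (hG : G.IsRegular) {X : G.Obj 3} {p : G.Pt X} {c : Coord X p}
    (hc : c.Centred) {S : Finset (Fin 3)} (m : ℕ) {f : G.Stalk X p}
    (hf : ∀ γ : Fin 3 → ℕ, (∀ j ∈ S, γ j = 0) → ∑ j, γ j < m → ¬ IsUnit (c.iter γ f)) :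
    f ∈ IsLocalRing.maximalIdeal (G.Stalk X p) ^ m ⊔ Ideal.span (c.x '' S) := by
  induction m generalizing f with
  | zero => simp
  | succ m ih =>
    refine Coord.mem_pow_succ_sup hG hc m ?_ fun j hj => ih fun γ hγ hlt => ?_
    · exact (IsLocalRing.mem_maximalIdeal _).2 (hf 0 (by simp) (by simp))
    · rw [Coord.iter_pd]
      refine hf _ (fun i hi => ?_) ?_
      · rw [Pi.add_apply, hγ i hi, Pi.single_eq_of_ne (by rintro rfl; exact hj hi),
          add_zero]
      · simp only [Pi.add_apply, Finset.sum_add_distrib]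
        simpa using hlt

/-- Each derivation that does not strike a factor `v` leaves a multiple of `v` behind, so modulo `v`
only `n! * f` survives. -/
theorem iterate_mul_pow {O : Type*} [CommRing O] (D : Derivation ℤ O O) {v : O} (hv : D v = 1)
    (n : ℕ) (f : O) : v ∣ D^[n] (f * v ^ n) - n.factorial * f := by
  induction n generalizing f with
  | zero => simp
  | succ n ih =>
    have e : D (f * v ^ (n + 1)) = (D f * v + (n + 1 : ℕ) * f) * v ^ n := by
      rw [D.leibniz, D.leibniz_pow, hv]
      simp only [smul_eq_mul, nsmul_eq_mul, Nat.add_sub_cancel]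
      ring
    rw [Function.iterate_succ_apply, e]
    have h2 : D^[n] ((D f * v + (n + 1 : ℕ) * f) * v ^ n) - (n + 1).factorial * f
        = (D^[n] ((D f * v + (n + 1 : ℕ) * f) * v ^ n)
          - n.factorial * (D f * v + (n + 1 : ℕ) * f)) + v * (n.factorial * D f) := by
      rw [Nat.factorial_succ]; push_cast; ring
    rw [h2]
    exact dvd_add (ih _) (dvd_mul_right _ _)

theorem iterate_mul_pow_eq_zero {O : Type*} [CommRing O] (D : Derivation ℤ O O) {v : O}
    (hv : D v = 1) {n j : ℕ} (hj : j < n) {f : O} (hf : D f = 0) : D^[n] (f * v ^ j) = 0 := by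
  induction n generalizing f j with
  | zero => omega
  | succ n ih =>
    rw [Function.iterate_succ_apply, D.leibniz, D.leibniz_pow, hv, hf]
    rcases j with _ | j
    · simp [iterate_map_zero]
    · simp only [smul_eq_mul, mul_zero, add_zero, Nat.add_sub_cancel, mul_one, nsmul_eq_mul]
      rw [← mul_assoc]
      refine ih (by omega) ?_
      rw [D.leibniz, hf, D.map_natCast]; simp

end Taylor

end

section

variable {G : Geometry.{u}}

/-! ### Prepared normal form -/

/-- Third entries vanish, so independence is the nonvanishing of a `2 × 2` determinant. At a 1-point
two exponents supported on the divisor are never independent, so there a hypothesis `Indep` on such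
exponents is contradictory and no separate treatment is needed. -/
theorem Indep.det_ne_zero {α γ : Fin 3 → ℕ} (h : Indep α γ) (hα : α 2 = 0) (hγ : γ 2 = 0) :
    (α 0 * γ 1 : ℤ) - α 1 * γ 0 ≠ 0 := by
  intro h0
  have hQ : (α 0 * γ 1 : ℚ) - α 1 * γ 0 = 0 := by exact_mod_cast h0
  rw [Indep, LinearIndependent.pair_iff] at h
  have key : ∀ s t : ℚ, s * α 0 + t * γ 0 = 0 → s * α 1 + t * γ 1 = 0 → s = 0 ∧ t = 0 := by
    intro s t h1 h2
    refine h s t (funext fun j => ?_)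
    fin_cases j
    · simpa using h1
    · simpa using h2
    · simp [hα, hγ]
  obtain ⟨h1, h2⟩ := key (γ 0) (-α 0) (by ring) (by linarith)
  obtain ⟨h3, h4⟩ := key (γ 1) (-α 1) (by linarith) (by ring)
  have := key 1 0 (by rw [neg_eq_zero] at h2; rw [h2]; ring)
    (by rw [neg_eq_zero] at h4; rw [h4]; ring)
  exact one_ne_zero this.1

theorem isUnit_of_sub_mem {O : Type*} [CommRing O] [IsLocalRing O] {a b : O} (hb : IsUnit b)
    (h : a - b ∈ IsLocalRing.maximalIdeal O) : IsUnit a := by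
  by_contra ha
  have h1 := sub_mem ((IsLocalRing.mem_maximalIdeal a).2 ha) h
  rw [sub_sub_cancel] at h1
  exact (IsLocalRing.mem_maximalIdeal _).1 h1 hb

theorem dvd_iterate {O : Type*} [CommRing O] {D : Derivation ℤ O O} {w : O} (hw : D w = 0) (n : ℕ)
    {f : O} (h : w ∣ f) : w ∣ D^[n] f := by
  induction n generalizing f with
  | zero => exact h
  | succ n ih =>
    rw [Function.iterate_succ_apply]
    obtain ⟨g, rfl⟩ := h
    exact ih ⟨D g, by rw [D.leibniz, hw]; simp⟩

theorem iterate_mul_of_deriv_eq_zero {O : Type*} [CommRing O] {D : Derivation ℤ O O} {w : O}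
    (hw : D w = 0) (n : ℕ) (f : O) : D^[n] (w * f) = w * D^[n] f := by
  induction n generalizing f with
  | zero => rfl
  | succ n ih =>
    rw [Function.iterate_succ_apply, Function.iterate_succ_apply, ← ih, D.leibniz, hw]
    simp

theorem iterate_derivation_add {O : Type*} [CommRing O] (D : Derivation ℤ O O) (n : ℕ) (f g : O) :
    D^[n] (f + g) = D^[n] f + D^[n] g :=
  iterate_map_add D n f g

theorem Coord.pd_mono_eq_zero {n : ℕ} {X : G.Obj n} {p : G.Pt X} (c : Coord X p) {γ : Fin n → ℕ}
    {k : Fin n} (hk : γ k = 0) : c.pd k (c.mono γ) = 0 := by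
  rw [c.deriv_mono γ (l := 0) fun j hj => ?_]
  · simp
  · rw [c.pd_x, if_neg (by rintro rfl; exact hj hk)]; simp

namespace PointKind

theorem two_notMem (k : PointKind) : (2 : Fin 3) ∉ k.S := by
  cases k <;> simp [PointKind.S]

end PointKind

namespace PreparedForm

variable {r : ℕ} {U : G.Obj 3} {M : G.Obj (r + 2)} {E : Set (IdealFamily U)} {σ : G.Hom U M}
  {a : G.Pt U} (P : PreparedForm E σ a)

theorem x_mem (j : Fin 3) : P.c.x j ∈ IsLocalRing.maximalIdeal (G.Stalk U a) := by
  rw [← show _ = _ from P.c_centred]; exact Ideal.subset_span ⟨j, rfl⟩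

theorem not_isUnit_x (j : Fin 3) : ¬ IsUnit (P.c.x j) :=
  (IsLocalRing.mem_maximalIdeal _).1 (P.x_mem j)

/-- Otherwise the first component of `σ` would pull back to `1`, whereas the coordinates at `σ(a)`
vanish there. -/
theorem exists_alpha_ne_zero (hG : G.IsRegular) : ∃ j ∈ P.kind.S, P.α j ≠ 0 := by
  by_contra! h
  have h0 : P.α = 0 := by
    ext j
    by_cases hj : j ∈ P.kind.S
    · exact h j hj
    · exact P.α_support j hj
  have hloc := hG.isLocalHom_pull σ a
  have h1 : IsUnit (G.pull σ a (P.z.x 0)) := by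
    rw [P.first, h0, Coord.mono_zero]; exact isUnit_one
  refine (IsLocalRing.mem_maximalIdeal _).1 ?_ (isUnit_of_map_unit (G.pull σ a) _ h1)
  rw [← show _ = _ from P.z_centred]
  exact Ideal.subset_span ⟨0, rfl⟩

/-- Taylor expansion transverse to the divisor: by minimality of `d` no derivative of order less
than `d` is a unit. -/
theorem T_mem (hG : G.IsRegular) (i : Fin (r + 1)) : P.T i ∈
    IsLocalRing.maximalIdeal (G.Stalk U a) ^ P.d ⊔ Ideal.span (P.c.x '' P.kind.S) :=
  Coord.mem_pow_sup_of_iter hG P.c_centred P.d fun γ hγ hlt hu =>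
    absurd (P.d_least.2 ⟨i, γ, hγ, rfl, hu⟩) (not_le.2 hlt)

/-- The coefficients do not depend on `v`, so `d` derivatives in `v` remove all terms of degree
below `d`; the leading term contributes `d!` times a unit modulo `v`. -/
theorem isUnit_iterate_T (hG : G.IsRegular) : IsUnit ((P.c.pd 2)^[P.d] (P.T 0)) := by
  have hv : P.c.pd 2 (P.c.x 2) = 1 := by rw [P.c.pd_x, if_pos rfl]
  have h1 : (P.c.pd 2)^[P.d] (P.T 0) = (P.c.pd 2)^[P.d] (P.Ttilde 0 * P.c.x 2 ^ P.d) := by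
    rw [P.weierstrass, iterate_derivation_add]
    have : ∀ s ⊆ Finset.range P.d,
        (P.c.pd 2)^[P.d] (∑ j ∈ s, P.coeff 0 j * P.c.x 2 ^ j) = 0 := by
      intro s
      induction s using Finset.induction_on with
      | empty => intro _; simp [iterate_map_zero]
      | insert j s hj ih =>
        intro hs
        have hjd : j < P.d := Finset.mem_range.1 (hs (Finset.mem_insert_self _ _))
        rw [Finset.sum_insert hj, iterate_derivation_add,
          ih ((Finset.subset_insert _ _).trans hs), add_zero]
        exact iterate_mul_pow_eq_zero _ hv hjd (P.coeff_indep_v 0 j hjd)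
    rw [this _ subset_rfl, add_zero]
  rw [h1]
  refine isUnit_of_sub_mem ((hG.isUnit_natCast U a _ (Nat.factorial_ne_zero P.d)).mul
    P.isUnit_Ttilde) ?_
  obtain ⟨t, ht⟩ := iterate_mul_pow (P.c.pd 2) hv P.d (P.Ttilde 0)
  rw [ht]
  exact Ideal.mul_mem_right _ _ (P.x_mem 2)

theorem isUnit_T_of_d_eq_zero (hd : P.d = 0) : IsUnit (P.T 0) := by
  rw [P.weierstrass, hd]; simpa using P.isUnit_Ttilde

/-- The logarithmic derivation that kills `u ^ α` at a 2-point. -/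
def tangent : Derivation ℤ (G.Stalk U a) (G.Stalk U a) :=
  (P.α 0 : G.Stalk U a) • (P.c.x 1 • P.c.pd 1) - (P.α 1 : G.Stalk U a) • (P.c.x 0 • P.c.pd 0)

theorem smul_pd_mono (j : Fin 3) (η : Fin 3 → ℕ) :
    (P.c.x j • P.c.pd j) (P.c.mono η) = η j * P.c.mono η := by
  rw [P.c.deriv_mono η (l := fun i => if i = j then 1 else 0)]
  · simp
  · intro i _
    rw [Derivation.smul_apply, P.c.pd_x, smul_eq_mul]
    rcases eq_or_ne i j with rfl | hij
    · simp
    · simp [hij, hij.symm]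

theorem tangent_mono (η : Fin 3 → ℕ) :
    P.tangent (P.c.mono η) = ((P.α 0 * η 1 - P.α 1 * η 0 : ℤ) : G.Stalk U a) * P.c.mono η := by
  change (P.α 0 : G.Stalk U a) * (P.c.x 1 • P.c.pd 1) (P.c.mono η)
    - (P.α 1 : G.Stalk U a) * (P.c.x 0 • P.c.pd 0) (P.c.mono η) = _
  rw [smul_pd_mono, smul_pd_mono]
  push_cast
  ring

theorem tangent_mem (f : G.Stalk U a) : P.tangent f ∈ IsLocalRing.maximalIdeal (G.Stalk U a) := by
  simp only [tangent, Derivation.sub_apply, Derivation.smul_apply, smul_eq_mul]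
  exact sub_mem (Ideal.mul_mem_left _ _ (Ideal.mul_mem_right _ _ (P.x_mem 1)))
    (Ideal.mul_mem_left _ _ (Ideal.mul_mem_right _ _ (P.x_mem 0)))

theorem deriv_g (D : Derivation ℤ (G.Stalk U a) (G.Stalk U a))
    (hD : ∀ s ∈ G.scalars U a, D s = 0) (i : Fin (r + 1)) :
    ∃ h, D (P.g i) = h * D (P.c.mono P.α) := by
  obtain ⟨h, hh⟩ := P.dg_mem i
  refine ⟨h, ?_⟩
  rw [P.c.deriv_eq_sum D hD]
  simp only [derivation_sum_apply, Derivation.smul_apply, smul_eq_mul, hh, Finset.mul_sum]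
  exact Finset.sum_congr rfl fun j _ => by ring

/-- Apply to `g + u^δ T`, which `u^α` divides, an operator that preserves divisibility by `u^α`,
kills `g`, and turns `u^δ T` into `u^δ` times a unit. For `d > 0` this is the `d`-th derivative in
`v`. For `d = 0` it is the field `tangent`: it kills `u^α`, hence `g`, and its eigenvalue on `u^δ`
is a nonzero determinant. -/
theorem mono_alpha_dvd (hG : G.IsRegular) : P.c.mono P.α ∣ P.c.mono P.δ := by
  have h0 : P.c.mono P.α ∣ P.g 0 + P.c.mono P.δ * P.T 0 := by
    rw [← P.other 0]; exact P.dvd _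
  have h2 := P.kind.two_notMem
  rcases Nat.eq_zero_or_pos P.d with hd | hd
  · have htα : P.tangent (P.c.mono P.α) = 0 := by
      rw [tangent_mono, show ((P.α 0 : ℤ) * P.α 1 - P.α 1 * P.α 0) = 0 by ring]; simp
    have h1 := dvd_iterate htα 1 h0
    obtain ⟨h, hh⟩ := P.deriv_g P.tangent (fun s hs => by
      simp [tangent, P.c.pd_scalar _ s hs]) 0
    rw [Function.iterate_one, map_add, hh, htα, mul_zero, zero_add, Derivation.leibniz,
      tangent_mono] at h1
    have hdet := (P.δ_indep ⟨0, P.isUnit_T_of_d_eq_zero hd⟩).det_ne_zero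
      (P.α_support 2 h2) (P.δ_support 2 h2)
    have hu : IsUnit (P.tangent (P.T 0)
        + ((P.α 0 * P.δ 1 - P.α 1 * P.δ 0 : ℤ) : G.Stalk U a) * P.T 0) := by
      refine isUnit_of_sub_mem ((hG.isUnit_intCast U a _ hdet).mul
        (P.isUnit_T_of_d_eq_zero hd)) ?_
      rw [add_sub_cancel_right]
      exact P.tangent_mem _
    have e : P.c.mono P.δ • P.tangent (P.T 0) + P.T 0 •
        (((P.α 0 * P.δ 1 - P.α 1 * P.δ 0 : ℤ) : G.Stalk U a) * P.c.mono P.δ)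
        = P.c.mono P.δ * (P.tangent (P.T 0)
        + ((P.α 0 * P.δ 1 - P.α 1 * P.δ 0 : ℤ) : G.Stalk U a) * P.T 0) := by
      simp only [smul_eq_mul]; ring
    rw [e] at h1
    exact hu.dvd_mul_right.1 h1
  · have h1 := dvd_iterate (P.c.pd_mono_eq_zero (P.α_support 2 h2)) P.d h0
    rw [iterate_derivation_add, iterate_mul_of_deriv_eq_zero
      (P.c.pd_mono_eq_zero (P.δ_support 2 h2))] at h1
    have h3 : (P.c.pd 2)^[P.d] (P.g 0) = 0 := by
      obtain ⟨m, hm⟩ : ∃ m, P.d = m + 1 := ⟨P.d - 1, by omega⟩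
      rw [hm, Function.iterate_succ_apply, P.g_of_u 0 2 h2, iterate_map_zero]
    rw [h3, zero_add] at h1
    exact (P.isUnit_iterate_T hG).dvd_mul_right.1 h1

/-- A homomorphism to a local ring over `a`, with a module `Λ` of logarithmic derivations. -/
structure IsPull {O : Type*} [CommRing O] (φ : G.Stalk U a →+* O)
    (Λ : Submodule O (Derivation ℤ O O)) : Prop where
  chain : ∀ D ∈ Λ, ∀ f, D (φ f) = ∑ j, φ (P.c.pd j f) * D (φ (P.c.x j))
  dvd : ∀ D ∈ Λ, ∀ η : Fin 3 → ℕ, (∀ j ∉ P.kind.S, η j = 0) →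
    φ (P.c.mono η) ∣ D (φ (P.c.mono η))
  theta : ∀ j, ∃ X ∈ Λ, ∀ η : Fin 3 → ℕ, X (φ (P.c.mono η)) = η j * φ (P.c.mono η)

namespace IsPull

variable {P} {O : Type*} [CommRing O] {φ : G.Stalk U a →+* O}
  {Λ : Submodule O (Derivation ℤ O O)} (H : P.IsPull φ Λ)

include H

theorem deriv_component (i : Fin (r + 1)) : ∃ h, ∀ D ∈ Λ,
    D (φ (G.pull σ a (P.z.x i.succ))) = h * D (φ (P.c.mono P.α))
      + D (φ (P.c.mono P.δ) * φ (P.T i)) := by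
  obtain ⟨h, hh⟩ := P.dg_mem i
  refine ⟨φ h, fun D hD => ?_⟩
  rw [P.other, map_add, map_add, map_mul, H.chain D hD (P.g i), H.chain D hD (P.c.mono P.α),
    Finset.mul_sum]
  congr 1
  exact Finset.sum_congr rfl fun j _ => by rw [hh, map_mul, mul_assoc]

/-- The minors of the components of `σ`. -/
theorem minor_mem (hG : G.IsRegular) (hO : ∀ m : ℕ, m ≠ 0 → IsUnit (m : O)) {L : Ideal O}
    (hL : ∀ X ∈ Λ, X (φ (P.c.mono P.α)) = 0 →
      ∀ i, ∃ l ∈ L, X (φ (P.c.mono P.δ) * φ (P.T i)) = φ (P.c.mono P.δ) * l)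
    {D₁ D₂ : Derivation ℤ O O} (h₁ : D₁ ∈ Λ) (h₂ : D₂ ∈ Λ) (i j : Fin (r + 2)) :
    minor D₁ D₂ (φ (G.pull σ a (P.z.x i))) (φ (G.pull σ a (P.z.x j))) ∈
      Ideal.span {φ (P.c.mono P.α) * φ (P.c.mono P.δ)} * L := by
  obtain ⟨j₀, -, hj₀⟩ := P.exists_alpha_ne_zero hG
  obtain ⟨X₀, hX₀, hX₀'⟩ := H.theta j₀
  choose h hh using H.deriv_component
  -- The factor `p X₀` is prescribed to be the integer `α j₀`, so that it is visibly a unit; for the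
  -- other fields any logarithmic factor will do.
  have hp : ∀ D : Derivation ℤ O O, ∃ p, (D ∈ Λ →
      D (φ (P.c.mono P.α)) = p * φ (P.c.mono P.α)) ∧ (D = X₀ → p = P.α j₀) := by
    intro D
    by_cases hD : D ∈ Λ
    · by_cases hD0 : D = X₀
      · exact ⟨P.α j₀, fun _ => by rw [hD0, hX₀'], fun _ => rfl⟩
      · obtain ⟨p, hp⟩ := H.dvd D hD P.α P.α_support
        exact ⟨p, fun _ => by rw [hp, mul_comm], fun h => absurd h hD0⟩
    · exact ⟨P.α j₀, fun h => absurd h hD, fun _ => rfl⟩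
  choose p hp using hp
  obtain ⟨k1, k2⟩ := LogFitting.minor_mem (A := φ (P.c.mono P.α)) (B := φ (P.c.mono P.δ)) p
    (fun D hD => (hp D).1 hD) hX₀ (by rw [(hp X₀).2 rfl]; exact hO _ hj₀)
    (map_dvd φ (P.mono_alpha_dvd hG)) (s := fun i => φ (G.pull σ a (P.z.x i.succ)))
    (h := h) (T := fun i => φ (P.T i)) (fun D hD i => hh i D hD)
    (fun D hD => H.dvd D hD P.δ P.δ_support) hL h₁ h₂
  refine Fin.cases (Fin.cases ?_ fun j => ?_) (fun i => Fin.cases ?_ fun j => ?_) i j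
  · rw [minor, mul_comm (D₁ _), sub_self]; exact zero_mem _
  · rw [P.first]; exact k1 j
  · have e : ∀ f g : O, minor D₁ D₂ f g = -minor D₁ D₂ g f := fun f g => by
      simp only [minor]; ring
    rw [e, P.first]; exact neg_mem (k1 i)
  · exact k2 i j

/-- A minor that involves the first component. -/
theorem exists_minor_eq (hG : G.IsRegular) (hO : ∀ m : ℕ, m ≠ 0 → IsUnit (m : O))
    {X : Derivation ℤ O O} (hX : X ∈ Λ) (hXα : X (φ (P.c.mono P.α)) = 0) (i : Fin (r + 1)) :
    ∃ X₀ ∈ Λ, ∃ e, IsUnit e ∧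
      e * minor X₀ X (φ (G.pull σ a (P.z.x 0))) (φ (G.pull σ a (P.z.x i.succ)))
        = φ (P.c.mono P.α) * X (φ (P.c.mono P.δ) * φ (P.T i)) := by
  obtain ⟨j₀, -, hj₀⟩ := P.exists_alpha_ne_zero hG
  obtain ⟨X₀, hX₀, hX₀'⟩ := H.theta j₀
  obtain ⟨h, hh⟩ := H.deriv_component i
  obtain ⟨e, he⟩ := (hO _ hj₀).exists_left_inv
  refine ⟨X₀, hX₀, e, IsUnit.of_mul_eq_one _ he, ?_⟩
  rw [minor, hh X hX, P.first, hX₀', hXα]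
  linear_combination (φ (P.c.mono P.α) * X (φ (P.c.mono P.δ) * φ (P.T i))) * he

end IsPull

theorem isPull_id : P.IsPull (RingHom.id _) (logDer E a) where
  chain D hD f := by
    conv_lhs => rw [P.c.deriv_eq_sum D hD.1]
    simp only [derivation_sum_apply, Derivation.smul_apply, smul_eq_mul, RingHom.id_apply]
    exact Finset.sum_congr rfl fun j _ => mul_comm _ _
  dvd D hD η hη := by
    have h1 : ∀ k, ∃ l, η k ≠ 0 → D (P.c.x k) = l * P.c.x k := by
      intro k
      by_cases hk : k ∈ P.kind.S
      · obtain ⟨l, hl⟩ := P.c_adapted.dvd_of_mem_logDer hD hk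
        exact ⟨l, fun _ => by rw [hl, mul_comm]⟩
      · exact ⟨0, fun h0 => absurd (hη k hk) h0⟩
    choose l hl using h1
    rw [RingHom.id_apply, P.c.deriv_mono η (l := l) hl]
    exact dvd_mul_left _ _
  theta j := ⟨_, P.c_adapted.smul_pd_mem_logDer j, fun η => P.smul_pd_mono j η⟩

/-- Each `T i` has order at least `d` on the stratum and a logarithmic derivation lowers this by at
most one, so after division by `u^(α+δ)` all minors have order at least `d - 1`. The minor of the
first two components along `∂/∂v` shows that no further power of `u` divides the Fitting ideal. -/
theorem le_rhoValue (hG : G.IsRegular) (hd : 1 ≤ P.d) : ((P.d - 1 : ℕ) : ℕ∞) ≤ P.rhoValue := by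
  have hfit := logFitting_eq_minorIdeal hG σ P.z P.c_adapted
  have h2 := P.kind.two_notMem
  obtain ⟨m, hm⟩ : ∃ m, P.d = m + 1 := ⟨P.d - 1, by omega⟩
  have hαδ : ∀ j ∉ P.kind.S, (P.α + P.δ) j = 0 := fun j hj => by
    rw [Pi.add_apply, P.α_support j hj, P.δ_support j hj, add_zero]
  refine le_rhoAt hG hαδ (L := IsLocalRing.maximalIdeal (G.Stalk U a) ^ (P.d - 1)
    ⊔ Ideal.span (P.c.x '' P.kind.S)) ?_ (f := P.c.pd 2 (P.T 0)) ?_ ?_ le_rfl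
  · rw [hfit]
    refine minorIdeal_le hG σ rfl P.z fun D₁ h₁ D₂ h₂ i j => ?_
    rw [Coord.mono_add]
    refine P.isPull_id.minor_mem hG (hG.isUnit_natCast U a) (fun X hX hXα i => ?_) h₁ h₂ i j
    obtain ⟨q, hq⟩ := P.isPull_id.dvd X hX P.δ P.δ_support
    refine ⟨q * P.T i + X (P.T i), ?_, ?_⟩
    · refine add_mem (Ideal.mul_mem_left _ _ (pow_sup_le _ _ (by omega) (P.T_mem hG i))) ?_
      refine derivation_mem_pow_sup (fun f hf => derivation_mem_span ?_ hf) _ ?_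
      · rintro _ ⟨k, hk, rfl⟩
        obtain ⟨l, hl⟩ := P.c_adapted.dvd_of_mem_logDer hX (Finset.mem_coe.1 hk)
        rw [hl]
        exact Ideal.mul_mem_right _ _ (Ideal.subset_span ⟨k, hk, rfl⟩)
      · rw [Nat.sub_add_cancel hd]; exact P.T_mem hG i
    · simp only [RingHom.id_apply] at hq ⊢
      rw [X.leibniz, hq]; simp only [smul_eq_mul]; ring
  · rw [hfit]
    have hX : P.c.pd 2 ∈ logDer E a := P.c_adapted.pd_mem_logDer h2
    obtain ⟨X₀, hX₀, e, -, he⟩ := P.isPull_id.exists_minor_eq hG (hG.isUnit_natCast U a) hX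
      (P.c.pd_mono_eq_zero (P.α_support 2 h2)) 0
    simp only [RingHom.id_apply] at he
    rw [Derivation.leibniz, P.c.pd_mono_eq_zero (P.δ_support 2 h2), smul_zero, add_zero,
      smul_eq_mul, ← mul_assoc, ← Coord.mono_add] at he
    rw [← he]
    exact Ideal.mul_mem_left _ _ (minor_mem_minorIdeal hX₀ hX ⟨_, rfl⟩ ⟨_, rfl⟩)
  · intro hmem
    -- Differentiation in `v` preserves the ideal of the stratum, so if it contained `∂T/∂v` it
    -- would contain the unit `∂^d T/∂v^d`.
    have h1 : ∀ (n : ℕ) (f : G.Stalk U a), f ∈ Ideal.span (P.c.x '' P.kind.S) →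
        (P.c.pd 2)^[n] f ∈ Ideal.span (P.c.x '' P.kind.S) := by
      intro n
      induction n with
      | zero => intro f hf; exact hf
      | succ n ih =>
        intro f hf
        rw [Function.iterate_succ_apply]
        exact ih _ (Coord.pd_mem_span h2 hf)
    have h3 : (P.c.pd 2)^[P.d] (P.T 0) ∈ Ideal.span (P.c.x '' P.kind.S) := by
      rw [hm, Function.iterate_succ_apply]; exact h1 m _ hmem
    refine (IsLocalRing.mem_maximalIdeal _).1 (Ideal.span_le.2 ?_ h3) (P.isUnit_iterate_T hG)
    rintro _ ⟨k, -, rfl⟩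
    exact P.x_mem k

end PreparedForm

end

/-! ### Exponents of the declared divisor and ideal -/

section

variable {G : Geometry.{u}}

theorem Adapted.insert_component {n : ℕ} {X : G.Obj n} {p : G.Pt X} {E : Set (IdealFamily X)}
    {c : Coord X p} {S : Finset (Fin n)} (h : Adapted E p c S) {V : IdealFamily X} {j : Fin n}
    (hV : V p = Ideal.span {c.x j}) (hj : j ∉ S) (hu : ¬ IsUnit (c.x j)) :
    Adapted (insert V E) p c (insert j S) := by
  rw [adapted_iff] at h ⊢
  obtain ⟨h1, h2, h3⟩ := h
  have hE : ∀ H ∈ E, H p ≠ Ideal.span {c.x j} := by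
    intro H hH hp
    obtain ⟨i, hi, hi'⟩ := h2 H hH (by rw [hp, Ne, Ideal.span_singleton_eq_top]; exact hu)
    refine c.not_mem_span_of_ne (i := i) (by rintro rfl; exact hj hi) hu ?_
    rw [← hp, hi']
    exact Ideal.mem_span_singleton_self _
  refine ⟨fun i hi => ?_, ?_, fun i hi => ?_⟩
  · rcases Finset.mem_insert.1 hi with rfl | hi
    · exact hu
    · exact h1 i hi
  · rintro H (rfl | hH) hp
    · exact ⟨j, Finset.mem_insert_self _ _, hV⟩
    · obtain ⟨i, hi, hi'⟩ := h2 H hH hp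
      exact ⟨i, Finset.mem_insert_of_mem hi, hi'⟩
  · rcases Finset.mem_insert.1 hi with rfl | hi
    · refine ⟨V, Or.inl rfl, hV, ?_⟩
      rintro H (rfl | hH) hp
      · rfl
      · exact absurd hp (hE H hH)
    · obtain ⟨H, hH, hHp, huniq⟩ := h3 i hi
      refine ⟨H, Or.inr hH, hHp, ?_⟩
      rintro H' (rfl | hH') hp
      · exfalso
        refine c.not_mem_span_of_ne (ne_of_mem_of_not_mem hi hj) hu ?_
        rw [← hV, hp]
        exact Ideal.mem_span_singleton_self _
      · exact huniq H' hH' hp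

namespace PreparedForm

variable {r : ℕ} {U : G.Obj 3} {M : G.Obj (r + 2)} {E D : Set (IdealFamily U)} {σ : G.Hom U M}
  {a : G.Pt U} (P : PreparedForm E σ a)

open Classical in
/-- The indices of the components of the declared divisor. -/
def declaredIndex : Finset (Fin 3) := if P.NonGeneric then Finset.univ else insert 2 P.kind.S

theorem subset_declaredIndex : P.kind.S ⊆ P.declaredIndex := by
  unfold declaredIndex
  split_ifs
  · exact Finset.subset_univ _
  · exact Finset.subset_insert _ _

theorem two_mem_declaredIndex : 2 ∈ P.declaredIndex := by
  unfold declaredIndex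
  split_ifs <;> simp

theorem adapted_declared (hD : P.IsDeclaredDivisor D) : Adapted D a P.c P.declaredIndex := by
  unfold declaredIndex
  rcases hD with ⟨hn, V, W, hV, hW, rfl⟩ | ⟨hn, V, hV, rfl⟩
  · rw [if_pos hn]
    have hS : P.kind.S = {0} := by rw [hn.1, PointKind.S]
    have h1 := P.c_adapted.insert_component hW (by simp [hS]) (P.not_isUnit_x 1)
    have h2 := h1.insert_component hV (by simp [hS]) (P.not_isUnit_x 2)
    convert h2 using 1
    rw [hS]; decide
  · rw [if_neg hn]
    exact P.c_adapted.insert_component hV P.kind.two_notMem (P.not_isUnit_x 2)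

open Classical in
/-- The exponent of the last generator of the declared ideal. -/
def lastExponent : Fin 3 → ℕ := P.β + if P.NonGeneric then Pi.single 1 1 else 0

/-- The exponents of the generators of the declared ideal. -/
def exponents : Set (Fin 3 → ℕ) :=
  {Pi.single 2 P.d} ∪ {η | ∃ ij ∈ P.J, η = P.expo ij.1 ij.2 + Pi.single 2 ij.2} ∪
    {P.lastExponent}

theorem single_mem_exponents : Pi.single 2 P.d ∈ P.exponents := Or.inl (Or.inl rfl)

theorem expo_mem_exponents {ij : Fin (r + 1) × ℕ} (h : ij ∈ P.J) :
    P.expo ij.1 ij.2 + Pi.single 2 ij.2 ∈ P.exponents := Or.inl (Or.inr ⟨ij, h, rfl⟩)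

theorem lastExponent_mem_exponents : P.lastExponent ∈ P.exponents := Or.inr rfl

theorem declaredIdeal_eq : P.declaredIdeal = Ideal.span (P.c.mono '' P.exponents) := by
  rw [declaredIdeal, exponents, Set.image_union, Set.image_union, Set.image_singleton,
    Set.image_singleton, Coord.mono_single]
  congr 2
  · congr 1
    ext f
    constructor
    · rintro ⟨ij, hij, rfl⟩
      exact ⟨_, ⟨ij, hij, rfl⟩, by rw [Coord.mono_add, Coord.mono_single]⟩
    · rintro ⟨_, ⟨ij, hij, rfl⟩, rfl⟩
      exact ⟨ij, hij, by rw [Coord.mono_add, Coord.mono_single]⟩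
  · ext f
    rw [Set.mem_singleton_iff, Set.mem_ofPred_eq]
    by_cases hn : P.NonGeneric
    · simp [hn, lastExponent, Coord.mono_add, Coord.mono_single]
    · simp [hn, lastExponent]

theorem lastExponent_two : P.lastExponent 2 = 0 := by
  unfold lastExponent
  split_ifs <;> simp [P.β_support 2 P.kind.two_notMem]

theorem eq_one_of_notMem {k : Fin 3} (hk : k ∉ P.declaredIndex) :
    k = 1 ∧ P.kind = .one ∧ ¬ P.NonGeneric := by
  unfold declaredIndex at hk
  split_ifs at hk with hn
  · simp at hk
  · cases hkind : P.kind <;> rw [hkind] at hk <;> fin_cases k <;> simp_all [PointKind.S]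

/-- The only coordinate that may lie outside the declared divisor is `w` at a generic 1-point, and
there no generator involves `w`. -/
theorem exponent_eq_zero_of_notMem {k : Fin 3} (hk : k ∉ P.declaredIndex) {η : Fin 3 → ℕ}
    (hη : η ∈ P.exponents) : η k = 0 := by
  obtain ⟨rfl, hkind, hn⟩ := P.eq_one_of_notMem hk
  rcases hη with (rfl | ⟨ij, hij, rfl⟩) | rfl
  · simp
  · have : P.expo ij.1 ij.2 1 = 0 := by
      by_contra h0
      exact hn ⟨hkind, ij, hij, h0⟩
    simp [this]
  · simp [lastExponent, hn, P.β_support 1 (by simp [hkind, PointKind.S])]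

/-- The last generator is free of `v` and `v^d` is free of `w`. This is what makes the pulled-back
ideal `E'`-monomial once it is `D'`-monomial. -/
theorem exists_exponent_eq_zero {k : Fin 3} (hk : k ∉ P.kind.S) :
    ∃ η ∈ P.exponents, η k = 0 := by
  rcases eq_or_ne k 2 with rfl | h2
  · exact ⟨_, P.lastExponent_mem_exponents, P.lastExponent_two⟩
  · exact ⟨_, P.single_mem_exponents, by simp [h2]⟩

theorem coeff_eq_zero {i : Fin (r + 1)} {j : ℕ} (h1 : 1 ≤ j) (hd : j < P.d) (hJ : (i, j) ∉ P.J) :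
    P.coeff i j = 0 := by
  by_contra h0
  exact hJ ⟨h1, hd, h0⟩

theorem isUnit_atilde {i : Fin (r + 1)} {j : ℕ} (hJ : (i, j) ∈ P.J) : IsUnit (P.atilde i j) := by
  refine (P.atilde_zero_or_unit i j).resolve_left fun h0 => hJ.2.2 ?_
  rw [P.coeff_eq i j hJ.1 hJ.2.1, h0, mul_zero]

theorem mono_mem_declaredIdeal {η : Fin 3 → ℕ} (hη : η ∈ P.exponents) :
    P.c.mono η ∈ P.declaredIdeal := by
  rw [declaredIdeal_eq]; exact Ideal.subset_span ⟨η, hη, rfl⟩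

/-- All the terms of `T i`, with the possible exception of `a_{i0}`, belong to the declared
ideal. -/
theorem T_sub_mem (i : Fin (r + 1)) {f : G.Stalk U a}
    (hf : 0 < P.d → P.coeff i 0 - f ∈ P.declaredIdeal) (hf0 : P.d = 0 → f = 0) :
    P.T i - f ∈ P.declaredIdeal := by
  have h1 : P.Ttilde i * P.c.x 2 ^ P.d ∈ P.declaredIdeal := by
    rw [← Coord.mono_single]
    exact Ideal.mul_mem_left _ _ (P.mono_mem_declaredIdeal P.single_mem_exponents)
  rw [P.weierstrass, add_sub_assoc]
  refine add_mem h1 ?_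
  rcases Nat.eq_zero_or_pos P.d with hd | hd
  · simp [hd, hf0 hd]
  · obtain ⟨m, hm⟩ : ∃ m, P.d = m + 1 := ⟨P.d - 1, by omega⟩
    rw [hm, Finset.sum_range_succ', pow_zero, mul_one, add_sub_assoc]
    refine add_mem (sum_mem fun j hj => ?_) (hf hd)
    have hjd : j + 1 < P.d := by have := Finset.mem_range.1 hj; omega
    by_cases hJ : (i, j + 1) ∈ P.J
    · rw [P.coeff_eq i (j + 1) (by omega) hjd, mul_right_comm, ← Coord.mono_single,
        ← Coord.mono_add]
      exact Ideal.mul_mem_right _ _ (P.mono_mem_declaredIdeal (P.expo_mem_exponents hJ))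
    · rw [P.coeff_eq_zero (by omega) hjd hJ, zero_mul]
      exact zero_mem _

theorem d_pos_of_nonGeneric (hn : P.NonGeneric) : 0 < P.d := by
  obtain ⟨-, ij, hij, -⟩ := hn
  exact lt_of_le_of_lt (Nat.zero_le _) hij.2.1

/-! ### The declared ideal in a monomial chart -/

section Chart

variable {Y : G.Obj 3} {τ : G.Hom Y U} {b : G.Pt Y} {h : G.map τ b = a}
  {E' D' : Set (IdealFamily Y)} (Q : MonomialChart τ h P.c P.declaredIndex P.kind.S E' D')
  {γ : Fin 3 → ℕ}

theorem isPull_chart (Q : MonomialChart τ h P.c P.declaredIndex P.kind.S E' D')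
    (hG : G.IsRegular) : P.IsPull (pullAt τ h) (logDer E' b) where
  chain D hD f := hG.deriv_pullAt τ h P.c D hD.1 f
  dvd _ hD _ hη := Q.pull_mono_dvd_deriv hD hη
  theta j := ⟨Q.theta j, Q.theta_mem_logDer j, fun η => Q.theta_pull_mono j η⟩

theorem map_declaredIdeal : P.declaredIdeal.map (pullAt τ h)
    = Ideal.span ((fun η => Q.c.mono (Matrix.vecMul η Q.A)) '' P.exponents) := by
  rw [declaredIdeal_eq, Ideal.map_span, Set.image_image]
  simp only [Q.pull_mono]

variable (hγ : ∀ k ∉ Q.S, γ k = 0)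
  (hI : P.declaredIdeal.map (pullAt τ h) = Ideal.span {Q.c.mono γ})

include hγ hI

theorem le_vecMul (hG : G.IsRegular) {η : Fin 3 → ℕ} (hη : η ∈ P.exponents) :
    γ ≤ Matrix.vecMul η Q.A := by
  intro k
  by_cases hk : k ∈ Q.S
  · refine Coord.le_of_mono_dvd hG Q.c ((Q.mem_S k).1 hk).2 ?_
    rw [← Ideal.mem_span_singleton, ← hI, map_declaredIdeal P Q]
    exact Ideal.subset_span ⟨η, hη, rfl⟩
  · rw [hγ k hk]; exact Nat.zero_le _

/-- In a local ring a principal ideal is generated by one of any given set of generators. The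
exponent found here agrees with `γ` at all components of `D'` through `b`; the other coordinates
occurring in it are units. -/
theorem exists_tight (hG : G.IsRegular) :
    ∃ η ∈ P.exponents, ∀ k ∈ Q.S, Matrix.vecMul η Q.A k = γ k := by
  rw [map_declaredIdeal P Q] at hI
  obtain ⟨_, ⟨η, hη, rfl⟩, hdvd⟩ :=
    exists_mem_dvd_of_span_eq (Coord.mono_mem_nonZeroDivisors hG Q.c γ) hI
  refine ⟨η, hη, fun k hk => le_antisymm ?_ ?_⟩
  · exact Coord.le_of_mono_dvd hG Q.c ((Q.mem_S k).1 hk).2 hdvd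
  · rw [← map_declaredIdeal P Q] at hI
    exact P.le_vecMul Q hγ hI hG hη k

/-- Along a component of `D'` outside `E'` the generators keep their original exponents, one of
which is zero, and `γ` is a lower bound for all of them. -/
theorem exponent_eq_zero (hG : G.IsRegular) {k : Fin 3} (hk : k ∉ Q.S_E) : γ k = 0 := by
  by_cases hS : k ∈ Q.S
  · have hN : k ∉ Q.N := fun hN => hk (Q.mem_S_E_of_mem hS hN)
    obtain ⟨η, hη, h0⟩ := P.exists_exponent_eq_zero fun h => hN (Q.sE_subset h)
    have : γ k ≤ Matrix.vecMul η Q.A k := P.le_vecMul Q hγ hI hG hη k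
    rw [Q.vecMul_eq_of_notMem η hN, h0] at this
    omega
  · exact hγ k hS

theorem pull_exponent (hG : G.IsRegular) {η : Fin 3 → ℕ} (hη : η ∈ P.exponents) :
    pullAt τ h (P.c.mono η) = Q.c.mono γ * Q.c.mono (Matrix.vecMul η Q.A - γ) := by
  rw [Q.pull_mono, Q.c.mono_dvd_mono (P.le_vecMul Q hγ hI hG hη)]

omit hγ hI in
theorem isUnit_quotient {η : Fin 3 → ℕ} (hη : η ∈ P.exponents)
    (ht : ∀ k ∈ Q.S, Matrix.vecMul η Q.A k = γ k) :
    IsUnit (Q.c.mono (Matrix.vecMul η Q.A - γ)) := by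
  refine Q.c.isUnit_mono_of_notMem (fun k hk hkS => Q.isUnit_of_mem_of_notMem hk hkS)
    (fun k hk => ?_) fun k hk => ?_
  · rw [Pi.sub_apply, ht k hk, Nat.sub_self]
  · rw [Pi.sub_apply, Q.vecMul_eq_of_notMem η fun h => hk (Q.subset_s h),
      P.exponent_eq_zero_of_notMem hk hη, Nat.zero_sub]

/-- A generator whose quotient by `x^γ` is a nonunit vanishes on the stratum of `D'`; this is how
terms are discarded in the order estimates. -/
theorem quotient_mem (hG : G.IsRegular) {η : Fin 3 → ℕ} (hη : η ∈ P.exponents)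
    (ht : ¬ ∀ k ∈ Q.S, Matrix.vecMul η Q.A k = γ k) :
    Q.c.mono (Matrix.vecMul η Q.A - γ) ∈ Ideal.span (Q.c.x '' Q.S) := by
  push Not at ht
  obtain ⟨k, hk, hne⟩ := ht
  refine Q.c.mono_mem_span hk ?_
  have : γ k ≤ Matrix.vecMul η Q.A k := P.le_vecMul Q hγ hI hG hη k
  rw [Pi.sub_apply]
  omega

/-- Division by `x^γ` shifts all eigenvalues by a constant independent of `η`, so eigenvalues that
were distinct remain distinct. -/
theorem theta_quotient (hG : G.IsRegular) (j : Fin 3) {η : Fin 3 → ℕ} (hη : η ∈ P.exponents) :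
    Q.theta j (Q.c.mono (Matrix.vecMul η Q.A - γ))
      = ((η j - ∑ k, γ k * Q.B k j : ℤ) : G.Stalk Y b)
        * Q.c.mono (Matrix.vecMul η Q.A - γ) := by
  rw [Q.theta_mono]
  congr 2
  rw [← Q.sum_vecMul_mul η j, ← Finset.sum_sub_distrib]
  refine Finset.sum_congr rfl fun k _ => ?_
  rw [Pi.sub_apply, Nat.cast_sub (P.le_vecMul Q hγ hI hG hη k), sub_mul]

/-- The ideal is generated by a monomial in labels of `E'`, and fields tangent to `E'` preserve such
an ideal. -/
theorem deriv_mem_of_mem (hG : G.IsRegular) {X : Derivation ℤ (G.Stalk Y b) (G.Stalk Y b)}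
    (hX : X ∈ logDer E' b) {f : G.Stalk Y b} (hf : f ∈ P.declaredIdeal.map (pullAt τ h)) :
    X f ∈ P.declaredIdeal.map (pullAt τ h) := by
  rw [hI] at hf ⊢
  refine derivation_mem_span (fun g hg => ?_) hf
  rw [Set.mem_singleton_iff.1 hg, Ideal.mem_span_singleton]
  exact Q.mono_dvd_deriv hX fun k hk => P.exponent_eq_zero Q hγ hI hG fun hE =>
    hk ((Q.mem_S_E k).1 hE).1

/-- At a 2-point or a generic 1-point `T i` itself belongs to the declared ideal, which tangent
fields preserve upstairs. At a non-generic 1-point `a_{i0}` is divisible only by `u^β`, whereas the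
generator is `u^β w`. There `X(u^α) = 0` forces `X(u) = 0`, so `X(a_{i0})` is a multiple of `u^β
X(w) = X(u^β w)`, which is in the ideal again. -/
theorem exists_deriv_mul_T (hG : G.IsRegular) {X : Derivation ℤ (G.Stalk Y b) (G.Stalk Y b)}
    (hX : X ∈ logDer E' b) (hXα : X (pullAt τ h (P.c.mono P.α)) = 0) (i : Fin (r + 1)) :
    ∃ l ∈ P.declaredIdeal.map (pullAt τ h),
      X (pullAt τ h (P.c.mono P.δ) * pullAt τ h (P.T i)) = pullAt τ h (P.c.mono P.δ) * l := by
  have hpull := P.isPull_chart Q hG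
  by_cases hn : P.NonGeneric
  · have hS : P.kind.S = {0} := by rw [hn.1, PointKind.S]
    have hmono : ∀ η : Fin 3 → ℕ, (∀ j ∉ P.kind.S, η j = 0) → P.c.mono η = P.c.x 0 ^ η 0 := by
      intro η hη
      rw [← Coord.mono_single]
      congr 1
      ext k
      rcases eq_or_ne k 0 with rfl | hk
      · simp
      · rw [hη k (by simp [hS, hk])]; simp [hk]
    -- With `X(u) = u e`, the relation `X(u^α) = 0` reads `α u^α e = 0`; the integer `α` is a unit
    -- and `u^α` pulls back to a nonzerodivisor.
    have hx0 : X (pullAt τ h (P.c.x 0)) = 0 := by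
      obtain ⟨j₀, hj₀, hα⟩ := P.exists_alpha_ne_zero hG
      obtain rfl : j₀ = 0 := by simpa [hS] using hj₀
      obtain ⟨e, he⟩ := hpull.dvd X hX (Pi.single 0 1) (by
        intro j hj; rw [hS] at hj; simp at hj; simp [hj])
      rw [Coord.mono_single, pow_one] at he
      obtain ⟨m, hm⟩ : ∃ m, P.α 0 = m + 1 := ⟨P.α 0 - 1, by omega⟩
      rw [hmono P.α P.α_support, map_pow, Derivation.leibniz_pow, he, hm] at hXα
      have h1 : ((m + 1 : ℕ) : G.Stalk Y b) * e = 0 := by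
        refine Coord.mono_mul_cancel hG Q.c (Matrix.vecMul (Pi.single 0 (m + 1)) Q.A) ?_
        rw [← Q.pull_mono, Coord.mono_single, map_pow, mul_zero, ← hXα]
        simp only [Nat.add_sub_cancel, smul_eq_mul, nsmul_eq_mul]
        ring
      rw [he, ((hG.isUnit_natCast Y b (m + 1) (by omega)).mul_right_eq_zero).1 h1, mul_zero]
    have hXmono : ∀ η : Fin 3 → ℕ, (∀ j ∉ P.kind.S, η j = 0) →
        X (pullAt τ h (P.c.mono η)) = 0 := by
      intro η hη
      rw [hmono η hη, map_pow, Derivation.leibniz_pow, hx0]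
      simp
    have hT : P.T i - P.coeff i 0 ∈ P.declaredIdeal :=
      P.T_sub_mem i (fun _ => by rw [sub_self]; exact zero_mem _)
        fun h0 => absurd (P.d_pos_of_nonGeneric hn) (by omega)
    refine ⟨X (pullAt τ h (P.T i)), ?_, ?_⟩
    · rw [show P.T i = (P.T i - P.coeff i 0) + P.coeff i 0 by ring, map_add, map_add]
      refine add_mem (P.deriv_mem_of_mem Q hγ hI hG hX (Ideal.mem_map_of_mem _ hT)) ?_
      obtain ⟨f, hf⟩ := P.β_dvd i
      have h1 : P.c.pd 1 (P.coeff i 0) = P.c.mono P.β * P.c.pd 1 f := by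
        rw [hf, Derivation.leibniz, P.c.pd_mono_eq_zero (P.β_support 1 (by simp [hS]))]
        simp
      rw [hpull.chain X hX, Fin.sum_univ_three, hx0, h1,
        P.coeff_indep_v i 0 (P.d_pos_of_nonGeneric hn)]
      have h2 : pullAt τ h (P.c.mono P.β) * X (pullAt τ h (P.c.x 1)) =
          X (pullAt τ h (P.c.mono P.lastExponent)) := by
        rw [lastExponent, if_pos hn, Coord.mono_add, Coord.mono_single, pow_one, map_mul,
          Derivation.leibniz, hXmono P.β P.β_support]
        simp
      have h3 : X (pullAt τ h (P.c.mono P.lastExponent)) ∈ P.declaredIdeal.map (pullAt τ h) :=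
        P.deriv_mem_of_mem Q hγ hI hG hX (Ideal.mem_map_of_mem _
          (P.mono_mem_declaredIdeal P.lastExponent_mem_exponents))
      rw [map_mul, mul_zero, map_zero, zero_mul, zero_add, add_zero, mul_right_comm, h2]
      exact Ideal.mul_mem_right _ _ h3
    · rw [Derivation.leibniz, hXmono P.δ P.δ_support]
      simp
  · have hT : P.T i ∈ P.declaredIdeal := by
      rw [← sub_zero (P.T i)]
      refine P.T_sub_mem i (fun _ => ?_) fun _ => rfl
      rw [sub_zero]
      obtain ⟨f, hf⟩ := P.β_dvd i
      rw [hf]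
      have := P.mono_mem_declaredIdeal P.lastExponent_mem_exponents
      rw [lastExponent, if_neg hn, add_zero] at this
      exact Ideal.mul_mem_right _ _ this
    have hT' := Ideal.mem_map_of_mem (pullAt τ h) hT
    obtain ⟨q, hq⟩ := hpull.dvd X hX P.δ P.δ_support
    refine ⟨q * pullAt τ h (P.T i) + X (pullAt τ h (P.T i)),
      add_mem (Ideal.mul_mem_left _ _ hT') (P.deriv_mem_of_mem Q hγ hI hG hX hT'), ?_⟩
    rw [X.leibniz, hq]
    simp only [smul_eq_mul]
    ring

end Chart

end PreparedForm

end

/-! ### A minor of small order over the prepared point -/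

section

variable {G : Geometry.{u}}

namespace PreparedForm

variable {r : ℕ} {U : G.Obj 3} {M : G.Obj (r + 2)} {E D : Set (IdealFamily U)} {σ : G.Hom U M}
  {a : G.Pt U} (P : PreparedForm E σ a) {Y : G.Obj 3} {τ : G.Hom Y U} {b : G.Pt Y}
  {h : G.map τ b = a} {E' D' : Set (IdealFamily Y)}
  (Q : MonomialChart τ h P.c P.declaredIndex P.kind.S E' D') {γ : Fin 3 → ℕ}

open Classical in
/-- The term of degree `j` in `v` of the quotient of `T i` by the monomial `x ^ γ`. -/
def term (γ : Fin 3 → ℕ) (i : Fin (r + 1)) (j : ℕ) : G.Stalk Y b :=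
  if j = P.d then
    pullAt τ h (P.Ttilde i) * Q.c.mono (Matrix.vecMul (Pi.single 2 P.d) Q.A - γ)
  else if (i, j) ∈ P.J then
    pullAt τ h (P.atilde i j) * Q.c.mono (Matrix.vecMul (P.expo i j + Pi.single 2 j) Q.A - γ)
  else 0

omit Q in
theorem coeff_zero_of_two (hk : P.kind = .two) : P.coeff P.i₀ 0 = P.c.mono P.β := by
  rw [P.coeff_zero]
  split
  · rw [mul_one]
  · simp_all

omit Q in
theorem coeff_zero_of_one (hk : P.kind = .one) :
    P.coeff P.i₀ 0 = P.c.mono P.β * P.c.x 1 := by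
  rw [P.coeff_zero]
  split
  · simp_all
  · rfl

variable (hγ : ∀ k ∉ Q.S, γ k = 0)
  (hI : P.declaredIdeal.map (pullAt τ h) = Ideal.span {Q.c.mono γ})

include hγ hI

theorem pull_coeff_mul (hG : G.IsRegular) (i : Fin (r + 1)) {j : ℕ} (hj : 1 ≤ j) (hd : j < P.d) :
    pullAt τ h (P.coeff i j) * pullAt τ h (P.c.mono (Pi.single 2 j))
      = Q.c.mono γ * P.term Q γ i j := by
  rw [term, if_neg hd.ne]
  split_ifs with hJ
  · rw [P.coeff_eq i j hj hd, map_mul, mul_right_comm, ← map_mul, ← Coord.mono_add,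
      P.pull_exponent Q hγ hI hG (P.expo_mem_exponents hJ)]
    ring
  · rw [P.coeff_eq_zero hj hd hJ]; simp

/-- The coefficients are independent of `v`, so the lift of `v ∂/∂v` multiplies the term of degree
`j` by `j`. Only `T̃` depends on `v`, and its derivative carries a factor `v`. -/
theorem theta_pull_T (hG : G.IsRegular) (i : Fin (r + 1)) :
    Q.theta 2 (pullAt τ h (P.T i)) = Q.c.mono γ *
      (∑ j ∈ Finset.range (P.d + 1), (j : G.Stalk Y b) * P.term Q γ i j
        + pullAt τ h (P.c.x 2 * P.c.pd 2 (P.Ttilde i))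
          * Q.c.mono (Matrix.vecMul (Pi.single 2 P.d) Q.A - γ)) := by
  have h1 : P.T i = P.Ttilde i * P.c.mono (Pi.single 2 P.d)
      + ∑ j ∈ Finset.range P.d, P.coeff i j * P.c.mono (Pi.single 2 j) := by
    simp only [Coord.mono_single]; exact P.weierstrass i
  have hpull := P.pull_exponent Q hγ hI hG P.single_mem_exponents
  have h2 : Q.theta 2 (pullAt τ h (P.Ttilde i * P.c.mono (Pi.single 2 P.d)))
      = Q.c.mono γ * ((P.d : G.Stalk Y b) * P.term Q γ i P.d
        + pullAt τ h (P.c.x 2 * P.c.pd 2 (P.Ttilde i))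
          * Q.c.mono (Matrix.vecMul (Pi.single 2 P.d) Q.A - γ)) := by
    rw [map_mul, Derivation.leibniz, Q.theta_pull_mono, Q.theta_pull hG, hpull, term, if_pos rfl]
    simp only [smul_eq_mul, Pi.single_eq_same]
    ring
  have h3 : ∀ j ∈ Finset.range P.d,
      Q.theta 2 (pullAt τ h (P.coeff i j * P.c.mono (Pi.single 2 j)))
        = Q.c.mono γ * ((j : G.Stalk Y b) * P.term Q γ i j) := by
    intro j hj
    have hjd := Finset.mem_range.1 hj
    rw [map_mul, Derivation.leibniz, Q.theta_pull_mono, Q.theta_pull hG, P.coeff_indep_v i j hjd]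
    simp only [smul_eq_mul, Pi.single_eq_same, mul_zero, map_zero, add_zero]
    rcases Nat.eq_zero_or_pos j with rfl | hj0
    · simp
    · rw [mul_left_comm, P.pull_coeff_mul Q hγ hI hG i hj0 hjd]
      ring
  rw [h1, map_add, map_add, h2, map_sum, map_sum, Finset.sum_congr rfl h3,
    Finset.sum_range_succ, ← Finset.mul_sum]
  ring

/-- The terms are eigenvectors up to the derivative of their coefficient. That derivative is a
multiple of the pull-back of `v`, which vanishes on the stratum of `D'`. -/
theorem theta_term (hG : G.IsRegular) (i : Fin (r + 1)) (j : ℕ) :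
    Q.theta 2 (P.term Q γ i j)
      - ((j - ∑ k, γ k * Q.B k 2 : ℤ) : G.Stalk Y b) * P.term Q γ i j
      ∈ Ideal.span (Q.c.x '' Q.S) := by
  have key : ∀ (η : Fin 3 → ℕ) (f : G.Stalk U a), η ∈ P.exponents → η 2 = j →
      Q.theta 2 (pullAt τ h f * Q.c.mono (Matrix.vecMul η Q.A - γ))
      - ((j - ∑ k, γ k * Q.B k 2 : ℤ) : G.Stalk Y b)
        * (pullAt τ h f * Q.c.mono (Matrix.vecMul η Q.A - γ)) ∈ Ideal.span (Q.c.x '' Q.S) := by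
    intro η f hη hj
    rw [Derivation.leibniz, Q.theta_pull hG, P.theta_quotient Q hγ hI hG 2 hη, hj, map_mul]
    have hx := Q.pull_x_mem_span hG P.two_mem_declaredIndex (P.not_isUnit_x 2)
    simp only [smul_eq_mul]
    rw [show ∀ A B C D : G.Stalk Y b, pullAt τ h f * (A * B) + B * (C * D)
      - A * (pullAt τ h f * B) = C * (B * D) by intros; ring]
    exact Ideal.mul_mem_right _ _ hx
  unfold term
  split_ifs with hjd hJ
  · exact key _ _ P.single_mem_exponents (by simp [hjd])
  · exact key _ _ (P.expo_mem_exponents hJ) (by simp [P.expo_v])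
  · simp

/-- If the quotient of `T i` by the monomial has at most `m` terms, then the order of its
derivative is less than `m`. -/
theorem notMem_of_terms (hG : G.IsRegular) (i : Fin (r + 1)) {F : Finset ℕ}
    (hF : F ⊆ Finset.range (P.d + 1))
    (hout : ∀ j ∈ Finset.range (P.d + 1), j ∉ F →
      (j : G.Stalk Y b) * P.term Q γ i j ∈ Ideal.span (Q.c.x '' Q.S))
    {j : ℕ} (hj : j ∈ F) (hj1 : 1 ≤ j) (hu : IsUnit (P.term Q γ i j)) {m : ℕ} (hm : F.card ≤ m) :
    ∑ j ∈ Finset.range (P.d + 1), (j : G.Stalk Y b) * P.term Q γ i j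
        + pullAt τ h (P.c.x 2 * P.c.pd 2 (P.Ttilde i))
          * Q.c.mono (Matrix.vecMul (Pi.single 2 P.d) Q.A - γ)
      ∉ IsLocalRing.maximalIdeal (G.Stalk Y b) ^ m ⊔ Ideal.span (Q.c.x '' Q.S) := by
  intro hmem
  have hx := Q.pull_x_mem_span hG P.two_mem_declaredIndex (P.not_isUnit_x 2)
  have h1 := sum_eigen_notMem (hG.isUnit_intCast Y b) (Q.theta 2)
    (fun f hf => Q.theta_mem_span 2 hf) Q.span_le_maximalIdeal
    (fun j : ℕ => (j - ∑ k, γ k * Q.B k 2 : ℤ)) F (fun j _ j' _ hjj' => by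
      simpa using hjj') (fun j => (j : G.Stalk Y b) * P.term Q γ i j) (fun j _ => ?_) hj
    ((hG.isUnit_natCast Y b j (by omega)).mul hu) hm
  · refine h1 ?_
    rw [← Finset.sum_sdiff hF, add_assoc, add_comm, add_assoc] at hmem
    refine (Submodule.add_mem_iff_left _ (Ideal.mem_sup_right ?_)).1 hmem
    refine add_mem ?_ (sum_mem fun j hj => ?_)
    · rw [map_mul]
      exact Ideal.mul_mem_right _ _ (Ideal.mul_mem_right _ _ hx)
    · exact hout j (Finset.mem_sdiff.1 hj).1 (Finset.mem_sdiff.1 hj).2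
  · have := Ideal.mul_mem_left _ (j : G.Stalk Y b) (P.theta_term Q hγ hI hG i j)
    convert this using 1
    rw [Derivation.leibniz, Derivation.map_natCast]
    simp only [smul_eq_mul]
    ring

theorem term_mem (hG : G.IsRegular) (i : Fin (r + 1)) {j : ℕ}
    (h1 : j = P.d → ¬ ∀ k ∈ Q.S, Matrix.vecMul (Pi.single 2 P.d) Q.A k = γ k)
    (h2 : (i, j) ∈ P.J →
      ¬ ∀ k ∈ Q.S, Matrix.vecMul (P.expo i j + Pi.single 2 j) Q.A k = γ k) :
    P.term Q γ i j ∈ Ideal.span (Q.c.x '' Q.S) := by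
  unfold term
  split_ifs with hjd hJ
  · exact Ideal.mul_mem_left _ _ (P.quotient_mem Q hγ hI hG P.single_mem_exponents (h1 hjd))
  · exact Ideal.mul_mem_left _ _ (P.quotient_mem Q hγ hI hG (P.expo_mem_exponents hJ) (h2 hJ))
  · exact zero_mem _

/-- The derivation that is used when `ℐ` is generated by its last generator. -/
theorem exists_deriv_last (hG : G.IsRegular)
    (ht : ∀ k ∈ Q.S, Matrix.vecMul P.lastExponent Q.A k = γ k) :
    ∃ X ∈ logDer E' b, (∀ f ∈ Ideal.span (Q.c.x '' Q.S), X f ∈ Ideal.span (Q.c.x '' Q.S)) ∧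
      X (pullAt τ h (P.c.mono P.α)) = 0 ∧ ∃ e, IsUnit e ∧
        X (pullAt τ h (P.c.mono P.δ) * pullAt τ h (P.coeff P.i₀ 0))
          = pullAt τ h (P.c.mono P.δ) * (Q.c.mono γ * e) := by
  have hu := P.isUnit_quotient Q P.lastExponent_mem_exponents ht
  have hpull := P.pull_exponent Q hγ hI hG P.lastExponent_mem_exponents
  rcases (by cases P.kind <;> simp : P.kind = .two ∨ P.kind = .one) with hk | hk
  · have hn : ¬ P.NonGeneric := fun hn => by rw [hn.1] at hk; cases hk
    rw [lastExponent, if_neg hn, add_zero] at hpull hu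
    -- At a 2-point the field is `α₁ θ₂ - α₂ θ₁` in the two divisor directions. It kills `u^α`, and
    -- its eigenvalue on `u^(δ+β)` is this determinant.
    have hdet := (P.β_indep hk).det_ne_zero (P.α_support 2 P.kind.two_notMem)
      (by rw [Pi.add_apply, P.δ_support 2 P.kind.two_notMem, P.β_support 2 P.kind.two_notMem])
    have hX : ∀ η : Fin 3 → ℕ,
        ((P.α 0 : G.Stalk Y b) • Q.theta 1 - (P.α 1 : G.Stalk Y b) • Q.theta 0)
          (pullAt τ h (P.c.mono η))
        = ((P.α 0 * η 1 - P.α 1 * η 0 : ℤ) : G.Stalk Y b) * pullAt τ h (P.c.mono η) := by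
      intro η
      rw [Derivation.sub_apply, Derivation.smul_apply, Derivation.smul_apply, Q.theta_pull_mono,
        Q.theta_pull_mono]
      push_cast
      simp only [smul_eq_mul]
      ring
    have hc := P.coeff_zero_of_two hk
    refine ⟨_, sub_mem (Submodule.smul_mem _ (P.α 0 : G.Stalk Y b) (Q.theta_mem_logDer 1))
      (Submodule.smul_mem _ (P.α 1 : G.Stalk Y b) (Q.theta_mem_logDer 0)),
      fun f hf => sub_mem (Ideal.mul_mem_left _ _ (Q.theta_mem_span 1 hf))
        (Ideal.mul_mem_left _ _ (Q.theta_mem_span 0 hf)), ?_, _,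
      (hG.isUnit_intCast Y b _ hdet).mul hu, ?_⟩
    · rw [hX, show ((P.α 0 : ℤ) * P.α 1 - P.α 1 * P.α 0) = 0 by ring]; simp
    · rw [← map_mul, hc, ← Coord.mono_add, hX, Coord.mono_add, map_mul, hpull]
      push_cast
      ring
  · have h1S : (1 : Fin 3) ∉ P.kind.S := by simp [hk, PointKind.S]
    have hc := P.coeff_zero_of_one hk
    by_cases hn : P.NonGeneric
    -- At a non-generic 1-point `w` is a component of `D`: the lift of `w ∂/∂w` kills `u` and fixes
    -- `u^β w`.
    · refine ⟨_, Q.theta_mem_logDer 1, fun f hf => Q.theta_mem_span 1 hf, ?_, _, hu, ?_⟩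
      · rw [Q.theta_pull_mono, P.α_support 1 h1S]; simp
      · have hc' : P.coeff P.i₀ 0 = P.c.mono P.lastExponent := by
          rw [hc, lastExponent, if_pos hn, Coord.mono_add, Coord.mono_single, pow_one]
        have h1 : P.lastExponent 1 = 1 := by simp [lastExponent, hn, P.β_support 1 h1S]
        rw [Derivation.leibniz, hc', Q.theta_pull_mono, Q.theta_pull_mono, h1,
          P.δ_support 1 h1S, hpull]
        simp
    -- At a generic 1-point `w` is not a component of `D`, so no blowing-up changes it: it remains a
    -- coordinate at `b`, and the ordinary derivative `∂/∂w` kills `u` and sends `u^β w` to the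
    -- generator `u^β`.
    · have hs : (1 : Fin 3) ∉ P.declaredIndex := by
        rw [declaredIndex, if_neg hn, hk]; decide
      have hN : (1 : Fin 3) ∉ Q.N := fun h => hs (Q.subset_s h)
      have hS : (1 : Fin 3) ∉ Q.S := fun h => hs ((Q.mem_S 1).1 h).1
      have hX : ∀ η : Fin 3 → ℕ, η 1 = 0 → Q.c.pd 1 (pullAt τ h (P.c.mono η)) = 0 := by
        intro η hη
        rw [Q.pull_mono]
        exact Q.c.pd_mono_eq_zero (by rw [Q.vecMul_eq_of_notMem η hN, hη])
      have hx1 : pullAt τ h (P.c.x 1) = Q.c.x 1 := by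
        rw [Q.pull_x]
        have : Q.A 1 = Pi.single 1 1 := by
          ext k; rw [Q.row 1 hs]; simp [Matrix.one_apply, Pi.single_apply, eq_comm]
        rw [this, Coord.mono_single, pow_one]
      rw [lastExponent, if_neg hn, add_zero] at hpull hu
      refine ⟨_, Q.adapted_E.pd_mem_logDer fun h => hS (Q.S_E_subset h),
        fun f hf => Coord.pd_mem_span hS hf, hX _ (P.α_support 1 h1S), _, hu, ?_⟩
      rw [hc, ← map_mul, ← mul_assoc, ← Coord.mono_add, map_mul, Derivation.leibniz,
        hX _ (by rw [Pi.add_apply, P.δ_support 1 h1S, P.β_support 1 h1S]), hx1, Q.c.pd_x,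
        if_pos rfl, Coord.mono_add, map_mul, hpull]
      simp

/-- The argument follows which generator of the declared ideal gives `x^γ` up to a unit: `v^d`, a
middle generator, or the last one. The case `d = 0` is separate, since `v^0 = 1` makes the ideal
trivial and a unit arises from the independence of `δ` and `α`. -/
theorem exists_low_order (hG : G.IsRegular) : ∃ (m : ℕ) (i : Fin (r + 1)),
    ∃ X ∈ logDer E' b, ∃ f : G.Stalk Y b, X (pullAt τ h (P.c.mono P.α)) = 0 ∧
      X (pullAt τ h (P.c.mono P.δ) * pullAt τ h (P.T i))
        = pullAt τ h (P.c.mono P.δ) * (Q.c.mono γ * f) ∧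
      f ∉ IsLocalRing.maximalIdeal (G.Stalk Y b) ^ m ⊔ Ideal.span (Q.c.x '' Q.S) ∧
      (m : ℕ∞) ≤ P.rhoValue := by
  have h2S := P.kind.two_notMem
  have hρ1 : ((1 : ℕ) : ℕ∞) ≤ P.rhoValue := by
    rw [Nat.cast_one]; exact Order.one_le_iff_pos.2 P.rho_pos
  have hunit : ∀ f : G.Stalk Y b, IsUnit f →
      f ∉ IsLocalRing.maximalIdeal (G.Stalk Y b) ^ 1 ⊔ Ideal.span (Q.c.x '' Q.S) := by
    intro f hf hmem
    rw [pow_one, sup_eq_left.2 Q.span_le_maximalIdeal] at hmem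
    exact (IsLocalRing.mem_maximalIdeal _).1 hmem hf
  have hlocal : ∀ f ∈ IsLocalRing.maximalIdeal (G.Stalk U a),
      pullAt τ h f ∈ IsLocalRing.maximalIdeal (G.Stalk Y b) := by
    have hloc : IsLocalHom (pullAt τ h) := by subst h; exact hG.isLocalHom_pull τ b
    intro f hf
    rw [IsLocalRing.mem_maximalIdeal] at hf ⊢
    exact fun hu => hf (isUnit_of_map_unit (pullAt τ h) _ hu)
  rcases Nat.eq_zero_or_pos P.d with hd | hd
  · have hγ0 : γ = 0 := by
      have := P.le_vecMul Q hγ hI hG P.single_mem_exponents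
      rw [hd, Pi.single_zero, Matrix.zero_vecMul] at this
      exact le_antisymm this fun k => Nat.zero_le _
    have hT := P.isUnit_T_of_d_eq_zero hd
    have hdet := (P.δ_indep ⟨0, hT⟩).det_ne_zero (P.α_support 2 h2S) (P.δ_support 2 h2S)
    let X : Derivation ℤ (G.Stalk Y b) (G.Stalk Y b) :=
      (P.α 0 : G.Stalk Y b) • Q.theta 1 - (P.α 1 : G.Stalk Y b) • Q.theta 0
    have hXm : ∀ η : Fin 3 → ℕ, X (pullAt τ h (P.c.mono η))
        = ((P.α 0 * η 1 - P.α 1 * η 0 : ℤ) : G.Stalk Y b) * pullAt τ h (P.c.mono η) := by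
      intro η
      rw [Derivation.sub_apply, Derivation.smul_apply, Derivation.smul_apply, Q.theta_pull_mono,
        Q.theta_pull_mono]
      push_cast
      simp only [smul_eq_mul]
      ring
    refine ⟨1, 0, X, sub_mem (Submodule.smul_mem _ _ (Q.theta_mem_logDer 1))
      (Submodule.smul_mem _ _ (Q.theta_mem_logDer 0)),
      X (pullAt τ h (P.T 0)) + ((P.α 0 * P.δ 1 - P.α 1 * P.δ 0 : ℤ) : G.Stalk Y b)
        * pullAt τ h (P.T 0), ?_, ?_, hunit _ ?_, hρ1⟩
    · rw [hXm, show ((P.α 0 : ℤ) * P.α 1 - P.α 1 * P.α 0) = 0 by ring]; simp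
    · rw [X.leibniz, hXm, hγ0, Coord.mono_zero]
      simp only [smul_eq_mul]
      ring
    · refine isUnit_of_sub_mem ((hG.isUnit_intCast Y b _ hdet).mul (hT.map (pullAt τ h))) ?_
      rw [add_sub_cancel_right, Derivation.sub_apply, Derivation.smul_apply,
        Derivation.smul_apply, Q.theta_pull hG, Q.theta_pull hG]
      exact sub_mem
        (Ideal.mul_mem_left _ _ (hlocal _ (Ideal.mul_mem_right _ _ (P.x_mem 1))))
        (Ideal.mul_mem_left _ _ (hlocal _ (Ideal.mul_mem_right _ _ (P.x_mem 0))))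
  have hρ := P.le_rhoValue hG hd
  have htheta : ∀ i, Q.theta 2 (pullAt τ h (P.c.mono P.δ) * pullAt τ h (P.T i))
      = pullAt τ h (P.c.mono P.δ) * (Q.c.mono γ *
        (∑ j ∈ Finset.range (P.d + 1), (j : G.Stalk Y b) * P.term Q γ i j
        + pullAt τ h (P.c.x 2 * P.c.pd 2 (P.Ttilde i))
          * Q.c.mono (Matrix.vecMul (Pi.single 2 P.d) Q.A - γ))) := by
    intro i
    rw [Derivation.leibniz, P.theta_pull_T Q hγ hI hG, Q.theta_pull_mono, P.δ_support 2 h2S]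
    simp
  have hthetaα : Q.theta 2 (pullAt τ h (P.c.mono P.α)) = 0 := by
    rw [Q.theta_pull_mono, P.α_support 2 h2S]; simp
  by_cases h1 : ∀ k ∈ Q.S, Matrix.vecMul (Pi.single 2 P.d) Q.A k = γ k
  -- The factor `j` removes degree `0`, and the vanishing of `a_{2,d-1}` removes degree `d - 1`. So
  -- `d - 1` terms remain if `d ≥ 2` and one if `d = 1`, where the two removals coincide.
  · refine ⟨max (P.d - 1) 1, 0, _, Q.theta_mem_logDer 2, _, hthetaα, htheta 0, ?_, ?_⟩
    · refine P.notMem_of_terms Q hγ hI hG 0 (F := (Finset.Icc 1 P.d).erase (P.d - 1))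
        (fun j hj => ?_) (fun j hj hjF => ?_) (j := P.d) ?_ hd ?_ ?_
      · have := Finset.mem_Icc.1 (Finset.mem_of_mem_erase hj)
        exact Finset.mem_range.2 (by omega)
      · rcases Nat.eq_zero_or_pos j with rfl | hj0
        · simp
        · have hjd : j + 1 = P.d := by
            have hj' := Finset.mem_range.1 hj
            by_contra hne
            exact hjF (Finset.mem_erase.2 ⟨by omega, Finset.mem_Icc.2 ⟨hj0, by omega⟩⟩)
          have hJ : (0, j) ∉ P.J := fun hJ => hJ.2.2 (P.coeff_pred j hjd)
          rw [term, if_neg (by omega), if_neg hJ, mul_zero]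
          exact zero_mem _
      · exact Finset.mem_erase.2 ⟨by omega, Finset.mem_Icc.2 ⟨hd, le_rfl⟩⟩
      · rw [term, if_pos rfl]
        exact (P.isUnit_Ttilde.map _).mul (P.isUnit_quotient Q P.single_mem_exponents h1)
      · rcases Nat.lt_or_ge 1 P.d with hd1 | hd1
        · rw [Finset.card_erase_of_mem (Finset.mem_Icc.2 ⟨by omega, by omega⟩), Nat.card_Icc]
          exact le_max_of_le_left (by omega)
        · refine (Finset.card_le_card (Finset.erase_subset _ _)).trans ?_
          rw [Nat.card_Icc]
          exact le_max_of_le_right (by omega)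
    · rcases le_total (P.d - 1) 1 with hle | hle
      · rwa [max_eq_right hle]
      · rwa [max_eq_left hle]
  by_cases h2 : ∃ ij ∈ P.J, ∀ k ∈ Q.S,
      Matrix.vecMul (P.expo ij.1 ij.2 + Pi.single 2 ij.2) Q.A k = γ k
  · obtain ⟨⟨i, j⟩, hJ, ht⟩ := h2
    have hj1 : 1 ≤ j := hJ.1
    have hjd : j < P.d := hJ.2.1
    -- The component `i` is the one whose coefficient provides the generator. The term of degree `d`
    -- vanishes on the stratum because `v^d` is not a generator, so the degrees `1, …, d - 1`
    -- remain.
    refine ⟨P.d - 1, i, _, Q.theta_mem_logDer 2, _, hthetaα, htheta i, ?_, hρ⟩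
    refine P.notMem_of_terms Q hγ hI hG i (F := Finset.Icc 1 (P.d - 1))
      (fun k hk => ?_) (fun k hk hkF => ?_) (j := j) ?_ hj1 ?_ ?_
    · have := Finset.mem_Icc.1 hk
      exact Finset.mem_range.2 (by omega)
    · rcases Nat.eq_zero_or_pos k with rfl | hk0
      · simp
      · have hkd : k = P.d := by
          have hk' := Finset.mem_range.1 hk
          by_contra hne
          exact hkF (Finset.mem_Icc.2 ⟨hk0, by omega⟩)
        refine Ideal.mul_mem_left _ _ (P.term_mem Q hγ hI hG i (fun _ => h1) fun hJ' => ?_)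
        exact absurd hJ'.2.1 (by simp [hkd])
    · exact Finset.mem_Icc.2 ⟨hj1, by omega⟩
    · rw [term, if_neg hjd.ne, if_pos hJ]
      exact ((P.isUnit_atilde hJ).map _).mul (P.isUnit_quotient Q (P.expo_mem_exponents hJ) ht)
    · rw [Nat.card_Icc]; omega
  · have ht : ∀ k ∈ Q.S, Matrix.vecMul P.lastExponent Q.A k = γ k := by
      obtain ⟨η, hη, ht⟩ := P.exists_tight Q hγ hI hG
      rcases hη with (rfl | ⟨ij, hij, rfl⟩) | rfl
      · exact absurd ht h1
      · exact absurd ⟨ij, hij, ht⟩ h2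
      · exact ht
    obtain ⟨X, hX, hXS, hXα, e, he, hXe⟩ := P.exists_deriv_last Q hγ hI hG ht
    obtain ⟨q, hq⟩ := (P.isPull_chart Q hG).dvd X hX P.δ P.δ_support
    obtain ⟨q', hq'⟩ := Q.mono_dvd_deriv hX (κ := γ) fun k hk =>
      P.exponent_eq_zero Q hγ hI hG fun hE => hk ((Q.mem_S_E k).1 hE).1
    obtain ⟨m, hm⟩ : ∃ m, P.d = m + 1 := ⟨P.d - 1, by omega⟩
    -- No other generator generates the ideal, so all terms of positive degree in `v` contribute
    -- `x^γ` times an element that vanishes on the stratum; only `a_{i₀,0}` can give a unit.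
    obtain ⟨t, ht, hT⟩ : ∃ t ∈ Ideal.span (Q.c.x '' Q.S), pullAt τ h (P.T P.i₀)
        = Q.c.mono γ * t + pullAt τ h (P.coeff P.i₀ 0) := by
      refine ⟨P.term Q γ P.i₀ P.d + ∑ j ∈ Finset.range m, P.term Q γ P.i₀ (j + 1), ?_, ?_⟩
      · exact add_mem (P.term_mem Q hγ hI hG _ (fun _ => h1) fun hJ ht => h2 ⟨_, hJ, ht⟩)
          (sum_mem fun j hj => P.term_mem Q hγ hI hG _ (fun _ => h1) fun hJ ht => h2 ⟨_, hJ, ht⟩)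
      · have h3 : ∀ j ∈ Finset.range m, pullAt τ h (P.coeff P.i₀ (j + 1))
            * pullAt τ h (P.c.x 2) ^ (j + 1) = Q.c.mono γ * P.term Q γ P.i₀ (j + 1) := by
          intro j hj
          have := Finset.mem_range.1 hj
          rw [← P.pull_coeff_mul Q hγ hI hG P.i₀ (by omega) (by omega), Coord.mono_single, map_pow]
        have h4 : pullAt τ h (P.Ttilde P.i₀) * pullAt τ h (P.c.x 2) ^ P.d
            = Q.c.mono γ * P.term Q γ P.i₀ P.d := by
          rw [← map_pow, ← Coord.mono_single, P.pull_exponent Q hγ hI hG P.single_mem_exponents,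
            term, if_pos rfl]
          ring
        rw [P.weierstrass, map_add, map_mul, map_pow, h4, map_sum]
        simp only [map_mul, map_pow]
        rw [Finset.sum_congr (congrArg Finset.range hm) fun _ _ => rfl, Finset.sum_range_succ',
          Finset.sum_congr rfl h3, mul_add, Finset.mul_sum, pow_zero, mul_one]
        ring
    refine ⟨1, P.i₀, X, hX, (q + q') * t + X t + e, hXα, ?_, hunit _ ?_, hρ1⟩
    · rw [hT, mul_add, map_add, hXe, X.leibniz, X.leibniz, hq, hq']
      simp only [smul_eq_mul]
      ring
    · refine isUnit_of_sub_mem he (Q.span_le_maximalIdeal ?_)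
      rw [add_sub_cancel_right]
      exact add_mem (Ideal.mul_mem_left _ _ ht) (hXS t ht)

end PreparedForm

theorem range_pullAt {m n : ℕ} {X : G.Obj m} {Y : G.Obj n} (f : G.Hom X Y) {p : G.Pt X}
    {q : G.Pt Y} (h : G.map f p = q) : Set.range (pullAt f h) = Set.range (G.pull f p) := by
  subst h; rfl

/-- Two facts about the Fitting ideal at `b` are combined: it lies in `(w)` by `exists_deriv_mul_T`,
and it contains `w * f` by `exists_low_order`. Minors may be computed with the fixed coordinates of
`M` at `σ(a)`, since the minor ideal does not depend on coordinates. -/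
theorem main_of_isRegular (hG : G.IsRegular) {r : ℕ} {U : G.Obj 3} {M : G.Obj (r + 2)}
    {σ : G.Hom U M} {E D : Set (IdealFamily U)} {a : G.Pt U} (P : PreparedForm E σ a)
    (hD : P.IsDeclaredDivisor D) {U' : G.Obj 3} {τ : G.Hom U' U} {E' D' : Set (IdealFamily U')}
    (hτ : BlowupSequence E D τ E' D') (b : G.Pt U') (hba : G.map τ b = a)
    (hI : IsPrincipalMonomial D' b (P.declaredIdeal.map (pullAt τ hba))) :
    IsPrincipalMonomial E' b (P.declaredIdeal.map (pullAt τ hba)) ∧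
      ∀ (c : Coord U' b) (S : Finset (Fin 3)), Adapted E' b c S →
        ∀ z : Coord M (G.map (G.comp τ σ) b), rho (G.comp τ σ) b c S z < P.rhoValue := by
  obtain ⟨Q⟩ := hτ.nonempty_monomialChart hG P.subset_declaredIndex (P.adapted_declared hD)
    P.c_adapted b hba
  obtain ⟨c₁, S₁, hS₁, γ₁, hγ₁, hI₁⟩ := hI
  obtain ⟨γ, hγ, hγ'⟩ := hS₁.exists_mono Q.adapted_D γ₁ hγ₁
  have hI := hI₁.trans hγ'
  have hγE : ∀ k ∉ Q.S_E, γ k = 0 := fun k hk => P.exponent_eq_zero Q hγ hI hG hk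
  refine ⟨⟨Q.c, Q.S_E, Q.adapted_E, γ, hγE, hI⟩, fun c S hc z => ?_⟩
  obtain ⟨m, i, X, hX, f, hXα, hXf, hf, hm⟩ := P.exists_low_order Q hγ hI hG
  refine lt_of_lt_of_le ?_ hm
  have hστ : G.map (G.comp τ σ) b = G.map σ a := by rw [hG.map_comp, hba]
  have hpull := P.isPull_chart Q hG
  have hfit := logFitting_eq_minorIdeal hG (G.comp τ σ) z hc
  rw [← range_pullAt _ hστ] at hfit
  have hcomp : ∀ g, pullAt (G.comp τ σ) hστ g = pullAt τ hba (G.pull σ a g) := fun g =>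
    hG.pullAt_comp τ σ hστ hba rfl g
  -- The expected monomial factor of the Fitting ideal. Some chart coordinates in it may be units at
  -- `b`, so it is monomial in `E'` only up to a unit.
  let w := pullAt τ hba (P.c.mono P.α) * pullAt τ hba (P.c.mono P.δ) * Q.c.mono γ
  have hw : w = Q.c.mono (Matrix.vecMul (P.α + P.δ) Q.A + γ) := by
    rw [Coord.mono_add, ← Q.pull_mono, Coord.mono_add, map_mul]
  have hκ : ∀ k ∉ Q.S_E, (Matrix.vecMul (P.α + P.δ) Q.A + γ) k = 0 ∨ IsUnit (Q.c.x k) := by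
    intro k hk
    by_cases hN : k ∈ Q.N
    · right
      by_contra hu
      exact hk ((Q.mem_S_E k).2 ⟨hN, hu⟩)
    · left
      have hkS : k ∉ P.kind.S := fun h => hN (Q.sE_subset h)
      rw [Pi.add_apply, Q.vecMul_eq_of_notMem _ hN, hγE k hk, Pi.add_apply, P.α_support k hkS,
        P.δ_support k hkS]
  refine rhoAt_lt hG hc Q.adapted_E (w := w)
    (μ := fun k => if k ∈ Q.S_E then (Matrix.vecMul (P.α + P.δ) Q.A + γ) k else 0)
    (fun j hj => if_neg hj) (by rw [hw]; exact Q.c.span_mono_restrict hκ) ?_ (f := f) ?_ ?_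
  · rw [hfit]
    refine minorIdeal_le hG (G.comp τ σ) hστ P.z fun D₁ h₁ D₂ h₂ i j => ?_
    rw [hcomp, hcomp, ← Ideal.span_singleton_mul_span_singleton, ← hI]
    exact hpull.minor_mem hG (hG.isUnit_natCast U' b)
      (fun X hX hXα i => P.exists_deriv_mul_T Q hγ hI hG hX hXα i) h₁ h₂ i j
  · rw [hfit]
    obtain ⟨X₀, hX₀, e, -, he⟩ := hpull.exists_minor_eq hG (hG.isUnit_natCast U' b) hX hXα i
    have e1 : w * f = e * minor X₀ X (pullAt τ hba (G.pull σ a (P.z.x 0)))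
        (pullAt τ hba (G.pull σ a (P.z.x i.succ))) := by
      rw [he, hXf]; simp only [w]; ring
    rw [e1, ← hcomp, ← hcomp]
    exact Ideal.mul_mem_left _ _ (minor_mem_minorIdeal hX₀ hX ⟨_, rfl⟩ ⟨_, rfl⟩)
  -- The order bound was proved on the stratum of `D'`, which lies in the stratum of `E'`;
  -- restriction to the smaller stratum can only raise the order.
  · have hle := sup_le_sup (le_refl (IsLocalRing.maximalIdeal (G.Stalk U' b) ^ m))
      (Ideal.span_mono (Set.image_mono (f := Q.c.x) (Finset.coe_subset.2 Q.S_E_subset)))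
    exact fun hmem => hf (hle hmem)

end

section

/-! ### Hadamard's lemma for analytic functions of several variables -/

section Hadamard

open MeasureTheory

variable {𝕜 : Type*} [RCLike 𝕜] {E : Type*} [NormedAddCommGroup E] [NormedSpace 𝕜 E]

/-- The power series of `g` is composed with `A s` and integrated term by term. As `‖A s‖ ≤ 1`, the
norms do not grow, so the radius of convergence is preserved and the sums may be exchanged. -/
theorem analyticAt_integral_comp {g : E → 𝕜} (hg : AnalyticAt 𝕜 g 0)
    {A : ℝ → E →L[𝕜] E} (hA : Continuous A) (hA1 : ∀ s ∈ Set.Ioc (0 : ℝ) 1, ‖A s‖ ≤ 1) :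
    AnalyticAt 𝕜 (fun z => ∫ s in Set.Ioc (0 : ℝ) 1, g (A s z)) 0 := by
  obtain ⟨p, r, hp⟩ := hg
  have hcont : ∀ n, Continuous fun s => (p n).compContinuousLinearMap fun _ => A s := fun n =>
    (ContinuousMultilinearMap.compContinuousLinearMapContinuousMultilinear 𝕜
      (fun _ : Fin n => E) (fun _ : Fin n => E) 𝕜).cont.comp (continuous_pi fun _ => hA)
      |>.clm_apply continuous_const
  have hnorm : ∀ n, ∀ s ∈ Set.Ioc (0 : ℝ) 1,
      ‖(p n).compContinuousLinearMap fun _ => A s‖ ≤ ‖p n‖ := fun n s hs =>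
    ((p n).norm_compContinuousLinearMap_le _).trans (mul_le_of_le_one_right (norm_nonneg _)
      (Finset.prod_le_one (fun _ _ => norm_nonneg _) fun _ _ => hA1 s hs))
  have hint : ∀ n, IntegrableOn (fun s => (p n).compContinuousLinearMap fun _ => A s)
      (Set.Ioc 0 1) := fun n => (hcont n).integrableOn_Ioc
  refine ⟨fun n => ∫ s in Set.Ioc (0 : ℝ) 1, (p n).compContinuousLinearMap fun _ => A s, r,
    ⟨?_, hp.r_pos, ?_⟩⟩
  · refine ENNReal.le_of_forall_nnreal_lt fun r' hr' => ?_
    obtain ⟨C, -, hC⟩ := p.norm_mul_pow_le_of_lt_radius (hr'.trans_le hp.r_le)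
    refine FormalMultilinearSeries.le_radius_of_bound _ C fun n => ?_
    refine (mul_le_mul_of_nonneg_right ?_ (by positivity)).trans (hC n)
    refine (norm_setIntegral_le_of_norm_le_const (by simp) (hnorm n)).trans ?_
    simp
  · intro y hy
    have hy' : ‖y‖ₑ < r := by simpa using hy
    have hmem : ∀ s ∈ Set.Ioc (0 : ℝ) 1, A s y ∈ Metric.eball (0 : E) r := fun s hs => by
      have h1 : ‖A s y‖ₑ ≤ ‖y‖ₑ := by
        rw [enorm_le_iff_norm_le]
        exact ((A s).le_opNorm y).trans (mul_le_of_le_one_left (norm_nonneg _) (hA1 s hs))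
      simpa using h1.trans_lt hy'
    have hsumm : Summable fun n => ‖p n‖ * ‖y‖ ^ n := by
      have : ((‖y‖₊ : NNReal) : ENNReal) < p.radius := lt_of_lt_of_le hy' hp.r_le
      simpa using p.summable_norm_mul_pow this
    have hle : ∀ n, ∀ s ∈ Set.Ioc (0 : ℝ) 1, ‖p n fun _ => A s y‖ ≤ ‖p n‖ * ‖y‖ ^ n := by
      intro n s hs
      refine (((p n).compContinuousLinearMap fun _ => A s).le_opNorm fun _ => y).trans ?_
      rw [Finset.prod_const, Finset.card_univ, Fintype.card_fin]
      exact mul_le_mul_of_nonneg_right (hnorm n s hs) (by positivity)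
    have hcont' : ∀ n, Continuous fun s => p n fun _ => A s y := fun n =>
      (p n).cont.comp (continuous_pi fun _ => hA.clm_apply continuous_const)
    have hbound : ∀ n, ∫ s in Set.Ioc (0 : ℝ) 1, ‖p n fun _ => A s y‖ ≤ ‖p n‖ * ‖y‖ ^ n := by
      intro n
      have h1 : ‖∫ s in Set.Ioc (0 : ℝ) 1, ‖p n fun _ => A s y‖‖
          ≤ (‖p n‖ * ‖y‖ ^ n) * volume.real (Set.Ioc (0 : ℝ) 1) :=
        norm_setIntegral_le_of_norm_le_const (by simp) fun s hs => by
          rw [norm_norm]; exact hle n s hs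
      rw [Real.volume_real_Ioc_of_le zero_le_one, sub_zero, mul_one] at h1
      exact (le_abs_self _).trans h1
    have h := hasSum_integral_of_summable_integral_norm (μ := volume.restrict (Set.Ioc (0 : ℝ) 1))
      (F := fun n s => p n fun _ => A s y) (fun n => (hcont' n).integrableOn_Ioc)
      (hsumm.of_nonneg_of_le (fun n => integral_nonneg fun _ => norm_nonneg _) hbound)
    rw [setIntegral_congr_fun measurableSet_Ioc fun s hs =>
      (hp.hasSum (hmem s hs)).tsum_eq] at h
    simp only [zero_add] at h ⊢
    convert h using 2 with n
    exact ContinuousLinearMap.integral_comp_comm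
      (ContinuousMultilinearMap.apply 𝕜 (fun _ : Fin n => E) 𝕜 fun _ => y) (hint n) |>.symm

/-- Hadamard's lemma in one of the variables. -/
theorem exists_analyticAt_eq_update_add {n : ℕ} {f : (Fin n → 𝕜) → 𝕜} (hf : AnalyticAt 𝕜 f 0)
    (j : Fin n) : ∃ h : (Fin n → 𝕜) → 𝕜, AnalyticAt 𝕜 h 0 ∧
      ∀ᶠ z in 𝓝 0, f z = f (Function.update z j 0) + z j * h z := by
  -- `A s` scales the `j`-th variable by `s`; integrating the derivative of `f (A s z)` from `s = 0`
  -- to `1` gives the quotient as an integral of `∂ j f`.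
  let A : ℝ → (Fin n → 𝕜) →L[𝕜] (Fin n → 𝕜) := fun s => ContinuousLinearMap.pi fun i =>
    (if i = j then (s : 𝕜) else 1) • ContinuousLinearMap.proj i
  have hAapp : ∀ s z i, A s z i = (if i = j then (s : 𝕜) else 1) * z i := fun s z i => rfl
  have hA : Continuous A := by
    refine continuous_clm_apply.2 fun z => continuous_pi fun i => ?_
    simp only [hAapp]
    split_ifs <;> fun_prop
  have hA1 : ∀ s ∈ Set.Icc (0 : ℝ) 1, ∀ z, ‖A s z‖ ≤ ‖z‖ := by
    intro s hs z
    refine (pi_norm_le_iff_of_nonneg (norm_nonneg z)).2 fun i => ?_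
    rw [hAapp, norm_mul]
    refine (mul_le_of_le_one_left (norm_nonneg _) ?_).trans (norm_le_pi_norm z i)
    split_ifs
    · simpa [abs_of_nonneg hs.1] using hs.2
    · simp
  have hder : AnalyticAt 𝕜 (fun y => fderiv 𝕜 f y (Pi.single j 1)) 0 :=
    ((ContinuousLinearMap.apply 𝕜 𝕜 (Pi.single j 1 : Fin n → 𝕜)).analyticAt _).comp hf.fderiv
  refine ⟨_, analyticAt_integral_comp hder hA fun s hs =>
    (A s).opNorm_le_bound zero_le_one fun z => by
      simpa using hA1 s (Set.Ioc_subset_Icc_self hs) z, ?_⟩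
  obtain ⟨ε, hε, hball⟩ := Metric.eventually_nhds_iff_ball.1 hf.eventually_analyticAt
  filter_upwards [Metric.ball_mem_nhds 0 hε] with z hz
  have hmem : ∀ s ∈ Set.Icc (0 : ℝ) 1, AnalyticAt 𝕜 f (A s z) := fun s hs =>
    hball _ (by rw [mem_ball_zero_iff] at hz ⊢; exact (hA1 s hs z).trans_lt hz)
  have hderiv : ∀ s ∈ Set.Icc (0 : ℝ) 1,
      HasDerivAt (fun s => f (A s z)) (z j * fderiv 𝕜 f (A s z) (Pi.single j 1)) s := by
    intro s hs
    have h1 : HasDerivAt (fun s => A s z) (Pi.single j (z j)) s := by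
      refine hasDerivAt_pi.2 fun i => ?_
      simp only [hAapp]
      by_cases hi : i = j
      · subst hi
        simpa using ((RCLike.ofRealCLM (K := 𝕜)).hasDerivAt (x := s)).mul_const (z i)
      · simpa [hi] using hasDerivAt_const s (z i)
    have h2 := ((hmem s hs).differentiableAt.hasFDerivAt.restrictScalars ℝ).comp_hasDerivAt s h1
    have h3 : (Pi.single j (z j) : Fin n → 𝕜) = z j • Pi.single j 1 := by
      rw [← Pi.single_smul, smul_eq_mul, mul_one]
    refine h2.congr_deriv ?_
    rw [h3, ContinuousLinearMap.coe_restrictScalars', map_smul, smul_eq_mul]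
  have hcd : ContinuousOn (fun s => z j * fderiv 𝕜 f (A s z) (Pi.single j 1)) (Set.Icc 0 1) := by
    intro s hs
    refine ContinuousAt.continuousWithinAt (continuousAt_const.mul ?_)
    exact ((hmem s hs).fderiv.continuousAt.clm_apply continuousAt_const).comp
      (f := fun s => A s z) (hA.clm_apply continuous_const).continuousAt
  have hftc := intervalIntegral.integral_eq_sub_of_hasDerivAt (a := 0) (b := 1)
    (f := fun s => f (A s z)) (f' := fun s => z j * fderiv 𝕜 f (A s z) (Pi.single j 1))
    (fun s hs => hderiv s (by rwa [Set.uIcc_of_le zero_le_one] at hs))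
    (ContinuousOn.intervalIntegrable (by rwa [Set.uIcc_of_le zero_le_one]))
  rw [intervalIntegral.integral_of_le zero_le_one, integral_const_mul] at hftc
  have e1 : A 1 z = z := by ext i; simp [hAapp]
  have e0 : A 0 z = Function.update z j 0 := by
    ext i
    by_cases hi : i = j
    · subst hi; simp [hAapp]
    · simp [hAapp, hi]
  rw [e1, e0] at hftc
  rw [hftc]; ring

/-- The one-variable lemma is applied to one variable after another, each time to the function with
the earlier variables set to zero. -/
theorem exists_analyticAt_eq_sum {n : ℕ} {f : (Fin n → 𝕜) → 𝕜} (hf : AnalyticAt 𝕜 f 0) :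
    ∃ h : Fin n → (Fin n → 𝕜) → 𝕜, (∀ j, AnalyticAt 𝕜 (h j) 0) ∧
      ∀ᶠ z in 𝓝 0, f z = f 0 + ∑ j, z j * h j z := by
  have key : ∀ s : Finset (Fin n), ∃ h : Fin n → (Fin n → 𝕜) → 𝕜, (∀ j, AnalyticAt 𝕜 (h j) 0) ∧
      ∀ᶠ z in 𝓝 0, f z = f (fun i => if i ∈ s then 0 else z i) + ∑ j ∈ s, z j * h j z := by
    intro s
    induction s using Finset.induction_on with
    | empty => exact ⟨fun _ _ => 0, fun _ => analyticAt_const, by simp⟩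
    | insert j s hj ih =>
      obtain ⟨h, hh, he⟩ := ih
      let π : (Fin n → 𝕜) →L[𝕜] (Fin n → 𝕜) := ContinuousLinearMap.pi fun i =>
        if i ∈ s then 0 else ContinuousLinearMap.proj i
      have hπ : ∀ z, π z = fun i => if i ∈ s then 0 else z i := fun z => by
        ext i
        simp only [π, ContinuousLinearMap.coe_pi']
        split_ifs <;> rfl
      have hfπ : AnalyticAt 𝕜 (fun z => f (π z)) 0 :=
        AnalyticAt.comp (by rwa [map_zero]) (π.analyticAt 0)
      obtain ⟨k, hk, hke⟩ := exists_analyticAt_eq_update_add hfπ j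
      refine ⟨Function.update h j k, fun i => ?_, ?_⟩
      · by_cases hi : i = j
        · subst hi; simpa using hk
        · simpa [hi] using hh i
      · filter_upwards [he, hke] with z hz1 hz2
        rw [hz1, ← hπ, hz2, Finset.sum_insert hj, hπ, add_assoc]
        congr 2
        · ext i
          by_cases hi : i = j
          · subst hi; simp
          · simp [hi]
        · simp
        · refine Finset.sum_congr rfl fun i hi => ?_
          rw [Function.update_of_ne (ne_of_mem_of_not_mem hi hj)]
  obtain ⟨h, hh, he⟩ := key Finset.univ
  exact ⟨h, hh, by simpa [Pi.zero_def] using he⟩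

end Hadamard

end

section

/-! ### Vanishing and divisibility of analytic functions -/

section Vanishing

variable {𝕜 : Type*} [RCLike 𝕜]

/-- Inductively, the first nonzero homogeneous term would be of the order of a higher power of the
norm, hence zero. So all terms of the power series vanish. -/
theorem eventually_eq_zero_of_isBigO {E : Type*} [NormedAddCommGroup E] [NormedSpace 𝕜 E]
    {f : E → 𝕜} (hf : AnalyticAt 𝕜 f 0) (h : ∀ k : ℕ, f =O[𝓝 0] fun z => ‖z‖ ^ k) :
    ∀ᶠ z in 𝓝 0, f z = 0 := by
  obtain ⟨p, hp⟩ := hf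
  have key : ∀ k y, p k (fun _ => y) = 0 := by
    intro k
    induction k using Nat.strong_induction_on with
    | _ k ih =>
      refine Asymptotics.IsBigO.continuousMultilinearMap_apply_eq_zero ?_
      refine ((h (k + 1)).sub (hp.isBigO_sub_partialSum_pow (k + 1))).congr_left fun y => ?_
      rw [zero_add, sub_sub_cancel, FormalMultilinearSeries.partialSum, Finset.sum_range_succ,
        Finset.sum_eq_zero fun i hi => ih i (Finset.mem_range.1 hi) y, zero_add]
  obtain ⟨r, hr⟩ := hp
  filter_upwards [Metric.eball_mem_nhds (0 : E) hr.r_pos] with z hz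
  have := hr.hasSum hz
  simp only [key, zero_add] at this
  exact this.unique hasSum_zero

variable {n : ℕ} {f g : (Fin n → 𝕜) → 𝕜} {i j : Fin n}

theorem analyticAt_coord (j : Fin n) (x : Fin n → 𝕜) :
    AnalyticAt 𝕜 (fun z : Fin n → 𝕜 => z j) x :=
  (ContinuousLinearMap.proj (R := 𝕜) (φ := fun _ : Fin n => 𝕜) j).analyticAt x

/-- Off the hyperplane `z i = 0` one can divide; points on it are limits of points off it, so
continuity suffices. -/
theorem AnalyticAt.eventually_eq_zero_of_coord_mul (hf : AnalyticAt 𝕜 f 0)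
    (h : ∀ᶠ z in 𝓝 0, z i * f z = 0) : ∀ᶠ z in 𝓝 0, f z = 0 := by
  filter_upwards [h.eventually_nhds, hf.eventually_analyticAt] with z hz hfz
  have hc : Filter.Tendsto (fun ε : 𝕜 => Function.update z i (z i + ε)) (𝓝[≠] 0) (𝓝 z) := by
    refine Filter.Tendsto.mono_left ?_ nhdsWithin_le_nhds
    have : Continuous fun ε : 𝕜 => Function.update z i (z i + ε) := by fun_prop
    simpa using this.tendsto 0
  by_cases hzi : z i = 0
  · refine tendsto_nhds_unique (hfz.continuousAt.tendsto.comp hc)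
      (tendsto_const_nhds.congr' ?_)
    filter_upwards [hc.eventually hz, self_mem_nhdsWithin] with ε hε h0
    have h0' : ε ≠ 0 := h0
    simpa [hzi, h0', eq_comm] using hε
  · exact (mul_eq_zero.1 hz.self_of_nhds).resolve_left hzi

/-- On `z j = 0` the relation becomes `z i * f = 0`, so `f` vanishes there and Hadamard's lemma
divides it by `z j`. -/
theorem AnalyticAt.exists_eq_coord_mul (hf : AnalyticAt 𝕜 f 0) (hij : i ≠ j)
    (h : ∀ᶠ z in 𝓝 0, z i * f z = z j * g z) :
    ∃ k : (Fin n → 𝕜) → 𝕜, AnalyticAt 𝕜 k 0 ∧ ∀ᶠ z in 𝓝 0, f z = z j * k z := by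
  obtain ⟨k, hk, he⟩ := exists_analyticAt_eq_update_add hf j
  let π : (Fin n → 𝕜) →L[𝕜] (Fin n → 𝕜) := ContinuousLinearMap.pi fun i =>
    if i = j then 0 else ContinuousLinearMap.proj i
  have hπ : ∀ z, π z = Function.update z j 0 := fun z => by
    ext i
    by_cases hi : i = j
    · subst hi; simp [π]
    · simp [π, hi]
  have hπ0 : Filter.Tendsto π (𝓝 0) (𝓝 0) := by simpa using π.continuous.tendsto 0
  have h0 : ∀ᶠ z in 𝓝 0, f (π z) = 0 := by
    refine AnalyticAt.eventually_eq_zero_of_coord_mul (i := i)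
      (AnalyticAt.comp (by rwa [map_zero]) (π.analyticAt 0)) ?_
    filter_upwards [hπ0.eventually h] with z hz
    simpa [hπ, hij] using hz
  refine ⟨k, hk, ?_⟩
  filter_upwards [he, h0] with z hz hz0
  rw [hz, ← hπ, hz0, zero_add]

end Vanishing

/-! ### Germs of analytic functions in a chart -/

section AnalyticStalk

variable {𝕜 : Type} [RCLike 𝕜] {n : ℕ} {X : AnalyticManifold.{u} 𝕜 n} {p : X.carrier}

theorem contMDiffAt_omega_iff_analyticAt {E F : Type*} [NormedAddCommGroup E] [NormedSpace 𝕜 E]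
    [NormedAddCommGroup F] [NormedSpace 𝕜 F] [CompleteSpace F] {f : E → F} {x : E} :
    ContMDiffAt 𝓘(𝕜, E) 𝓘(𝕜, F) ω f x ↔ AnalyticAt 𝕜 f x := by
  rw [contMDiffAt_iff_contDiffAt, ← contDiffWithinAt_univ,
    contDiffWithinAt_omega_iff_analyticWithinAt, analyticWithinAt_univ]

/-- The value of a germ of an analytic function. -/
def analyticValue (X : AnalyticManifold.{u} 𝕜 n) (p : X.carrier) : analyticStalk X p →+* 𝕜 :=
  Filter.Germ.valueRingHom.comp (analyticStalk X p).subtype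

/-- Constant germs. -/
def analyticConst (X : AnalyticManifold.{u} 𝕜 n) (p : X.carrier) (c : 𝕜) : analyticStalk X p :=
  ⟨((fun _ => c : X.carrier → 𝕜) : Filter.Germ (𝓝 p) 𝕜), _, contMDiffAt_const, rfl⟩

theorem analyticValue_eq_zero_iff {φ : analyticStalk X p} :
    analyticValue X p φ = 0 ↔ ¬ IsUnit φ := by
  rw [analyticStalk_isUnit_iff, not_not]; rfl

variable (X p)

/-- An analytic chart of `X`, centred at `p`. -/
structure AnalyticChart where
  toFun : X.carrier → Fin n → 𝕜
  inv : (Fin n → 𝕜) → X.carrier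
  contMDiffAt_toFun : ContMDiffAt 𝓘(𝕜, Fin n → 𝕜) 𝓘(𝕜, Fin n → 𝕜) ω toFun p
  contMDiffAt_inv : ContMDiffAt 𝓘(𝕜, Fin n → 𝕜) 𝓘(𝕜, Fin n → 𝕜) ω inv 0
  toFun_self : toFun p = 0
  inv_zero : inv 0 = p
  left_inv : ∀ᶠ x in 𝓝 p, inv (toFun x) = x
  right_inv : ∀ᶠ z in 𝓝 0, toFun (inv z) = z

theorem nonempty_analyticChart : Nonempty (AnalyticChart X p) := by
  let e := extChartAt 𝓘(𝕜, Fin n → 𝕜) p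
  have h1 : ContMDiffAt 𝓘(𝕜, Fin n → 𝕜) 𝓘(𝕜, Fin n → 𝕜) ω (fun z => z + e p) 0 :=
    contMDiffAt_omega_iff_analyticAt.2 (analyticAt_id.add analyticAt_const)
  have ht : ∀ᶠ z in 𝓝 (0 : Fin n → 𝕜), z + e p ∈ e.target := by
    have : Filter.Tendsto (fun z : Fin n → 𝕜 => z + e p) (𝓝 0) (𝓝 (e p)) := by
      simpa using (continuous_add_const (e p)).tendsto (0 : Fin n → 𝕜)
    exact this.eventually (extChartAt_target_mem_nhds p)
  exact ⟨{
    toFun := fun x => e x - e p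
    inv := fun z => e.symm (z + e p)
    contMDiffAt_toFun := (contMDiffAt_extChartAt (n := ω)).sub contMDiffAt_const
    contMDiffAt_inv := by
      refine ContMDiffAt.comp (g := e.symm) (I' := 𝓘(𝕜, Fin n → 𝕜)) (0 : Fin n → 𝕜) ?_ h1
      simp only [zero_add]
      exact (contMDiffOn_extChartAt_symm p).contMDiffAt (extChartAt_target_mem_nhds p)
    toFun_self := sub_self _
    inv_zero := by simp [e]
    left_inv := by
      filter_upwards [extChartAt_source_mem_nhds (I := 𝓘(𝕜, Fin n → 𝕜)) p] with x hx
      simp only [sub_add_cancel]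
      exact e.left_inv hx
    right_inv := by
      filter_upwards [ht] with z hz
      rw [e.right_inv hz, add_sub_cancel_right] }⟩

namespace AnalyticChart

variable {X p} (K : AnalyticChart X p)

theorem tendsto_toFun : Filter.Tendsto K.toFun (𝓝 p) (𝓝 0) := by
  simpa [ContinuousAt, K.toFun_self] using K.contMDiffAt_toFun.continuousAt

theorem tendsto_inv : Filter.Tendsto K.inv (𝓝 0) (𝓝 p) := by
  simpa [ContinuousAt, K.inv_zero] using K.contMDiffAt_inv.continuousAt

/-- The germ of an analytic function of the coordinates. -/
def germ (f : (Fin n → 𝕜) → 𝕜) (hf : AnalyticAt 𝕜 f 0) : analyticStalk X p :=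
  ⟨((f ∘ K.toFun : X.carrier → 𝕜) : Filter.Germ (𝓝 p) 𝕜), _,
    ContMDiffAt.comp p (contMDiffAt_omega_iff_analyticAt.2 (by rwa [K.toFun_self]))
      K.contMDiffAt_toFun, rfl⟩

theorem exists_eq_germ (φ : analyticStalk X p) : ∃ f hf, φ = K.germ f hf := by
  obtain ⟨_, f, hf, rfl⟩ := φ
  refine ⟨f ∘ K.inv, contMDiffAt_omega_iff_analyticAt.1
    (ContMDiffAt.comp 0 (by rwa [K.inv_zero]) K.contMDiffAt_inv), Subtype.ext ?_⟩
  refine Filter.Germ.coe_eq.2 ?_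
  filter_upwards [K.left_inv] with x hx
  simp [hx]

variable {f g h : (Fin n → 𝕜) → 𝕜} (hf : AnalyticAt 𝕜 f 0) (hg : AnalyticAt 𝕜 g 0)

theorem germ_eq_germ_iff : K.germ f hf = K.germ g hg ↔ ∀ᶠ z in 𝓝 0, f z = g z := by
  rw [Subtype.ext_iff]
  refine Filter.Germ.coe_eq.trans ⟨fun H => ?_, fun H => K.tendsto_toFun.eventually H⟩
  filter_upwards [K.tendsto_inv.eventually H, K.right_inv] with z hz hz'
  simpa [hz'] using hz

theorem germ_mul : K.germ f hf * K.germ g hg = K.germ (fun z => f z * g z) (hf.mul hg) := rfl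

theorem germ_add : K.germ f hf + K.germ g hg = K.germ (fun z => f z + g z) (hf.add hg) := rfl

theorem germ_const (c : 𝕜) : K.germ (fun _ => c) analyticAt_const = analyticConst X p c := rfl

theorem germ_zero : K.germ (fun _ => 0) analyticAt_const = 0 := rfl

theorem value_germ : analyticValue X p (K.germ f hf) = f 0 :=
  congrArg f K.toFun_self

/-- The coordinate functions. -/
def coord (j : Fin n) : analyticStalk X p :=
  K.germ (fun z => z j) (analyticAt_coord j 0)

theorem value_coord (j : Fin n) : analyticValue X p (K.coord j) = 0 := K.value_germ _

theorem germ_sum {ι : Type*} (s : Finset ι) {F : ι → (Fin n → 𝕜) → 𝕜}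
    (hF : ∀ i, AnalyticAt 𝕜 (F i) 0) :
    K.germ (fun z => ∑ i ∈ s, F i z) (Finset.analyticAt_fun_sum s fun i _ => hF i)
      = ∑ i ∈ s, K.germ (F i) (hF i) := by
  induction s using Finset.cons_induction with
  | empty => simp only [Finset.sum_empty]; exact K.germ_zero
  | cons a s ha ih => simp only [Finset.sum_cons]; rw [← ih]; rfl

theorem exists_eq_const_add_sum (φ : analyticStalk X p) :
    ∃ h : Fin n → analyticStalk X p,
      φ = analyticConst X p (analyticValue X p φ) + ∑ j, K.coord j * h j := by
  obtain ⟨f, hf, rfl⟩ := K.exists_eq_germ φ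
  obtain ⟨h, hh, he⟩ := exists_analyticAt_eq_sum hf
  refine ⟨fun j => K.germ (h j) (hh j), ?_⟩
  rw [K.value_germ, ← K.germ_const]
  simp only [coord, K.germ_mul]
  rw [← K.germ_sum, K.germ_add, K.germ_eq_germ_iff]
  exact he

theorem eq_zero_of_coord_mul {i : Fin n} {φ : analyticStalk X p} (h : K.coord i * φ = 0) :
    φ = 0 := by
  obtain ⟨f, hf, rfl⟩ := K.exists_eq_germ φ
  rw [coord, K.germ_mul, ← K.germ_zero, K.germ_eq_germ_iff] at h
  rw [← K.germ_zero, K.germ_eq_germ_iff]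
  exact AnalyticAt.eventually_eq_zero_of_coord_mul hf h

theorem coord_dvd_of_coord_dvd_mul {i j : Fin n} (hij : i ≠ j) {φ : analyticStalk X p}
    (h : K.coord j ∣ K.coord i * φ) : K.coord j ∣ φ := by
  obtain ⟨f, hf, rfl⟩ := K.exists_eq_germ φ
  obtain ⟨ψ, hψ⟩ := h
  obtain ⟨g, hg, rfl⟩ := K.exists_eq_germ ψ
  rw [coord, coord, K.germ_mul, K.germ_mul, K.germ_eq_germ_iff] at hψ
  obtain ⟨k, hk, he⟩ := AnalyticAt.exists_eq_coord_mul hf hij hψ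
  refine ⟨K.germ k hk, ?_⟩
  rw [coord, K.germ_mul, K.germ_eq_germ_iff]
  exact he

end AnalyticChart

/-- The local ring of germs of analytic functions is separated in the topology of its maximal
ideal. -/
theorem eq_zero_of_forall_mem_pow {φ : analyticStalk X p} (J : Ideal (analyticStalk X p))
    (hJ : ∀ ψ ∈ J, analyticValue X p ψ = 0) (h : ∀ k : ℕ, φ ∈ J ^ k) : φ = 0 := by
  obtain ⟨K⟩ := nonempty_analyticChart X p
  have key : ∀ k : ℕ, ∀ ψ ∈ J ^ k, ∀ f hf, ψ = K.germ f hf → f =O[𝓝 0] fun z => ‖z‖ ^ k := by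
    intro k
    induction k with
    | zero =>
      rintro ψ - f hf -
      simpa using hf.continuousAt.isBigO_one ℝ
    | succ k ih =>
      intro ψ hψ
      rw [pow_succ] at hψ
      refine Submodule.mul_induction_on hψ ?_ ?_
      · intro a ha b hb f hf he
        obtain ⟨a, ha', rfl⟩ := K.exists_eq_germ a
        obtain ⟨b, hb', rfl⟩ := K.exists_eq_germ b
        rw [K.germ_mul, K.germ_eq_germ_iff] at he
        have h1 := ih _ ha _ _ rfl
        have h2 : b =O[𝓝 0] fun z => ‖z‖ := by
          have h3 := hJ _ hb
          rw [K.value_germ] at h3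
          simpa [h3] using hb'.differentiableAt.isBigO_sub.norm_right
        exact ((h1.mul h2).congr_right fun z => (pow_succ _ _).symm).congr' he
          (Filter.EventuallyEq.refl _ _)
      · intro a b iha ihb f hf he
        obtain ⟨a, ha', rfl⟩ := K.exists_eq_germ a
        obtain ⟨b, hb', rfl⟩ := K.exists_eq_germ b
        rw [K.germ_add, K.germ_eq_germ_iff] at he
        exact ((iha _ _ rfl).add (ihb _ _ rfl)).congr' he (Filter.EventuallyEq.refl _ _)
  obtain ⟨f, hf, rfl⟩ := K.exists_eq_germ φ
  rw [← K.germ_zero, K.germ_eq_germ_iff]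
  exact eventually_eq_zero_of_isBigO hf fun k => key k _ (h k) f hf rfl

end AnalyticStalk

end

section

/-! ### Coordinates with dual derivations come from analytic charts -/

section CoordinateChange

variable {𝕜 : Type} [RCLike 𝕜] {n : ℕ} {X : AnalyticManifold.{u} 𝕜 n} {p : X.carrier}

open Matrix in
/-- An analytic map with invertible derivative is a change of coordinates. -/
theorem AnalyticChart.exists_comp (K : AnalyticChart X p) {F : (Fin n → 𝕜) → Fin n → 𝕜}
    (hF : AnalyticAt 𝕜 F 0) (hF0 : F 0 = 0) {B A : Matrix (Fin n) (Fin n) 𝕜} (hBA : B * A = 1)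
    (hB : HasFDerivAt F (LinearMap.toContinuousLinearMap (Matrix.toLin' B)) 0) :
    ∃ K' : AnalyticChart X p, K'.toFun = F ∘ K.toFun := by
  let L : (Fin n → 𝕜) ≃L[𝕜] (Fin n → 𝕜) :=
    (Matrix.toLin'OfInv (mul_eq_one_comm.1 hBA) hBA).toContinuousLinearEquiv
  have hL : HasFDerivAt F (L : (Fin n → 𝕜) →L[𝕜] (Fin n → 𝕜)) 0 := hB
  have hCD : ContDiffAt 𝕜 ω F 0 := hF.contDiffAt
  have hω : (ω : WithTop ℕ∞) ≠ 0 := by simp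
  have hs := hCD.hasStrictFDerivAt' hL hω
  have hinv0 := hCD.localInverse_apply_image hL hω
  have hinv := hCD.to_localInverse hL hω
  have hr : ∀ᶠ y in 𝓝 (F 0), F (hCD.localInverse hL hω y) = y := hs.eventually_right_inverse
  have hl : ∀ᶠ x in 𝓝 0, hCD.localInverse hL hω (F x) = x := hs.eventually_left_inverse
  rw [hF0] at hinv0 hinv hr
  have hFc : Filter.Tendsto (hCD.localInverse hL hω) (𝓝 0) (𝓝 0) := by
    simpa [ContinuousAt, hinv0] using hinv.continuousAt
  refine ⟨{
    toFun := F ∘ K.toFun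
    inv := K.inv ∘ hCD.localInverse hL hω
    contMDiffAt_toFun := ContMDiffAt.comp p
      (by rw [K.toFun_self]; exact hCD.contMDiffAt) K.contMDiffAt_toFun
    contMDiffAt_inv := ContMDiffAt.comp 0 (by rw [hinv0]; exact K.contMDiffAt_inv)
      hinv.contMDiffAt
    toFun_self := by simp [K.toFun_self, hF0]
    inv_zero := by simp [hinv0, K.inv_zero]
    left_inv := by
      filter_upwards [K.left_inv, K.tendsto_toFun.eventually hl] with x h1 h2
      simp [h1, h2]
    right_inv := by
      filter_upwards [hr, hFc.eventually K.right_inv] with z h1 h2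
      simp [h1, h2] }, rfl⟩

/-- The dual derivations force the Jacobian matrix of the `x j` to be invertible, and the inverse
function theorem turns these functions, up to their values at `p`, into the coordinates of a chart.
-/
theorem exists_analyticChart_of_derivations {x : Fin n → analyticStalk X p}
    {D : Fin n → Derivation ℤ (analyticStalk X p) (analyticStalk X p)}
    (hD : ∀ i c, D i (analyticConst X p c) = 0) (hDx : ∀ i j, D i (x j) = if i = j then 1 else 0) :
    ∃ K : AnalyticChart X p,
      ∀ j, x j = analyticConst X p (analyticValue X p (x j)) + K.coord j := by
  obtain ⟨K⟩ := nonempty_analyticChart X p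
  choose C hC hxC using fun j => K.exists_eq_germ (x j)
  choose h hh using fun j => K.exists_eq_const_add_sum (x j)
  choose H hH hhH using fun j l => K.exists_eq_germ (h j l)
  -- `B` is the Jacobian of the `x j` in the given chart, read off from Hadamard's lemma. `A` holds
  -- the values of the derivations on the chart coordinates, and duality says that `B * A = 1`.
  let B : Matrix (Fin n) (Fin n) 𝕜 := fun j l => analyticValue X p (h j l)
  let A : Matrix (Fin n) (Fin n) 𝕜 := fun l i => analyticValue X p (D i (K.coord l))
  have hBA : B * A = 1 := by
    ext j i
    have h1 := congrArg (analyticValue X p) (hDx i j)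
    rw [hh j, map_add, hD, zero_add, map_sum, map_sum] at h1
    simp only [Derivation.leibniz, smul_eq_mul, map_add, map_mul, K.value_coord, zero_mul,
      zero_add] at h1
    rw [Matrix.mul_apply, Matrix.one_apply]
    simp only [B, A]
    rw [h1]
    by_cases hij : i = j
    · simp [hij]
    · simp [hij, Ne.symm hij]
  have hF : AnalyticAt 𝕜 (fun z j => C j z - C j 0) 0 :=
    analyticAt_pi_iff.2 fun j => (hC j).sub analyticAt_const
  have he : ∀ j, ∀ᶠ z in 𝓝 0, C j z - C j 0 = ∑ l, z l * H j l z := by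
    intro j
    have h1 : K.germ (C j) (hC j) = K.germ (fun z => C j 0 + ∑ l, z l * H j l z)
        (analyticAt_const.add (Finset.analyticAt_fun_sum _ fun l _ =>
          (analyticAt_coord l 0).mul (hH j l))) := by
      have hv : analyticValue X p (x j) = C j 0 := by rw [hxC, K.value_germ]
      have h2 := hh j
      rw [hv] at h2
      simp only [hhH] at h2
      exact (hxC j).symm.trans (h2.trans (congrArg (analyticConst X p (C j 0) + ·)
        (K.germ_sum _ fun l => (analyticAt_coord l 0).mul (hH j l)).symm))
    rw [K.germ_eq_germ_iff] at h1
    filter_upwards [h1] with z hz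
    rw [hz, add_sub_cancel_left]
  have hB : HasFDerivAt (fun z j => C j z - C j 0)
      (LinearMap.toContinuousLinearMap (Matrix.toLin' B)) 0 := by
    refine hasFDerivAt_pi'.2 fun j => ?_
    have h1 : HasFDerivAt (fun z : Fin n → 𝕜 => ∑ l, z l * H j l z)
        (∑ l, B j l • ContinuousLinearMap.proj (R := 𝕜) (φ := fun _ : Fin n => 𝕜) l) 0 := by
      refine HasFDerivAt.fun_sum fun l _ => ?_
      have h2 := (ContinuousLinearMap.proj (R := 𝕜) (φ := fun _ : Fin n => 𝕜) l).hasFDerivAt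
        (x := 0) |>.mul (hH j l).differentiableAt.hasFDerivAt
      refine h2.congr_fderiv ?_
      have h3 : B j l = H j l 0 := by simp only [B]; rw [hhH, K.value_germ]
      ext v
      simp [h3]
    refine (h1.congr_of_eventuallyEq (he j)).congr_fderiv ?_
    ext v
    simp [Matrix.mulVec, dotProduct]
  obtain ⟨K', hK'⟩ := K.exists_comp hF (by ext; simp) hBA hB
  refine ⟨K', fun j => ?_⟩
  conv_lhs => rw [hxC j]
  rw [hxC j, K.value_germ]
  apply Subtype.ext
  refine Filter.Germ.coe_eq.2 (Filter.Eventually.of_forall fun y => ?_)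
  change C j (K.toFun y) = C j 0 + K'.toFun y j
  rw [hK']
  simp

end CoordinateChange

/-! ### The analytic geometries are regular -/

section AnalyticRegular

variable {𝕜 : Type} [RCLike 𝕜]

theorem exists_analyticChart {n : ℕ} {X : AnalyticManifold.{u} 𝕜 n} {p : X.carrier}
    (c : Coord (G := analyticGeometry 𝕜) X p) : ∃ K : AnalyticChart X p,
      ∀ j, c.x j = analyticConst X p (analyticValue X p (c.x j)) + K.coord j :=
  exists_analyticChart_of_derivations (D := c.pd) (fun i a => c.pd_scalar i _ ⟨a, rfl⟩) c.pd_x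

theorem isUnit_or_eq_coord {n : ℕ} {X : AnalyticManifold.{u} 𝕜 n} {p : X.carrier}
    {x : analyticStalk X p} {K : AnalyticChart X p} {j : Fin n}
    (h : x = analyticConst X p (analyticValue X p x) + K.coord j) :
    IsUnit x ∨ x = K.coord j := by
  by_cases h0 : analyticValue X p x = 0
  · right
    rw [h, h0]
    exact zero_add _
  · left
    by_contra hu
    exact h0 (analyticValue_eq_zero_iff.2 hu)

theorem analyticGeometry_isRegular : (analyticGeometry.{u} 𝕜).IsRegular where
  isUnit_natCast X p m hm := by
    refine (analyticStalk_isUnit_iff X p _).2 ?_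
    have : analyticValue X p (m : analyticStalk X p) = m := map_natCast _ m
    exact this.trans_ne (Nat.cast_ne_zero.2 hm)
  isLocalHom_pull {m n X Y} f p := by
    refine ⟨fun φ hφ => (analyticStalk_isUnit_iff Y _ φ).2 ?_⟩
    have h := (analyticStalk_isUnit_iff X p _).1 hφ
    obtain ⟨_, g, hg, rfl⟩ := φ
    exact h
  image_scalars f p := by
    ext φ
    constructor
    · rintro ⟨ψ, ⟨a, ha⟩, rfl⟩
      obtain ⟨ψ, hψ⟩ := ψ
      obtain rfl : ψ = _ := ha
      exact ⟨a, rfl⟩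
    · rintro ⟨a, ha⟩
      exact ⟨analyticConst _ _ a, ⟨a, rfl⟩, Subtype.ext ha.symm⟩
  deriv_ext {m n X Y} f p c D hD hs hx φ := by
    obtain ⟨K, hK⟩ := exists_analyticChart c
    have hcoord : ∀ j, D (K.coord j) = 0 := by
      intro j
      have h1 := hx j
      rw [hK j] at h1
      have h2 := D.map_add (analyticConst Y _ (analyticValue Y _ (c.x j))) (K.coord j)
      rw [hs (analyticConst Y _ (analyticValue Y _ (c.x j))) ⟨_, rfl⟩, zero_add] at h2
      exact h2.symm.trans h1
    -- Hadamard's lemma writes each `D φ` as a combination of pulled-back coordinates with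
    -- coefficients of the form `D h`. Iteration puts `D φ` in every power of the ideal of germs
    -- vanishing at `p`, hence makes it zero.
    let J : Ideal (analyticStalk X p) := RingHom.ker (analyticValue X p)
    have hJ : ∀ j, analyticPull f.1 f.2 p (K.coord j) ∈ J := K.value_coord
    refine eq_zero_of_forall_mem_pow X p J (fun ψ hψ => hψ) fun k => ?_
    revert φ
    induction k with
    | zero => intro φ; rw [pow_zero, Ideal.one_eq_top]; trivial
    | succ k ih =>
      intro φ
      obtain ⟨h, hh⟩ := K.exists_eq_const_add_sum φ
      have h1 : D φ = ∑ j, (analyticGeometry 𝕜).pull f p (K.coord j) * D (h j) := by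
        rw [hh]
        refine (D.map_add _ _).trans ?_
        rw [hs (analyticConst Y _ (analyticValue Y _ φ)) ⟨_, rfl⟩, zero_add]
        refine (map_sum D _ _).trans (Finset.sum_congr rfl fun j _ => (hD _ _).trans ?_)
        rw [hcoord, mul_zero, add_zero]
      rw [h1, pow_succ']
      exact Ideal.sum_mem _ fun j _ => Ideal.mul_mem_mul (hJ j) (ih _)
  mem_of_mul_mem {n X p} c i j hij f h := by
    obtain ⟨K, hK⟩ := exists_analyticChart c
    rcases isUnit_or_eq_coord (hK i) with hi | hi
    · exact (Ideal.unit_mul_mem_iff_mem _ hi).1 h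
    rcases isUnit_or_eq_coord (hK j) with hj | hj
    · exact Ideal.mem_span_singleton.2 hj.dvd
    · rw [Ideal.mem_span_singleton, hi, hj] at h
      rw [Ideal.mem_span_singleton, hj]
      exact K.coord_dvd_of_coord_dvd_mul hij h
  eq_zero_of_mul {n X p} c i f h := by
    obtain ⟨K, hK⟩ := exists_analyticChart c
    rcases isUnit_or_eq_coord (hK i) with hi | hi
    · exact hi.mul_right_eq_zero.1 h
    · rw [hi] at h
      exact K.eq_zero_of_coord_mul h
  map_id _ _ := rfl
  map_comp _ _ _ := rfl
  pullAt_id X p q h h' φ := by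
    subst h'
    obtain ⟨_, g, hg, rfl⟩ := φ
    rfl
  pullAt_comp f g p q r h h₁ h₂ φ := by
    subst h₁ h₂
    obtain ⟨_, g, hg, rfl⟩ := φ
    rfl

end AnalyticRegular

end

section

/-! ### Kähler differentials and coordinates -/

section KaehlerCoordinates

variable {k O : Type*} [Field k] [CommRing O] [Algebra k O] [Module.Projective O Ω[O⁄k]]
  {n : ℕ} {x : Fin n → O} {D : Fin n → Derivation k O O}

/-- If the `D i` form a basis of the derivations that is dual to the `x j`, then the differentials
of the `x j` generate the module of differentials. -/
theorem kaehler_eq_sum (hDx : ∀ i j, D i (x j) = if i = j then 1 else 0)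
    (hD : ∀ d : Derivation k O O, (∀ j, d (x j) = 0) → d = 0) (a : O) :
    KaehlerDifferential.D k O a = ∑ j, D j a • KaehlerDifferential.D k O (x j) := by
  refine sub_eq_zero.1 ((Module.forall_dual_apply_eq_zero_iff O _).1 fun φ => ?_)
  have h := hD (φ.compDer (KaehlerDifferential.D k O)
    - ∑ j, φ (KaehlerDifferential.D k O (x j)) • D j) fun j => by
      simp [derivation_sum_apply, hDx]
  have h1 := congrArg (fun d : Derivation k O O => d a) h
  simpa [derivation_sum_apply, mul_comm] using h1

/-- A derivation into any module factors through the Kähler differentials, which the `d(x j)`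
generate. -/
theorem derivation_eq_zero_of_coord {M : Type*} [AddCommGroup M] [Module O M] [Module k M]
    [IsScalarTower k O M]
    (hDx : ∀ i j, D i (x j) = if i = j then 1 else 0)
    (hD : ∀ d : Derivation k O O, (∀ j, d (x j) = 0) → d = 0) {d : Derivation k O M}
    (hd : ∀ j, d (x j) = 0) (a : O) : d a = 0 := by
  rw [← d.liftKaehlerDifferential_comp_D, kaehler_eq_sum hDx hD a, map_sum]
  simp [hd]

end KaehlerCoordinates

/-! ### Cancelling a coordinate in a Noetherian local ring -/

section Krull

variable {O : Type*} [CommRing O] [IsLocalRing O] [IsNoetherianRing O]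

/-- Repeated differentiation of `x f ∈ J` shows that modulo `J` the element `f` is a multiple of
every power of `x`. If `x` is a nonunit, Krull's intersection theorem in the quotient by `J` gives
`f ∈ J`. -/
theorem mem_of_mul_mem_of_derivation (hu : ∀ m : ℕ, m ≠ 0 → IsUnit (m : O))
    (D : Derivation ℤ O O) {J : Ideal O} (hJ : ∀ a ∈ J, D a ∈ J) {x : O} (hDx : D x = 1) {f : O}
    (h : x * f ∈ J) : f ∈ J := by
  by_cases hx : IsUnit x
  · exact (Ideal.unit_mul_mem_iff_mem _ hx).1 h
  have h1 : ∀ m : ℕ, x * D^[m + 1] f + (m + 1 : ℕ) * D^[m] f ∈ J := by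
    intro m
    induction m with
    | zero => simpa [hDx] using hJ _ h
    | succ m ih =>
      have h2 := hJ _ ih
      rw [map_add, D.leibniz, D.leibniz, hDx, D.map_natCast] at h2
      rw [Function.iterate_succ_apply' D (m + 1), Function.iterate_succ_apply' D m]
      rw [Function.iterate_succ_apply' D m] at h2
      convert h2 using 1
      simp only [smul_eq_mul]
      push_cast
      ring
  have h3 : ∀ m : ℕ, ∃ c : O, f - c * x ^ m * D^[m] f ∈ J := by
    intro m
    induction m with
    | zero => exact ⟨1, by simp⟩
    | succ m ih =>
      obtain ⟨c, hc⟩ := ih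
      obtain ⟨e, he⟩ := (hu (m + 1) m.succ_ne_zero).exists_left_inv
      refine ⟨-(c * e), ?_⟩
      convert add_mem hc (J.mul_mem_left (c * x ^ m * e) (h1 m)) using 1
      linear_combination (-c * x ^ m * D^[m] f) * he
  have h4 : (Ideal.Quotient.mk J f) ∈ (⨅ m : ℕ, Ideal.span {x} ^ m • ⊤ : Submodule O (O ⧸ J)) := by
    refine (Submodule.mem_iInf _).2 fun m => ?_
    obtain ⟨c, hc⟩ := h3 m
    rw [Ideal.Quotient.eq.2 hc, Ideal.span_singleton_pow, mul_comm c, mul_assoc]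
    exact Submodule.smul_mem_smul (Ideal.mem_span_singleton_self _) (Submodule.mem_top
      (x := Ideal.Quotient.mk J (c * D^[m] f)))
  rw [Ideal.iInf_pow_smul_eq_bot_of_isLocalRing _ fun h => hx (Ideal.span_singleton_eq_top.1 h),
    Submodule.mem_bot] at h4
  exact Ideal.Quotient.eq_zero_iff_mem.1 h4

end Krull

/-! ### Local rings of smooth schemes -/

section Stalk

variable {k : Type u} [Field k] {X : Scheme.{u}} (f : X ⟶ Spec (CommRingCat.of k)) (p : X)

/-- The constants of the ground field, in a local ring of a scheme. -/
def stalkScalar : k →+* X.presheaf.stalk p :=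
  (X.presheaf.germ ⊤ p trivial).hom.comp
    (f.appTop.hom.comp (Scheme.ΓSpecIso (CommRingCat.of k)).inv.hom)

/-- The local ring is a localization of the coordinate ring of an affine neighbourhood, which is
smooth and of finite type over the field; both properties pass to localizations. -/
theorem stalk_formallySmooth [Smooth f] :
    IsNoetherianRing (X.presheaf.stalk p) ∧ (stalkScalar f p).FormallySmooth := by
  obtain ⟨_, ⟨V, hV, rfl⟩, hpV, -⟩ := X.isBasis_affineOpens.exists_subset_of_mem_open
    (Set.mem_univ p) isOpen_univ
  let ψ : k →+* Γ(X, V) := (f.appLE ⊤ V le_top).hom.comp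
    (Scheme.ΓSpecIso (CommRingCat.of k)).inv.hom
  have hψ : ψ.Smooth :=
    (RingHom.Smooth.of_bijective (ConcreteCategory.bijective_of_isIso
      (Scheme.ΓSpecIso (CommRingCat.of k)).inv)).comp
        (f.smooth_appLE (isAffineOpen_top _) hV le_top)
  have hcomp : stalkScalar f p = (X.presheaf.germ V p hpV).hom.comp ψ := by
    have h1 : f.appTop ≫ X.presheaf.germ ⊤ p trivial
        = f.appLE ⊤ V le_top ≫ X.presheaf.germ V p hpV := by
      change f.app ⊤ ≫ _ = _
      rw [Scheme.Hom.app_eq_appLE, ← f.appLE_map le_top (homOfLE le_top : V ⟶ ⊤).op,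
        Category.assoc, TopCat.Presheaf.germ_res]
      rfl
    ext c
    exact congrArg (fun φ => φ.hom ((Scheme.ΓSpecIso (CommRingCat.of k)).inv.hom c)) h1
  let y : V := ⟨p, hpV⟩
  let : Algebra Γ(X, V) (X.presheaf.stalk p) :=
    TopCat.Presheaf.algebra_section_stalk X.presheaf y
  have hloc : IsLocalization.AtPrime (X.presheaf.stalk p) (hV.primeIdealOf y).asIdeal :=
    hV.isLocalization_stalk y
  have hfin := hψ.2
  algebraize [ψ]
  have : IsNoetherianRing Γ(X, V) := Algebra.FiniteType.isNoetherianRing k _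
  refine ⟨IsLocalization.isNoetherianRing (hV.primeIdealOf y).asIdeal.primeCompl
    (X.presheaf.stalk p) inferInstance, ?_⟩
  rw [hcomp]
  refine RingHom.FormallySmooth.comp hψ.1 ?_
  exact RingHom.formallySmooth_algebraMap.2
    (Algebra.FormallySmooth.of_isLocalization (Rₘ := X.presheaf.stalk p)
      (hV.primeIdealOf y).asIdeal.primeCompl)

end Stalk

end

section

/-! ### Derivations along a homomorphism -/

section DerivationAlong

variable {k O M : Type*} [Field k] [CommRing O] [CommRing M] {n : ℕ}

/-- An additive map that satisfies the Leibniz rule and kills the constants is a derivation. -/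
def derivationOfAdditive [Algebra k O] [Module O M] [Module k M] [IsScalarTower k O M] (D : O →+ M)
    (hD : ∀ a b, D (a * b) = a • D b + b • D a) (hs : ∀ c, D (algebraMap k O c) = 0) :
    Derivation k O M :=
  Derivation.mk' { D with
    map_smul' := fun c a => by
      change D (c • a) = c • D a
      rw [Algebra.smul_def, hD, hs, smul_zero, add_zero, algebraMap_smul] } hD

/-- `M` is regarded as an `O`-module through `π`, so that `D` becomes a derivation over the ground
field. Formal smoothness makes the module of differentials projective, hence detected by its dual,
that is by derivations of `O`, which are controlled by `huniq`. -/
theorem eq_zero_of_leibniz_along {φ : k →+* O} (hφ : φ.FormallySmooth) (π : O →+* M)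
    {x : Fin n → O} {pd : Fin n → Derivation ℤ O O} (hpd : ∀ j c, pd j (φ c) = 0)
    (hpdx : ∀ i j, pd i (x j) = if i = j then 1 else 0)
    (huniq : ∀ D : Derivation ℤ O O, (∀ c, D (φ c) = 0) → (∀ j, D (x j) = 0) → D = 0)
    (D : O →+ M) (hD : ∀ a b, D (a * b) = π a * D b + π b * D a) (hs : ∀ c, D (φ c) = 0)
    (hx : ∀ j, D (x j) = 0) (a : O) : D a = 0 := by
  algebraize [φ]
  let _ : Module O M := Module.compHom M π
  let _ : Module k M := Module.compHom M (π.comp φ)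
  have : IsScalarTower k O M := ⟨fun c a m => by
    change π (φ c * a) * m = π (φ c) * (π a * m)
    rw [map_mul, mul_assoc]⟩
  have : Module.Projective O Ω[O⁄k] := Algebra.FormallySmooth.projective_kaehlerDifferential
  refine derivation_eq_zero_of_coord (x := x) (D := fun i => derivationOfAdditive
    (pd i : O →+ O) (fun a b => (pd i).leibniz a b) (hpd i)) (d := derivationOfAdditive D hD hs)
    hpdx (fun d hd => ?_) hx a
  have h := huniq (d.restrictScalars ℤ) (fun c => d.map_algebraMap c) hd
  ext a
  exact congrArg (fun d : Derivation ℤ O O => d a) h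

end DerivationAlong

/-! ### The algebraic geometry is regular -/

section AlgebraicRegular

variable {k : Type u} [Field k]

theorem isUnit_natCast_stalk [CharZero k] {X : Scheme.{u}} (f : X ⟶ Spec (CommRingCat.of k))
    (p : X) (m : ℕ) (hm : m ≠ 0) : IsUnit (m : X.presheaf.stalk p) := by
  rw [← map_natCast (stalkScalar f p) m]
  exact (Nat.cast_ne_zero.2 hm : (m : k) ≠ 0).isUnit.map _

theorem stalkMap_stalkScalar {X Y : Scheme.{u}} {f : X ⟶ Spec (CommRingCat.of k)}
    {g : Y ⟶ Spec (CommRingCat.of k)} (h : X ⟶ Y) (w : h ≫ g = f) (p : X) (c : k) :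
    (h.stalkMap p).hom (stalkScalar g (h p) c) = stalkScalar f p c := by
  subst w
  have h1 : g.appTop ≫ Y.presheaf.germ ⊤ (h p) (TopologicalSpace.Opens.mem_top _) ≫ h.stalkMap p
      = (h ≫ g).appTop ≫ X.presheaf.germ ⊤ p (TopologicalSpace.Opens.mem_top _) := by
    rw [Scheme.Hom.germ_stalkMap, Scheme.Hom.comp_appTop, Category.assoc]
    rfl
  exact congrArg (fun φ => φ.hom ((Scheme.ΓSpecIso (CommRingCat.of k)).inv.hom c)) h1

variable [CharZero k]

theorem algebraicGeometry_isRegular : (algebraicGeometry k).IsRegular where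
  isUnit_natCast X p m hm := isUnit_natCast_stalk X.1.hom p m hm
  isLocalHom_pull f p := f.left.toLRSHom.prop p
  image_scalars {m n X Y} f p := by
    have h : ∀ c, (algebraicGeometry k).pull f p (stalkScalar Y.1.hom (f.left p) c)
        = stalkScalar X.1.hom p c := stalkMap_stalkScalar f.left (Over.w f) p
    ext φ
    constructor
    · rintro ⟨_, ⟨c, rfl⟩, rfl⟩
      exact ⟨c, (h c).symm⟩
    · rintro ⟨c, rfl⟩
      exact ⟨_, ⟨c, rfl⟩, h c⟩
  deriv_ext {m n X Y} f p c D hD hs hx := by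
    have := Y.2
    have := SmoothOfRelativeDimension.smooth n Y.1.hom
    exact eq_zero_of_leibniz_along (stalk_formallySmooth Y.1.hom (f.left p)).2
      ((algebraicGeometry k).pull f p) (fun j a => c.pd_scalar j _ ⟨a, rfl⟩) c.pd_x
      (fun D hD hx => c.pd_unique D (by rintro _ ⟨a, rfl⟩; exact hD a) hx) D hD
      (fun a => hs _ ⟨a, rfl⟩) hx
  mem_of_mul_mem {n X p} c i j hij f h := by
    have := X.2
    have := SmoothOfRelativeDimension.smooth n X.1.hom
    have hN : IsNoetherianRing ((algebraicGeometry k).Stalk X p) :=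
      (stalk_formallySmooth X.1.hom p).1
    refine mem_of_mul_mem_of_derivation (O := (algebraicGeometry k).Stalk X p)
      (isUnit_natCast_stalk X.1.hom p) (c.pd i)
      (fun a ha => ?_) ((c.pd_x i i).trans (if_pos rfl)) h
    exact derivation_mem_span (s := {c.x j})
      (by rintro _ rfl; rw [c.pd_x, if_neg hij]; exact zero_mem _) ha
  eq_zero_of_mul {n X p} c i f h := by
    have := X.2
    have := SmoothOfRelativeDimension.smooth n X.1.hom
    have hN : IsNoetherianRing ((algebraicGeometry k).Stalk X p) :=
      (stalk_formallySmooth X.1.hom p).1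
    -- That a coordinate is a nonzerodivisor is the cancellation statement for the zero ideal.
    refine mem_of_mul_mem_of_derivation (O := (algebraicGeometry k).Stalk X p)
      (isUnit_natCast_stalk X.1.hom p) (c.pd i) (J := ⊥)
      (fun a ha => ?_) ((c.pd_x i i).trans (if_pos rfl)) h
    rw [Ideal.mem_bot.1 ha, map_zero]
    exact zero_mem _
  map_id _ _ := rfl
  map_comp _ _ _ := rfl
  pullAt_id X p q h h' φ := by
    subst h'
    exact congrArg (fun ψ => ψ.hom φ) (Scheme.Hom.stalkMap_id X.1.left p)
  pullAt_comp f g p q r h h₁ h₂ φ := by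
    subst h₁ h₂
    exact congrArg (fun ψ => ψ.hom φ) (Scheme.Hom.stalkMap_comp f.left g.left p)

end AlgebraicRegular

theorem Setting.geometry_isRegular : ∀ 𝒮 : Setting.{u}, 𝒮.geometry.IsRegular
  | @Setting.algebraic _ _ _ => algebraicGeometry_isRegular
  | .realAnalytic => analyticGeometry_isRegular
  | .complexAnalytic => analyticGeometry_isRegular

end

end LogFitting

end

theorem proposition7p2 (𝒮 : Setting) {r : ℕ}
    (U : 𝒮.geometry.Obj 3) (M : 𝒮.geometry.Obj (r + 2)) (σ : 𝒮.geometry.Hom U M)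
    (E D : Set (IdealFamily U)) (a : 𝒮.geometry.Pt U) (P : PreparedForm E σ a)
    (hD : P.IsDeclaredDivisor D) (hsnc : IsSNC D)
    (U' : 𝒮.geometry.Obj 3) (τ : 𝒮.geometry.Hom U' U) (E' D' : Set (IdealFamily U'))
    (hτ : BlowupSequence E D τ E' D')
    (b : 𝒮.geometry.Pt U') (hb : IsClosed {b}) (hba : 𝒮.geometry.map τ b = a)
    (hI : IsPrincipalMonomial D' b (P.declaredIdeal.map (pullAt τ hba))) :
    IsPrincipalMonomial E' b (P.declaredIdeal.map (pullAt τ hba)) ∧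
      ∀ (c : Coord U' b) (S : Finset (Fin 3)), Adapted E' b c S →
        ∀ z : Coord M (𝒮.geometry.map (𝒮.geometry.comp τ σ) b),
          rho (𝒮.geometry.comp τ σ) b c S z < P.rhoValue :=
  main_of_isRegular 𝒮.geometry_isRegular P hD hτ b hba hI
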